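/- Let $M$ be a compact connected smooth manifold, possibly with boundary, and let $\chi\in H^1(M;\mathbb Z)=\operatorname{Hom}(\pi_1(M),\mathbb Z)$ be an epimorphism. Let $\Sigma\subset M$ be a Seifert manifold for $(M,\chi)$, i.e. a connected properly embedded cooriented hypersurface Poincaré–Lefschetz dual to $\chi$; explicitly, $\Sigma=f^{-1}(1)$ is connected and nonempty, where $f:M\to S^1$ is a smooth map representing $\chi$ under $[M,S^1]=H^1(M;\mathbb Z)$ and $1$ is a regular value of $f$ and of $f|_{\partial M}$. (This includes the case where $\partial M\cong P\times S^1$, $f|_{\partial M}$ is the projection to $S^1$, and $\partial\Sigma=P\times\{1\}$.) Let $E_\Sigma$ be $M$ slit along $\Sigma$, with its incoming and outgoing copies of $\Sigma$. Let $N$ be a compact smooth submanifold in the interior of $M$, possibly with boundary, such that $\chi$ is nontrivial on $\pi_1$ of some component of $N$, and such that $\Sigma$ is transverse to $N$ and to $\partial N$. For $d\ge 1$ let $M_d\to M$ be the $d$-fold cyclic cover associated to $\chi$ (the connected covering belonging to the subgroup $\chi^{-1}(d\mathbb Z)$ of $\pi_1(M)$), and let $N_d\subset M_d$ be the preimage of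 $N$. Let $G$ be a finite group. Let $\hat Z=\hat Z_G(E_\Sigma,N\cap E_\Sigma)$ be the square matrix of nonnegative integers, with rows and columns indexed by $\operatorname{Hom}(\pi_1(\Sigma/(\Sigma\cap N)),G)$, of the linear map $$\gamma\longmapsto\sum_{\delta\in\operatorname{Hom}(\pi_1(E_\Sigma/(N\cap E_\Sigma)),G),\ \delta_1=\gamma}\delta_2,$$ where $\delta_1$ and $\delta_2$ are the restrictions of $\delta$ along the inclusions of $\Sigma/(\Sigma\cap N)$ as the incoming and the outgoing copy, and where all fundamental groups are based at the point to which the subspace is collapsed. Thus the entry of $\hat Z$ at $(\gamma',\gamma)$ is the number of $\delta$ with $\delta_1=\gamma$ and $\delta_2=\gamma'$. Then the sets $\operatorname{Hom}(\pi_1(\Sigma/(\Sigma\cap N)),G)$, $\operatorname{Hom}(\pi_1(E_\Sigma/(N\cap E_\Sigma)),G)$ and $\operatorname{Hom}(\pi_1(M_d/N_d),G)$, $d\ge1$, are finite, and if $\sum_{i=0}^{r}c_i x^i$ (with $c_r=1$) is the characteristic polynomial of $\hat Z$, then $$\sum_{i=0}^{r}c_i\cdot\#\operatorname{Hom}(\pi_1(M_{d+i}/N_{d+i}),G)=0\qquad\text{for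 all } d\ge 1 .$$ -/

import Mathlib

open scoped Manifold ContDiff

noncomputable section

namespace CyclicTQFT

/-! ### The quotient `X / A` as a pointed space -/

/-- The two summands of `X ⊔ {*}` are glued along `A`: all points of `A` are identified with `*`. -/
def collapseRel {X : Type*} (A : Set X) : X ⊕ Unit → X ⊕ Unit → Prop
  | Sum.inl x, Sum.inr _ => x ∈ A
  | _, _ => False

/-- The quotient space `X / A`, with `A` collapsed to a point `*`, as the quotient of `X ⊔ {*}` that
identifies the points of `A` with `*`. For nonempty `A` this is the usual quotient space of `X`; the
present form has a base point that does not depend on a choice of a point of `A`. -/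
def Collapse {X : Type*} (A : Set X) : Type _ := Quot (collapseRel A)

instance {X : Type*} [TopologicalSpace X] (A : Set X) : TopologicalSpace (Collapse A) :=
  inferInstanceAs (TopologicalSpace (Quot (collapseRel A)))

/-- The point `[A]` of `X / A`. -/
def Collapse.pt {X : Type*} (A : Set X) : Collapse A := Quot.mk _ (Sum.inr ())

/-- The projection `X → X / A`. -/
def Collapse.mk {X : Type*} (A : Set X) (x : X) : Collapse A := Quot.mk _ (Sum.inl x)

/-- The pointed map `X / A → Y / B` induced by a continuous map of pairs `(X, A) → (Y, B)`. -/
def Collapse.map {X Y : Type*} [TopologicalSpace X] [TopologicalSpace Y] {A : Set X} {B : Set Y}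
    (g : C(X, Y)) (h : Set.MapsTo g A B) : C(Collapse A, Collapse B) where
  toFun := Quot.map (Sum.map g id) (by
    rintro (x | x) (y | y) hxy
    · exact hxy.elim
    · exact h hxy
    · exact hxy.elim
    · exact hxy.elim)
  continuous_toFun := by
    refine continuous_quot_lift _ ?_
    exact continuous_quot_mk.comp (by fun_prop)

/-- The group `π₁(X / A, [A])`. -/
abbrev RelPi {X : Type*} [TopologicalSpace X] (A : Set X) : Type _ :=
  FundamentalGroup (Collapse A) (Collapse.pt A)

/-- The homomorphism `π₁(X / A, [A]) → π₁(Y / B, [B])` induced by a map of pairs. -/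
def RelPi.map {X Y : Type*} [TopologicalSpace X] [TopologicalSpace Y] {A : Set X} {B : Set Y}
    (g : C(X, Y)) (h : Set.MapsTo g A B) : RelPi A →* RelPi B :=
  FundamentalGroup.mapOfEq (Collapse.map g h) rfl

/-! ### The modified finite group TQFT on an endomorphism -/

/-- Let `(X, W)` be a cobordism from `(Y, U)` to itself, where `j₀` and `j₁` include `(Y, U)` in
`(X, W)` as the incoming and as the outgoing boundary. This is the matrix of the map
`γ ↦ ∑ δ₁`, the sum over all `δ : π₁(X / W) → G` with `δ₀ = γ`, on the free abelian group with basis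
`Hom(π₁(Y / U), G)`; here `δ₀`, `δ₁` are the restrictions of `δ` along `j₀`, `j₁`. The entry at
`(γ', γ)` is the coefficient of `γ'` in the image of `γ`. -/
def zHat (G : Type*) [Group G] {X Y : Type*} [TopologicalSpace X] [TopologicalSpace Y]
    {W : Set X} {U : Set Y} (j₀ j₁ : C(Y, X)) (h₀ : Set.MapsTo j₀ U W) (h₁ : Set.MapsTo j₁ U W) :
    Matrix (RelPi U →* G) (RelPi U →* G) ℕ :=
  Matrix.of fun γ' γ => Nat.card {δ : RelPi W →* G //
    δ.comp (RelPi.map j₀ h₀) = γ ∧ δ.comp (RelPi.map j₁ h₁) = γ'}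

/-! ### Classes in `H¹(M; ℤ)` and cyclic covers -/

section Topological

variable {M : Type*} [TopologicalSpace M] {x₀ : M}

/-- The value of `χ ∈ H¹(M; ℤ) = Hom(π₁(M), ℤ)` on a loop. -/
def eval (χ : FundamentalGroup M x₀ →* Multiplicative ℤ) (γ : Path x₀ x₀) : ℤ :=
  (χ (FundamentalGroup.fromPath (Path.Homotopic.Quotient.mk γ))).toAdd

/-- `f : M → S¹` represents `χ` under `[M, S¹] = H¹(M; ℤ)`: for every loop `γ`, the degree of
`f ∘ γ`, computed by a lift `θ` of `f ∘ γ` along `t ↦ exp (2πit)`, is `χ(γ)`. -/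
def Represents (f : M → Circle) (χ : FundamentalGroup M x₀ →* Multiplicative ℤ) : Prop :=
  ∀ (γ : Path x₀ x₀) (θ : C(unitInterval, ℝ)),
    (∀ t, f (γ t) = Circle.exp (2 * Real.pi * θ t)) → θ 1 - θ 0 = eval χ γ

/-- The restriction of `χ` along `ι : N → M` is nontrivial: on some component of `N` there is a loop
whose image in `M`, joined to the base point by some path, has nonzero value. -/
def NontrivialOn {N : Type*} [TopologicalSpace N]
    (χ : FundamentalGroup M x₀ →* Multiplicative ℤ) (ι : C(N, M)) : Prop :=
  ∃ (y : N) (γ : Path y y) (σ : Path x₀ (ι y)),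
    eval χ ((σ.trans (γ.map ι.continuous)).trans σ.symm) ≠ 0

/-- `p : M' → M` is the `d`-fold cyclic cover of `M` associated to `χ`: the connected covering that
belongs to the subgroup `χ⁻¹(dℤ)` of `π₁(M)`, i.e. a loop of `M` at `x₀` lifts to a closed loop
exactly when `d` divides its value under `χ`. -/
structure IsCyclicCover (χ : FundamentalGroup M x₀ →* Multiplicative ℤ) (d : ℕ)
    {M' : Type*} [TopologicalSpace M'] (p : M' → M) : Prop where
  isCoveringMap : IsCoveringMap p
  connected : ConnectedSpace M'
  lift_closed_iff : ∀ e : M', p e = x₀ → ∀ γ : Path x₀ x₀,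
    (∃ γ' : Path e e, ∀ t, p (γ' t) = γ t) ↔ (d : ℤ) ∣ eval χ γ

end Topological

/-! ### Seifert manifolds and transverse submanifolds -/

section Smooth

variable {m : ℕ} [NeZero m] {M : Type*} [TopologicalSpace M]
  [ChartedSpace (EuclideanHalfSpace m) M]

variable (m) in
/-- The vectors in `T_x M` tangent to the boundary, for a boundary point `x` of a manifold modelled
on the half-space `{v | 0 ≤ v 0}` (in the coordinates of the preferred chart at `x`). -/
def boundaryTangent (x : M) : Submodule ℝ (TangentSpace (𝓡∂ m) x) :=
  LinearMap.ker (EuclideanSpace.proj (0 : Fin m) : EuclideanSpace ℝ (Fin m) →L[ℝ] ℝ).toLinearMap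

/-- A Seifert manifold `Σ` for `(M, χ)`: a connected properly embedded cooriented hypersurface that
is Poincaré-Lefschetz dual to `χ`. It is given as `Σ = f⁻¹(1)` where the smooth map `f : M → S¹`
represents `χ` and `1` is a regular value of `f` and of the restriction of `f` to `∂M`. -/
structure SeifertManifold (m : ℕ) [NeZero m] {M : Type*} [TopologicalSpace M]
    [ChartedSpace (EuclideanHalfSpace m) M] {x₀ : M}
    (χ : FundamentalGroup M x₀ →* Multiplicative ℤ) where
  /-- The map to the circle. -/
  f : M → Circle
  smooth : ContMDiff (𝓡∂ m) (𝓡 1) ∞ f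
  represents : Represents f χ
  regular : ∀ x, f x = 1 → mfderiv (𝓡∂ m) (𝓡 1) f x ≠ 0
  regular_boundary : ∀ x, f x = 1 → (𝓡∂ m).IsBoundaryPoint x →
    ∃ v ∈ boundaryTangent m x, mfderiv (𝓡∂ m) (𝓡 1) f x v ≠ 0
  connected : IsConnected {x | f x = 1}

namespace SeifertManifold

variable {x₀ : M} {χ : FundamentalGroup M x₀ →* Multiplicative ℤ} (S : SeifertManifold m χ)

/-- The Seifert manifold `Σ` as a space. -/
abbrev Surface : Type _ := {x : M // S.f x = 1}

/-- `M` slit along `Σ`: the pullback of `f : M → S¹` along `[0, 1] → S¹`, `t ↦ exp (2πit)`. A point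
of `M` off `Σ` has one preimage in it and a point of `Σ` has two, at `t = 0` and at `t = 1`. -/
abbrev Slit : Type _ :=
  {q : M × unitInterval // S.f q.1 = Circle.exp (2 * Real.pi * (q.2 : ℝ))}

/-- The incoming copy of `Σ` in `M` slit along `Σ`. -/
def incoming : C(S.Surface, S.Slit) where
  toFun x := ⟨(x.1, 0), by simpa using x.2⟩
  continuous_toFun := by fun_prop

/-- The outgoing copy of `Σ` in `M` slit along `Σ`. -/
def outgoing : C(S.Surface, S.Slit) where
  toFun x := ⟨(x.1, 1), by simpa using x.2⟩
  continuous_toFun := by fun_prop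

/-- The subspace `Σ ∩ A` of `Σ`. -/
def surfaceInter (A : Set M) : Set S.Surface := {x | x.1 ∈ A}

/-- The subspace `A ∩ E` of `E`, the manifold `M` slit along `Σ`: the part that lies over `A`. -/
def slitInter (A : Set M) : Set S.Slit := {q | q.1.1 ∈ A}

/-- The nonnegative integer matrix that the modified finite group TQFT assigns to the endomorphism
`(E, A ∩ E)` of `(Σ, Σ ∩ A)`, where `E` is `M` slit along `Σ`. -/
def matrix (G : Type*) [Group G] (A : Set M) :
    Matrix (RelPi (S.surfaceInter A) →* G) (RelPi (S.surfaceInter A) →* G) ℕ :=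
  zHat G (W := S.slitInter A) (U := S.surfaceInter A) S.incoming S.outgoing
    (fun _ hx => hx) (fun _ hx => hx)

end SeifertManifold

/-- `ι : N → M` is a smooth embedding onto a submanifold in the interior of `M`. Both manifolds may
have boundary. -/
structure IsInteriorSubmanifold (k m : ℕ) [NeZero k] [NeZero m] {N M : Type*}
    [TopologicalSpace N] [ChartedSpace (EuclideanHalfSpace k) N]
    [TopologicalSpace M] [ChartedSpace (EuclideanHalfSpace m) M] (ι : C(N, M)) : Prop where
  smooth : ContMDiff (𝓡∂ k) (𝓡∂ m) ∞ ι
  isEmbedding : Topology.IsEmbedding ι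
  immersion : ∀ y, Function.Injective (mfderiv (𝓡∂ k) (𝓡∂ m) ι y)
  interior : ∀ y, (𝓡∂ m).IsInteriorPoint (ι y)

/-- `Σ` is transverse to the submanifold `ι : N → M` (and to its boundary, if there is one):
`T_y N + T_y Σ = T_y M` at the points of `N ∩ Σ`, where `T_y Σ = ker (d_y f)`. -/
structure SeifertManifold.IsTransverse (k : ℕ) [NeZero k] {N : Type*} [TopologicalSpace N]
    [ChartedSpace (EuclideanHalfSpace k) N] {x₀ : M}
    {χ : FundamentalGroup M x₀ →* Multiplicative ℤ} (S : SeifertManifold m χ) (ι : C(N, M)) :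
    Prop where
  inside : ∀ y, S.f (ι y) = 1 →
    LinearMap.range (mfderiv (𝓡∂ k) (𝓡∂ m) ι y).toLinearMap ⊔
      LinearMap.ker (mfderiv (𝓡∂ m) (𝓡 1) S.f (ι y)).toLinearMap = ⊤
  boundary : ∀ y, S.f (ι y) = 1 → (𝓡∂ k).IsBoundaryPoint y →
    (boundaryTangent k y).map (mfderiv (𝓡∂ k) (𝓡∂ m) ι y).toLinearMap ⊔
      LinearMap.ker (mfderiv (𝓡∂ m) (𝓡 1) S.f (ι y)).toLinearMap = ⊤

end Smooth

end CyclicTQFT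

end

/-! For d ≥ 1 the number of homomorphisms π₁(M_d/N_d) → G is the trace of Ẑ^d. Multiplying the
Cayley–Hamilton identity of Ẑ by Ẑ^d and taking traces then gives the recursion
(`sum_charpoly_coeff_mul_trace`).

For the trace, Ẑ is read as the counting matrix of a finite directed graph: the vertices are the
homomorphisms on π₁(Σ/(Σ ∩ N)), and each δ on π₁(E/(N ∩ E)) is an edge from δ₁ to δ₂. The trace of
Ẑ^d counts closed walks of length d (`trace_pow_eq_card`). Since M_d consists of d copies of E glued
in a cycle, it remains to see that a homomorphism on π₁(M_d/N_d) is the same as a cyclic sequence of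
edges with matching ends.

Instead of a van Kampen argument on quotient spaces, Hom(π₁(X/A), G) is replaced by the relative
nonabelian cohomology `RelH1 G A`: flat G-bundles on X trivialised along A, presented by germs of
parallel transport, modulo gauge transformations equal to 1 on A. Holonomy on X/A together with
excision gives a natural bijection (`IsTamePair.homEquiv`, `IsTamePair.homEquiv_comp`). Gluing is
then elementary (`CyclicGluing.bijective_pull`): matching classes differ along a seam by a gauge
transformation that is 1 on Σ ∩ N, and it is unique because Σ is connected and Σ ∩ N is nonempty.
Uniqueness is what makes gluing injective. The intersection is nonempty because otherwise f would
have a logarithm on N and χ would vanish there (`SeifertManifold.nonempty_inter`).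

The comparison with π₁ and the finiteness need local control of the pairs, and `ConvexModel`
supplies all of it: a chart onto a relatively open ball in a closed convex set that takes A to a
closed convex set. Regularity and transversality allow the angle of f to be made linear in such a
chart, so a hyperplane or half-space section gives models for Σ and for E, while covers inherit the
models of M.

Finally, M_d is identified with the space of pairs (x, z) with z^d = f(x)
(`IsCyclicCover.exists_homeomorph`), which the argument of z cuts into d copies of E. -/

namespace CyclicTQFT

open Set Filter Topology

section Cohomology

open unitInterval

/-! ### Germ cocycles, flat sections and holonomy. -/

section Cocycle

variable {X Y T G : Type*} [TopologicalSpace X] [TopologicalSpace Y] [TopologicalSpace T] [Group G]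

/-- A `G`-valued germ cocycle on `X`: a flat `G`-bundle, presented by the parallel transport
`c p x` from `p` to nearby points `x`. Only the germ of `c p` at `p` matters. -/
def IsCocycle (c : X → X → G) : Prop :=
  ∀ p, ∀ᶠ q in 𝓝 p, ∀ᶠ x in 𝓝 q, c p x = c q x * c p q

/-- `g` is a gauge transformation from `c` to `c'`. -/
def IsGauge (c c' : X → X → G) (g : X → G) : Prop :=
  ∀ p, ∀ᶠ x in 𝓝 p, c' p x = g x * c p x * (g p)⁻¹

/-- `g` is a flat section of `c` over `K`. -/
def FlatOn (c : X → X → G) (g : X → G) (K : Set X) : Prop :=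
  ∀ p ∈ K, ∀ᶠ x in 𝓝[K] p, g x = c p x * g p

/-- The cocycle identity at q = x = p makes c p p idempotent. -/
theorem IsCocycle.self {c : X → X → G} (hc : IsCocycle c) (p : X) : c p p = 1 := by
  have h := (hc p).self_of_nhds.self_of_nhds
  simpa using h

theorem IsCocycle.comp {c : X → X → G} (hc : IsCocycle c) {φ : T → X} (hφ : Continuous φ) :
    IsCocycle fun s t => c (φ s) (φ t) := by
  intro s
  filter_upwards [hφ.continuousAt.eventually (hc (φ s))] with t ht
  exact hφ.continuousAt.eventually ht

/-- The parallel transport from a fixed point is flat near that point. -/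
theorem IsCocycle.exists_flatOn {c : X → X → G} (hc : IsCocycle c) (p : X) :
    ∃ V : Set X, IsOpen V ∧ p ∈ V ∧ FlatOn c (c p) V := by
  obtain ⟨V, hV, hVo, hp⟩ := eventually_nhds_iff.1 (hc p)
  exact ⟨V, hVo, hp, fun q hq => mem_nhdsWithin_of_mem_nhds (hV q hq)⟩

theorem IsGauge.refl (c : X → X → G) : IsGauge c c 1 := fun p => by simp

theorem IsGauge.symm {c c' : X → X → G} {g : X → G} (h : IsGauge c c' g) :
    IsGauge c' c g⁻¹ := fun p => by
  filter_upwards [h p] with x hx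
  simp [hx, mul_assoc]

theorem IsGauge.trans {c c' c'' : X → X → G} {g g' : X → G} (h : IsGauge c c' g)
    (h' : IsGauge c' c'' g') : IsGauge c c'' (g' * g) := fun p => by
  filter_upwards [h p, h' p] with x hx hx'
  simp [hx, hx', mul_assoc]

theorem IsGauge.comp {c c' : X → X → G} {g : X → G} (h : IsGauge c c' g) {φ : T → X}
    (hφ : Continuous φ) :
    IsGauge (fun s t => c (φ s) (φ t)) (fun s t => c' (φ s) (φ t)) (g ∘ φ) := fun s =>
  hφ.continuousAt.eventually (h (φ s))

theorem IsCocycle.gauge {c : X → X → G} (hc : IsCocycle c) (g : X → G) :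
    IsCocycle fun p x => g x * c p x * (g p)⁻¹ := fun p => by
  filter_upwards [hc p] with q hq
  filter_upwards [hq] with x hx
  simp [hx, mul_assoc]

theorem FlatOn.mono {c : X → X → G} {g : X → G} {K L : Set X} (h : FlatOn c g K) (hL : L ⊆ K) :
    FlatOn c g L := fun p hp => nhdsWithin_mono p hL (h p (hL hp))

theorem FlatOn.comp {c : X → X → G} {g : X → G} {K : Set X} (h : FlatOn c g K) {φ : T → X}
    (hφ : Continuous φ) {L : Set T} (hL : MapsTo φ L K) :
    FlatOn (fun s t => c (φ s) (φ t)) (g ∘ φ) L := fun s hs =>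
  (hφ.continuousWithinAt.tendsto_nhdsWithin hL).eventually (h (φ s) (hL hs))

theorem FlatOn.mul_const {c : X → X → G} {g : X → G} {K : Set X} (h : FlatOn c g K) (a : G) :
    FlatOn c (fun x => g x * a) K := fun p hp => by
  filter_upwards [h p hp] with x hx
  simp [hx, mul_assoc]

theorem FlatOn.gauge {c c' : X → X → G} {g u : X → G} {K : Set X} (h : FlatOn c g K)
    (hu : IsGauge c c' u) : FlatOn c' (u * g) K := fun p hp => by
  filter_upwards [h p hp, mem_nhdsWithin_of_mem_nhds (hu p)] with x hx hx'
  simp [hx, hx', mul_assoc]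

theorem FlatOn.congr {c : X → X → G} {g g' : X → G} {K : Set X} (h : FlatOn c g K)
    (hg : EqOn g g' K) : FlatOn c g' K := fun p hp => by
  filter_upwards [h p hp, self_mem_nhdsWithin] with x hx hxK
  rw [← hg hp, ← hg hxK, hx]

/-- A locally constant function on a preconnected set is constant. -/
theorem eq_of_eventually_eq {α : Type*} {K : Set X} (hK : IsPreconnected K) {u : X → α}
    (hu : ∀ p ∈ K, ∀ᶠ x in 𝓝[K] p, u x = u p) {p q : X} (hp : p ∈ K) (hq : q ∈ K) :
    u p = u q := by
  have : PreconnectedSpace K := isPreconnected_iff_preconnectedSpace.1 hK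
  have hl : IsLocallyConstant fun x : K => u x := by
    rw [IsLocallyConstant.iff_eventually_eq]
    rintro ⟨x, hx⟩
    rw [nhds_subtype_eq_comap_nhdsWithin]
    exact (hu x hx).comap _
  exact hl.apply_eq_of_preconnectedSpace ⟨p, hp⟩ ⟨q, hq⟩

/-- Transport acts on flat sections from the left, so it cancels in g⁻¹g', which is therefore
locally constant. -/
theorem FlatOn.ratio {c : X → X → G} {g g' : X → G} {K : Set X} (h : FlatOn c g K)
    (h' : FlatOn c g' K) (hK : IsPreconnected K) {p q : X} (hp : p ∈ K) (hq : q ∈ K) :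
    (g p)⁻¹ * g' p = (g q)⁻¹ * g' q := by
  refine eq_of_eventually_eq (u := fun x => (g x)⁻¹ * g' x) hK (fun p hp => ?_) hp hq
  filter_upwards [h p hp, h' p hp] with x hx hx'
  simp [hx, hx', mul_assoc]

theorem FlatOn.eqOn {c : X → X → G} {g g' : X → G} {K : Set X} (h : FlatOn c g K)
    (h' : FlatOn c g' K) (hK : IsPreconnected K) {p : X} (hp : p ∈ K) (hpp : g p = g' p) :
    EqOn g g' K := fun q hq => by
  have := h.ratio h' hK hp hq
  rw [hpp, inv_mul_cancel, eq_comm, inv_mul_eq_one] at this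
  exact this

theorem FlatOn.transport_eq {c : X → X → G} {g g' : X → G} {K : Set X} (h : FlatOn c g K)
    (h' : FlatOn c g' K) (hK : IsPreconnected K) {p q : X} (hp : p ∈ K) (hq : q ∈ K) :
    g q * (g p)⁻¹ = g' q * (g' p)⁻¹ := by
  have := h.ratio h' hK hp hq
  rw [inv_mul_eq_iff_eq_mul] at this
  rw [this]; group

/-- Two gauge transformations between the same cocycles that agree at one point agree on a
preconnected space. -/
theorem IsGauge.eq_of_preconnected [PreconnectedSpace X] {c c' : X → X → G} {g g' : X → G}
    (h : IsGauge c c' g) (h' : IsGauge c c' g') {p : X} (hp : g p = g' p) : g = g' := by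
  funext q
  have key : (g p = g' p) = (g q = g' q) := by
    refine eq_of_eventually_eq (u := fun x => g x = g' x) (isPreconnected_univ (α := X))
      -- The quotient of two gauge transformations is conjugated by c from point to point and need
      -- not be locally constant. The proposition that they agree is, so the argument runs on truth
      -- values.
      (fun p _ => ?_) (mem_univ p) (mem_univ q)
    rw [nhdsWithin_univ]
    filter_upwards [h p, h' p] with x hx hx'
    have e : g x * c p x * (g p)⁻¹ = g' x * c p x * (g' p)⁻¹ := hx.symm.trans hx'
    refine propext ⟨fun k => ?_, fun k => ?_⟩
    · rw [k] at e
      simpa using e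
    · rw [k] at e
      simpa using e
  exact key ▸ hp

/-- On the connected overlap the two sections differ by a right constant, which is absorbed into the
second. Closedness makes the condition relative to K void at points off K, and likewise for L. -/
theorem FlatOn.union {c : X → X → G} {K L : Set X} (hK : IsClosed K) (hL : IsClosed L)
    (hKL : IsPreconnected (K ∩ L)) (hne : (K ∩ L).Nonempty) {g g' : X → G}
    (h : FlatOn c g K) (h' : FlatOn c g' L) : ∃ f, FlatOn c f (K ∪ L) := by
  classical
  obtain ⟨p, hp⟩ := hne
  set g'' : X → G := fun x => g' x * ((g' p)⁻¹ * g p) with hg''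
  have h'' : FlatOn c g'' L := h'.mul_const _
  have heq : EqOn g g'' (K ∩ L) :=
    (h.mono inter_subset_left).eqOn (h''.mono inter_subset_right) hKL hp (by simp [hg''])
  have e1 : EqOn (K.piecewise g g'') g K := piecewise_eqOn K g g''
  have e2 : EqOn (K.piecewise g g'') g'' L := fun x hx => by
    by_cases hxK : x ∈ K
    · rw [piecewise_eq_of_mem _ _ _ hxK]; exact heq ⟨hxK, hx⟩
    · rw [piecewise_eq_of_notMem _ _ _ hxK]
  have f1 := h.congr e1.symm
  have f2 := h''.congr e2.symm
  have aux : ∀ {A : Set X}, IsClosed A → FlatOn c (K.piecewise g g'') A → ∀ x,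
      ∀ᶠ y in 𝓝[A] x, K.piecewise g g'' y = c x y * K.piecewise g g'' x := by
    intro A hA hf x
    by_cases hx : x ∈ A
    · exact hf x hx
    · rw [notMem_closure_iff_nhdsWithin_eq_bot.1 (by rwa [hA.closure_eq])]
      exact eventually_bot
  refine ⟨K.piecewise g g'', fun x _ => ?_⟩
  rw [nhdsWithin_union]
  exact eventually_sup.2 ⟨aux hK f1 x, aux hL f2 x⟩

/-- Each c p is flat near p. A Lebesgue grid subordinate to these neighbourhoods is filled cell by
cell into rows and row by row into the square; every overlap is a segment, hence connected. -/
theorem IsCocycle.exists_flatOn_square {c : I × I → I × I → G} (hc : IsCocycle c) :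
    ∃ g, FlatOn c g univ := by
  choose V hVo hpV hV using hc.exists_flatOn
  obtain ⟨t, t0, tm, ⟨n, hn⟩, ht⟩ := exists_monotone_Icc_subset_open_cover_unitInterval_prod_self
    hVo (fun p _ => mem_iUnion.2 ⟨p, hpV p⟩)
  have hcl : ∀ a b : I, IsClosed (Icc a b) := fun a b => isClosed_Icc
  have hpc : ∀ a b : I, IsPreconnected (Icc a b) := fun a b => isPreconnected_Icc
  have row : ∀ m k, ∃ g, FlatOn c g (Icc 0 (t k) ×ˢ Icc (t m) (t (m + 1))) := by
    intro m k
    induction k with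
    | zero =>
      obtain ⟨i, hi⟩ := ht 0 m
      refine ⟨c i, (hV i).mono fun x hx => hi ⟨⟨?_, ?_⟩, hx.2⟩⟩
      · rw [t0]; exact hx.1.1
      · exact hx.1.2.trans (tm (Nat.zero_le _))
    | succ k ih =>
      obtain ⟨g, hg⟩ := ih
      obtain ⟨i, hi⟩ := ht k m
      have hi' := (hV i).mono hi
      have hint : (Icc 0 (t k) ×ˢ Icc (t m) (t (m + 1))) ∩
          (Icc (t k) (t (k + 1)) ×ˢ Icc (t m) (t (m + 1))) =
          ({t k} : Set I) ×ˢ Icc (t m) (t (m + 1)) := by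
        rw [prod_inter_prod, inter_self, Icc_inter_Icc_eq_singleton (by simp) (tm k.le_succ)]
      have hun : (Icc 0 (t k) ×ˢ Icc (t m) (t (m + 1))) ∪
          (Icc (t k) (t (k + 1)) ×ˢ Icc (t m) (t (m + 1))) =
          Icc 0 (t (k + 1)) ×ˢ Icc (t m) (t (m + 1)) := by
        rw [← union_prod, Icc_union_Icc_eq_Icc (by simp) (tm k.le_succ)]
      have := FlatOn.union ((hcl _ _).prod (hcl _ _)) ((hcl _ _).prod (hcl _ _))
        (by rw [hint]; exact isPreconnected_singleton.prod (hpc _ _))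
        (by rw [hint]; exact ⟨(t k, t m), rfl, le_rfl, tm m.le_succ⟩) hg hi'
      rwa [hun] at this
  have col : ∀ k, ∃ g, FlatOn c g (Icc 0 1 ×ˢ Icc 0 (t k)) := by
    intro k
    induction k with
    | zero =>
      obtain ⟨g, hg⟩ := row 0 n
      rw [hn n le_rfl, t0] at hg
      refine ⟨g, hg.mono (prod_mono le_rfl ?_)⟩
      rw [t0]
      exact Icc_subset_Icc_right bot_le
    | succ k ih =>
      obtain ⟨g, hg⟩ := ih
      obtain ⟨g', hg'⟩ := row k n
      rw [hn n le_rfl] at hg'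
      have hint : (Icc (0 : I) 1 ×ˢ Icc 0 (t k)) ∩ (Icc (0 : I) 1 ×ˢ Icc (t k) (t (k + 1))) =
          Icc (0 : I) 1 ×ˢ ({t k} : Set I) := by
        rw [prod_inter_prod, inter_self, Icc_inter_Icc_eq_singleton (by simp) (tm k.le_succ)]
      have hun : (Icc (0 : I) 1 ×ˢ Icc 0 (t k)) ∪ (Icc (0 : I) 1 ×ˢ Icc (t k) (t (k + 1))) =
          Icc (0 : I) 1 ×ˢ Icc 0 (t (k + 1)) := by
        rw [← prod_union, Icc_union_Icc_eq_Icc (by simp) (tm k.le_succ)]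
      have := FlatOn.union ((hcl _ _).prod (hcl _ _)) ((hcl _ _).prod (hcl _ _))
        (by rw [hint]; exact (hpc _ _).prod isPreconnected_singleton)
        (by rw [hint]; exact ⟨(0, t k), ⟨le_rfl, by simp⟩, rfl⟩) hg hg'
      rwa [hun] at this
  obtain ⟨g, hg⟩ := col n
  rw [hn n le_rfl] at hg
  exact ⟨g, hg.mono fun x _ => ⟨⟨bot_le, le_top⟩, bot_le, le_top⟩⟩

theorem IsCocycle.exists_flatOn_interval {c : I → I → G} (hc : IsCocycle c) :
    ∃ g, FlatOn c g univ := by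
  obtain ⟨g, hg⟩ := (hc.comp continuous_fst).exists_flatOn_square (c := fun s t => c s.1 t.1)
  exact ⟨_, hg.comp (φ := fun t : I => (t, (0 : I))) (by fun_prop) (mapsTo_univ _ _)⟩

open Classical in
/-- The holonomy of `c` along `γ`. -/
noncomputable def hol (c : X → X → G) {x y : X} (γ : Path x y) : G :=
  -- For a cocycle the default value is never taken, and the choice of section is immaterial since
  -- two sections differ by a right constant.
  if h : ∃ g, FlatOn (fun s t => c (γ s) (γ t)) g univ then h.choose 1 * (h.choose 0)⁻¹ else 1

theorem hol_eq {c : X → X → G} {x y : X} {γ : Path x y} {g : I → G}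
    (hg : FlatOn (fun s t => c (γ s) (γ t)) g univ) : hol c γ = g 1 * (g 0)⁻¹ := by
  have h : ∃ g, FlatOn (fun s t => c (γ s) (γ t)) g univ := ⟨g, hg⟩
  rw [hol, dif_pos h]
  exact h.choose_spec.transport_eq hg isPreconnected_univ trivial trivial

theorem IsCocycle.exists_flat_path {c : X → X → G} (hc : IsCocycle c) {x y : X} (γ : Path x y) :
    ∃ g, FlatOn (fun s t => c (γ s) (γ t)) g univ :=
  (hc.comp γ.continuous).exists_flatOn_interval

theorem IsCocycle.hol_trans {c : X → X → G} (hc : IsCocycle c) {x y z : X} (γ : Path x y)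
    (γ' : Path y z) : hol c (γ.trans γ') = hol c γ' * hol c γ := by
  obtain ⟨g, hg⟩ := hc.exists_flat_path (γ.trans γ')
  let a : I → I := fun t => ⟨t / 2, by constructor <;> linarith [t.2.1, t.2.2]⟩
  let b : I → I := fun t => ⟨(1 + t) / 2, by constructor <;> linarith [t.2.1, t.2.2]⟩
  have ha : Continuous a := by fun_prop
  have hb : Continuous b := by fun_prop
  have ea : ∀ t, (γ.trans γ') (a t) = γ t := fun t => by
    rw [Path.trans_apply, dif_pos (by simp only [a]; linarith [t.2.2])]
    congr 1; ext; simp [a]; ring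
  have eb : ∀ t, (γ.trans γ') (b t) = γ' t := fun t => by
    rw [Path.trans_apply]
    split_ifs with h
    · have : t = 0 := by
        have h0 : (t : ℝ) = 0 := le_antisymm (by simp only [b] at h; linarith) t.2.1
        exact Subtype.ext h0
      subst this
      refine Eq.trans ?_ (γ.target.trans γ'.source.symm)
      congr 1; ext; simp [b]
    · congr 1; ext; simp [b]; ring
  have h1 := hol_eq (γ := γ) (by simpa only [ea] using hg.comp ha (mapsTo_univ _ univ))
  have h2 := hol_eq (γ := γ') (by simpa only [eb] using hg.comp hb (mapsTo_univ _ univ))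
  have e0 : a 0 = 0 := by ext; simp [a]
  have e1 : a 1 = b 0 := by ext; simp [a, b]
  have e2 : b 1 = 1 := by ext; simp [b]
  rw [h1, h2, hol_eq hg]
  simp [e0, e1, e2, mul_assoc]

theorem IsCocycle.hol_refl {c : X → X → G} (hc : IsCocycle c) (x : X) :
    hol c (Path.refl x) = 1 := by
  rw [hol_eq (g := 1) (fun p _ => by simp [hc.self])]
  simp

theorem IsCocycle.hol_symm {c : X → X → G} (hc : IsCocycle c) {x y : X} (γ : Path x y) :
    hol c γ.symm = (hol c γ)⁻¹ := by
  obtain ⟨g, hg⟩ := hc.exists_flat_path γ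
  rw [hol_eq hg, hol_eq (g := g ∘ σ) (hg.comp (φ := σ) continuous_symm (mapsTo_univ _ _))]
  simp

/-- A flat section of the cocycle pulled back along the homotopy is constant on the two sides where
the homotopy is stationary, so both paths see the same endpoint values. -/
theorem IsCocycle.hol_congr {c : X → X → G} (hc : IsCocycle c) {x y : X} {γ γ' : Path x y}
    (h : γ.Homotopic γ') : hol c γ = hol c γ' := by
  obtain ⟨H⟩ := h
  obtain ⟨g, hg⟩ := (hc.comp H.continuous).exists_flatOn_square (c := fun s t => c (H s) (H t))
  have h0 := hol_eq (γ := γ) (by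
    simpa using hg.comp (φ := fun t : I => ((0 : I), t)) (by fun_prop) (mapsTo_univ _ univ))
  have h1 := hol_eq (γ := γ') (by
    simpa using hg.comp (φ := fun t : I => ((1 : I), t)) (by fun_prop) (mapsTo_univ _ univ))
  have side : ∀ e : I, (∀ s s' : I, H (s, e) = H (s', e)) → g (0, e) = g (1, e) := by
    intro e he
    refine eq_of_eventually_eq (u := fun s => g (s, e)) (isPreconnected_univ (α := I))
      (fun s _ => ?_) trivial trivial
    have := hg.comp (φ := fun s : I => (s, e)) (by fun_prop) (mapsTo_univ _ univ) s trivial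
    filter_upwards [this] with s' hs'
    simpa [he s' s, hc.self] using hs'
  rw [h0, h1]
  simp only [Function.comp_apply]
  rw [side 0 (by simp), side 1 (by simp)]

theorem IsCocycle.hol_gauge {c c' : X → X → G} (hc : IsCocycle c) {u : X → G}
    (hu : IsGauge c c' u) {x y : X} (γ : Path x y) :
    hol c' γ = u y * hol c γ * (u x)⁻¹ := by
  obtain ⟨g, hg⟩ := hc.exists_flat_path γ
  rw [hol_eq hg, hol_eq (hg.gauge (hu.comp γ.continuous))]
  simp [mul_assoc]

theorem IsCocycle.hol_of_mem {c : X → X → G} (hc : IsCocycle c) {V : Set X} {p x : X}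
    (hV : FlatOn c (c p) V) {γ : Path p x} (hγ : ∀ t, γ t ∈ V) : hol c γ = c p x := by
  rw [hol_eq (g := c p ∘ γ) (hV.comp γ.continuous fun t _ => hγ t)]
  simp [hc.self]

end Cocycle

/-! ### From homomorphisms on π₁ to cocycles. -/

section Transport

variable {Y G : Type*} [TopologicalSpace Y] [Group G]

/-- Parallel transport along paths: a functor from the fundamental groupoid of `Y` to `G`. -/
structure Transport (Y G : Type*) [TopologicalSpace Y] [Group G] where
  along : ∀ {x y : Y}, Path x y → G
  congr : ∀ {x y : Y} {γ γ' : Path x y}, γ.Homotopic γ' → along γ = along γ'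
  trans : ∀ {x y z : Y} (γ : Path x y) (γ' : Path y z), along (γ.trans γ') = along γ' * along γ

namespace Transport

variable (T : Transport Y G)

theorem refl (x : Y) : T.along (Path.refl x) = 1 := by
  have := T.trans (Path.refl x) (Path.refl x)
  rw [Path.refl_trans_refl] at this
  simpa using this

theorem symm {x y : Y} (γ : Path x y) : T.along γ.symm = (T.along γ)⁻¹ := by
  rw [eq_inv_iff_mul_eq_one, ← T.trans, T.congr ⟨(Path.Homotopy.reflTransSymm γ).symm⟩, T.refl]

end Transport

/-- A homomorphism from the fundamental group of a path connected space extends to a parallel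
transport. -/
theorem exists_transport [PathConnectedSpace Y] {y₀ : Y} (δ : FundamentalGroup Y y₀ →* G) :
    ∃ T : Transport Y G, ∀ γ : Path y₀ y₀,
      T.along γ = δ (FundamentalGroup.fromPath (Path.Homotopic.Quotient.mk γ)) := by
  let b : ∀ y, Path y₀ y := fun y => PathConnectedSpace.somePath y₀ y
  -- Prepending the inverse of `b y₀` makes the chosen class at y₀ trivial, so the transport around
  -- loops is δ itself and not a conjugate.
  let β : ∀ y, Path.Homotopic.Quotient y₀ y := fun y =>
    ((Path.Homotopic.Quotient.mk (b y₀)).symm).trans (Path.Homotopic.Quotient.mk (b y))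
  have hβ : β y₀ = .refl y₀ := Path.Homotopic.Quotient.symm_trans _
  refine ⟨⟨fun {x y} γ => δ (FundamentalGroup.fromPath
    (((β x).trans (Path.Homotopic.Quotient.mk γ)).trans (β y).symm)), ?_, ?_⟩, ?_⟩
  · intro x y γ γ' h
    rw [Path.Homotopic.Quotient.eq.2 h]
  · intro x y z γ γ'
    rw [← map_mul, FundamentalGroup.mul_def]
    congr 1
    change _ = Path.Homotopic.Quotient.trans (Path.Homotopic.Quotient.trans _ _)
      (Path.Homotopic.Quotient.trans (Path.Homotopic.Quotient.trans _ _) _)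
    simp only [Path.Homotopic.Quotient.trans_assoc, Path.Homotopic.Quotient.mk_trans]
    rw [← Path.Homotopic.Quotient.trans_assoc (β y).symm (β y),
      Path.Homotopic.Quotient.symm_trans, Path.Homotopic.Quotient.refl_trans]
  · intro γ
    simp only [hβ]
    rw [Path.Homotopic.Quotient.refl_trans]
    congr 1
    exact Path.Homotopic.Quotient.trans_refl _

/-- Small loops are null-homotopic. -/
def SmallLoopsTrivialAt (p : Y) : Prop :=
  ∃ V ∈ 𝓝 p, ∀ γ : Path p p, (∀ t, γ t ∈ V) → γ.Homotopic (Path.refl p)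

theorem exists_path_near [LocallyPathConnectedSpace Y] {p : Y} {V : Set Y} (hV : V ∈ 𝓝 p) :
    ∀ᶠ x in 𝓝 p, ∃ γ : Path p x, ∀ t, γ t ∈ V := by
  filter_upwards [pathComponentIn_mem_nhds hV] with x hx
  exact ⟨hx.somePath, hx.somePath_mem⟩

/-- A parallel transport on a space in which small loops are null-homotopic comes from a cocycle. -/
theorem Transport.exists_cocycle [LocallyPathConnectedSpace Y] (h : ∀ p : Y, SmallLoopsTrivialAt p)
    (T : Transport Y G) : ∃ c : Y → Y → G, IsCocycle c ∧
      ∀ {x y : Y} (γ : Path x y), hol c γ = T.along γ := by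
  classical
  choose V hV hloop using h
  let c : Y → Y → G := fun p x =>
    if h : ∃ γ : Path p x, ∀ t, γ t ∈ interior (V p) then T.along h.choose else 1
  -- Two paths inside `interior (V p)` form a small loop, so the value does not depend on the chosen
  -- path.
  have hcT : ∀ {p x : Y} (γ : Path p x), (∀ t, γ t ∈ interior (V p)) → c p x = T.along γ := by
    intro p x γ hγ
    have h : ∃ γ : Path p x, ∀ t, γ t ∈ interior (V p) := ⟨γ, hγ⟩
    have hl := T.congr (hloop p (h.choose.trans γ.symm) fun t => by
      rw [Path.trans_apply]
      split_ifs
      · exact interior_subset (h.choose_spec _)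
      · exact interior_subset (hγ _))
    rw [T.trans, T.refl, T.symm, inv_mul_eq_one] at hl
    simp only [c]
    rw [dif_pos h, hl]
  have hc : IsCocycle c := by
    intro p
    filter_upwards [exists_path_near (interior_mem_nhds.2 (hV p)),
      isOpen_interior.mem_nhds (mem_interior_iff_mem_nhds.2 (hV p))] with q ⟨γ, hγ⟩ hq
    filter_upwards [exists_path_near (inter_mem (isOpen_interior.mem_nhds hq)
      (interior_mem_nhds.2 (hV q)))] with x ⟨γ', hγ'⟩
    rw [hcT γ hγ, hcT γ' fun t => (hγ' t).2, ← T.trans]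
    refine hcT _ fun t => ?_
    rw [Path.trans_apply]
    split_ifs
    · exact hγ _
    · exact (hγ' _).1
  refine ⟨c, hc, fun {x y} γ => ?_⟩
  -- The transport along initial segments of γ is a flat section over γ, so the holonomy is the
  -- transport along the whole path.
  have hflat : FlatOn (fun s t => c (γ s) (γ t)) (fun t => T.along (γ.subpath 0 t)) univ := by
    intro s _
    rw [nhdsWithin_univ]
    have hs : γ ⁻¹' interior (V (γ s)) ∈ 𝓝 s :=
      γ.continuous.continuousAt (interior_mem_nhds.2 (hV (γ s)))
    obtain ⟨ε, hε, hball⟩ := Metric.mem_nhds_iff.1 hs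
    filter_upwards [Metric.ball_mem_nhds s hε] with t ht
    rw [hcT (γ.subpath s t), ← T.trans, T.congr ⟨Path.Homotopy.subpathTransSubpath γ 0 s t⟩]
    intro r
    have : γ.subpath s t r ∈ γ '' (uIcc s t) := by
      rw [← Path.range_subpath]; exact mem_range_self r
    obtain ⟨r', hr', e⟩ := this
    rw [← e]
    refine hball ?_
    have h1 : |(r' : ℝ) - s| ≤ |(t : ℝ) - s| := by
      have : (r' : ℝ) ∈ uIcc (s : ℝ) t := hr'
      exact abs_sub_left_of_mem_uIcc this
    exact lt_of_le_of_lt h1 ht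
  rw [hol_eq hflat, Path.subpath_self, T.refl, Path.subpath_zero_one]
  simp only [inv_one, mul_one]
  have aux : ∀ {a b : Y} (ha : a = x) (hb : b = y), T.along (γ.cast ha hb) = T.along γ := by
    rintro a b rfl rfl; rfl
  exact aux _ _

/-- Cocycles with the same holonomy along loops are gauge equivalent. -/
theorem IsCocycle.exists_gauge_of_hol_eq [PathConnectedSpace Y] [LocallyPathConnectedSpace Y]
    {c c' : Y → Y → G} (hc : IsCocycle c) (hc' : IsCocycle c') {y₀ : Y}
    (h : ∀ γ : Path y₀ y₀, hol c γ = hol c' γ) : ∃ u : Y → G, u y₀ = 1 ∧ IsGauge c c' u := by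
  let b : ∀ y, Path y₀ y := fun y => PathConnectedSpace.somePath y₀ y
  -- The gauge compares the holonomies along a chosen path from y₀. The hypothesis, applied to the
  -- loop through p and a nearby x, gives the gauge relation between c p x and c' p x.
  refine ⟨fun x => hol c' (b x) * (hol c (b x))⁻¹, by simp [h], fun p => ?_⟩
  obtain ⟨V, hVo, hpV, hV⟩ := hc.exists_flatOn p
  obtain ⟨V', hVo', hpV', hV'⟩ := hc'.exists_flatOn p
  filter_upwards [exists_path_near (inter_mem (hVo.mem_nhds hpV) (hVo'.mem_nhds hpV'))]
    with x ⟨γ, hγ⟩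
  have e := h (((b p).trans γ).trans (b x).symm)
  rw [hc.hol_trans, hc'.hol_trans, hc.hol_trans, hc'.hol_trans, hc.hol_symm, hc'.hol_symm,
    hc.hol_of_mem hV fun t => (hγ t).1, hc'.hol_of_mem hV' fun t => (hγ t).2] at e
  have e2 : c' p x = hol c' (b x) * ((hol c' (b x))⁻¹ * (c' p x * hol c' (b p))) *
    (hol c' (b p))⁻¹ := by group
  rw [e2, ← e]
  group

/-- Every cocycle on a simply connected space has a flat section. -/
theorem IsCocycle.exists_flatOn_univ [SimplyConnectedSpace Y] [LocallyPathConnectedSpace Y]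
    {c : Y → Y → G} (hc : IsCocycle c) : ∃ g, FlatOn c g univ := by
  have h1 : IsCocycle (fun _ _ : Y => (1 : G)) := fun p => by simp
  obtain ⟨y₀⟩ : Nonempty Y := inferInstance
  obtain ⟨u, -, hu⟩ := h1.exists_gauge_of_hol_eq hc (y₀ := y₀) fun γ => by
    have : γ.Homotopic (Path.refl _) := SimplyConnectedSpace.paths_homotopic _ _
    rw [hc.hol_congr this, h1.hol_congr this, hc.hol_refl, h1.hol_refl]
  refine ⟨u, fun p _ => ?_⟩
  rw [nhdsWithin_univ]
  filter_upwards [hu p] with x hx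
  simp [hx]

end Transport

/-! ### Relative nonabelian cohomology and the holonomy bijection. -/

section Relative

variable {X Y Z G : Type*} [TopologicalSpace X] [TopologicalSpace Y] [TopologicalSpace Z] [Group G]

variable (G) in
/-- Cocycles on `X` that are trivial on `A`. -/
def RelCocycle (A : Set X) : Type _ :=
  {c : X → X → G // IsCocycle c ∧ ∀ a ∈ A, ∀ᶠ x in 𝓝[A] a, c a x = 1}

variable (G) in
/-- Gauge equivalence by gauge transformations that are trivial on `A`. -/
instance relSetoid (A : Set X) : Setoid (RelCocycle G A) where
  r c c' := ∃ g : X → G, (∀ a ∈ A, g a = 1) ∧ IsGauge c.1 c'.1 g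
  iseqv :=
    { refl := fun c => ⟨1, fun _ _ => rfl, .refl _⟩
      symm := fun ⟨g, hg, h⟩ => ⟨g⁻¹, fun a ha => by simp [hg a ha], h.symm⟩
      trans := fun ⟨g, hg, h⟩ ⟨g', hg', h'⟩ =>
        ⟨g' * g, fun a ha => by simp [hg a ha, hg' a ha], h.trans h'⟩ }

variable (G) in
/-- The nonabelian cohomology set `H¹(X, A; G)`. -/
def RelH1 (A : Set X) : Type _ := Quotient (relSetoid G A)

theorem relSetoid_iff {A : Set X} {c c' : RelCocycle G A} :
    (⟦c⟧ : RelH1 G A) = ⟦c'⟧ ↔ ∃ g : X → G, (∀ a ∈ A, g a = 1) ∧ IsGauge c.1 c'.1 g :=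
  Quotient.eq

/-- The pullback of a relative cocycle. -/
def RelCocycle.pull {A : Set X} {B : Set Y} (φ : C(X, Y)) (h : MapsTo φ A B)
    (c : RelCocycle G B) : RelCocycle G A :=
  ⟨fun s t => c.1 (φ s) (φ t), c.2.1.comp φ.continuous, fun a ha =>
    (φ.continuous.continuousWithinAt.tendsto_nhdsWithin h).eventually (c.2.2 (φ a) (h ha))⟩

/-- The pullback map in nonabelian cohomology. -/
def RelH1.pull {A : Set X} {B : Set Y} (φ : C(X, Y)) (h : MapsTo φ A B) :
    RelH1 G B → RelH1 G A :=
  Quotient.map (RelCocycle.pull φ h) fun _ _ ⟨g, hg, hc⟩ =>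
    ⟨g ∘ φ, fun _ ha => hg _ (h ha), hc.comp φ.continuous⟩

theorem RelH1.pull_pull {A : Set X} {B : Set Y} {D : Set Z} (φ : C(X, Y)) (h : MapsTo φ A B)
    (ψ : C(Y, Z)) (h' : MapsTo ψ B D) (x : RelH1 G D) :
    RelH1.pull φ h (RelH1.pull ψ h' x) = RelH1.pull (ψ.comp φ) (h'.comp h) x := by
  induction x using Quotient.ind
  rfl

/-- The holonomy homomorphism of a cocycle. -/
noncomputable def IsCocycle.holHom {c : Y → Y → G} (hc : IsCocycle c) (y₀ : Y) :
    FundamentalGroup Y y₀ →* G where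
  toFun q := Quotient.lift (fun γ : Path y₀ y₀ => hol c γ) (fun _ _ h => hc.hol_congr h)
    (FundamentalGroup.toPath q)
  map_one' := hc.hol_refl y₀
  map_mul' p q := by
    induction p using Path.Homotopic.Quotient.ind with | mk γ =>
    induction q using Path.Homotopic.Quotient.ind with | mk γ' =>
    -- The product of the classes of γ and γ' in `FundamentalGroup` is the class of `γ'.trans γ`,
    -- which agrees with the order reversal in `hol_trans`.
    exact hc.hol_trans γ' γ

theorem IsCocycle.holHom_mk {c : Y → Y → G} (hc : IsCocycle c) {y₀ : Y} (γ : Path y₀ y₀) :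
    hc.holHom y₀ (FundamentalGroup.fromPath (Path.Homotopic.Quotient.mk γ)) = hol c γ := rfl

theorem fundamentalGroup_hom_ext {y₀ : Y} {δ δ' : FundamentalGroup Y y₀ →* G}
    (h : ∀ γ : Path y₀ y₀, δ (FundamentalGroup.fromPath (Path.Homotopic.Quotient.mk γ)) =
      δ' (FundamentalGroup.fromPath (Path.Homotopic.Quotient.mk γ))) : δ = δ' := by
  ext q
  induction q using Path.Homotopic.Quotient.ind with | mk γ => exact h γ

/-- The holonomy homomorphism of a class in `H¹(Y, y₀; G)`. -/
noncomputable def RelH1.holHom (y₀ : Y) : RelH1 G ({y₀} : Set Y) → (FundamentalGroup Y y₀ →* G) :=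
  Quotient.lift (fun c => c.2.1.holHom y₀) fun c c' ⟨g, hg, h⟩ => by
    refine fundamentalGroup_hom_ext fun γ => ?_
    rw [c.2.1.holHom_mk, c'.2.1.holHom_mk, c.2.1.hol_gauge h, hg y₀ rfl]
    simp

/-- Injectivity: holonomy around loops determines a cocycle up to a gauge equal to 1 at y₀.
Surjectivity: a homomorphism extends to a transport, and triviality of small loops turns the
transport into a cocycle. -/
theorem RelH1.holHom_bijective [PathConnectedSpace Y] [LocallyPathConnectedSpace Y]
    (h : ∀ p : Y, SmallLoopsTrivialAt p) (y₀ : Y) :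
    Function.Bijective (RelH1.holHom (G := G) y₀) := by
  constructor
  · intro x x'
    induction x using Quotient.ind with | _ c =>
    induction x' using Quotient.ind with | _ c' =>
    intro e
    obtain ⟨u, hu, hg⟩ := c.2.1.exists_gauge_of_hol_eq c'.2.1 (y₀ := y₀) fun γ =>
      DFunLike.congr_fun e (FundamentalGroup.fromPath (Path.Homotopic.Quotient.mk γ))
    exact relSetoid_iff.2 ⟨u, by simpa using hu, hg⟩
  · intro δ
    obtain ⟨T, hT⟩ := exists_transport δ
    obtain ⟨c, hc, hcT⟩ := T.exists_cocycle h
    refine ⟨⟦⟨c, hc, fun a ha => ?_⟩⟧, fundamentalGroup_hom_ext fun γ => ?_⟩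
    · obtain rfl := ha
      simp [hc.self]
    · exact (hcT γ).trans (hT γ)

theorem RelH1.holHom_pull (φ : C(X, Y)) {x₀ : X} {y₀ : Y} (h : φ x₀ = y₀)
    (h' : MapsTo φ {x₀} {y₀}) (x : RelH1 G ({y₀} : Set Y)) :
    RelH1.holHom x₀ (RelH1.pull φ h' x) =
      (RelH1.holHom y₀ x).comp (FundamentalGroup.mapOfEq φ h) := by
  induction x using Quotient.ind with | _ c =>
  subst h
  refine fundamentalGroup_hom_ext fun γ => ?_
  rw [MonoidHom.comp_apply, FundamentalGroup.mapOfEq_apply]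
  rfl

end Relative

/-! ### The quotient X/A: excision, small loops and tame pairs. -/

section CollapseTopology

variable {X Y G : Type*} [TopologicalSpace X] [TopologicalSpace Y] [Group G] {A : Set X}

set_option linter.unusedSectionVars false

theorem Collapse.continuous_mk (A : Set X) : Continuous (Collapse.mk A) :=
  continuous_quot_mk.comp continuous_inl

theorem Collapse.isOpen_iff {U : Set (Collapse A)} : IsOpen U ↔ IsOpen (Collapse.mk A ⁻¹' U) := by
  refine ⟨fun h => h.preimage (Collapse.continuous_mk A), fun h => ?_⟩
  have : IsOpen (Quot.mk (collapseRel A) ⁻¹' U) ↔ IsOpen U := isQuotientMap_quot_mk.isOpen_preimage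
  rw [← this, isOpen_sum_iff]
  exact ⟨h, isOpen_discrete _⟩

theorem Collapse.mk_eq_pt {x : X} (hx : x ∈ A) : Collapse.mk A x = Collapse.pt A :=
  Quot.sound hx

/-- Distinguishes the points of `X / A`. -/
def Collapse.toSet (A : Set X) : Collapse A → Set X :=
  Quot.lift (Sum.elim (fun x => {y | y = x ∨ x ∈ A ∧ y ∈ A}) fun _ => A) (by
    rintro (x | x) (y | y) hxy
    · exact hxy.elim
    · have hx : x ∈ A := hxy
      ext z
      simp only [Sum.elim_inl, Sum.elim_inr, mem_ofPred_eq, hx, true_and]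
      exact ⟨fun h => h.elim (fun e => e ▸ hx) id, Or.inr⟩
    · exact hxy.elim
    · exact hxy.elim)

theorem Collapse.mk_eq_mk {x y : X} (h : Collapse.mk A x = Collapse.mk A y) (hx : x ∉ A) :
    x = y := by
  have e : ({z | z = x ∨ x ∈ A ∧ z ∈ A} : Set X) = {z | z = y ∨ y ∈ A ∧ z ∈ A} :=
    congrArg (Collapse.toSet A) h
  have : x ∈ ({z | z = y ∨ y ∈ A ∧ z ∈ A} : Set X) := e ▸ Or.inl rfl
  rcases this with h | h
  · exact h
  · exact absurd h.2 hx

theorem Collapse.mk_eq_pt_iff {x : X} : Collapse.mk A x = Collapse.pt A ↔ x ∈ A := by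
  refine ⟨fun h => ?_, Collapse.mk_eq_pt⟩
  have e : ({z | z = x ∨ x ∈ A ∧ z ∈ A} : Set X) = A := congrArg (Collapse.toSet A) h
  have : x ∈ ({z | z = x ∨ x ∈ A ∧ z ∈ A} : Set X) := Or.inl rfl
  rwa [e] at this

theorem Collapse.cases (y : Collapse A) :
    y = Collapse.pt A ∨ ∃ x, x ∉ A ∧ y = Collapse.mk A x := by
  induction y using Quot.ind with | _ z =>
  rcases z with x | u
  · by_cases hx : x ∈ A
    · exact Or.inl (Collapse.mk_eq_pt hx)
    · exact Or.inr ⟨x, hx, rfl⟩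
  · exact Or.inl rfl

/-- Open sets containing A map to neighbourhoods of the collapsed point. Pointwise conditions at the
points of A combine because the interior of the good set contains A. -/
theorem Collapse.eventually_pt {P : Collapse A → Prop} :
    (∀ᶠ y in 𝓝 (Collapse.pt A), P y) ↔
      P (Collapse.pt A) ∧ ∀ a ∈ A, ∀ᶠ x in 𝓝 a, P (Collapse.mk A x) := by
  constructor
  · intro h
    refine ⟨h.self_of_nhds, fun a ha => ?_⟩
    have := (Collapse.continuous_mk A).continuousAt (x := a)
    rw [ContinuousAt, Collapse.mk_eq_pt ha] at this
    exact this.eventually h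
  · rintro ⟨h0, h⟩
    have hA : A ⊆ interior {x | P (Collapse.mk A x)} := fun a ha =>
      mem_interior_iff_mem_nhds.2 (h a ha)
    refine eventually_nhds_iff.2 ⟨insert (Collapse.pt A)
      (Collapse.mk A '' interior {x | P (Collapse.mk A x)}), ?_, ?_, mem_insert _ _⟩
    · rintro y (rfl | ⟨x, hx, rfl⟩)
      · exact h0
      · exact interior_subset (s := {x | P (Collapse.mk A x)}) hx
    · rw [Collapse.isOpen_iff]
      convert! isOpen_interior (s := {x | P (Collapse.mk A x)}) using 1
      ext x
      simp only [mem_preimage, mem_insert_iff, Collapse.mk_eq_pt_iff, mem_image]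
      constructor
      · rintro (hx | ⟨z, hz, e⟩)
        · exact hA hx
        · by_cases hzA : z ∈ A
          · rw [Collapse.mk_eq_pt hzA, eq_comm, Collapse.mk_eq_pt_iff] at e
            exact hA e
          · exact Collapse.mk_eq_mk e hzA ▸ hz
      · exact fun hx => Or.inr ⟨x, hx, rfl⟩

theorem Collapse.eventually_mk (hA : IsClosed A) {x : X} (hx : x ∉ A) {P : Collapse A → Prop} :
    (∀ᶠ y in 𝓝 (Collapse.mk A x), P y) ↔ ∀ᶠ z in 𝓝 x, P (Collapse.mk A z) := by
  refine ⟨fun h => (Collapse.continuous_mk A).continuousAt.eventually h, fun h => ?_⟩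
  obtain ⟨V, hV, hVo, hxV⟩ := eventually_nhds_iff.1 (h.and (hA.isOpen_compl.mem_nhds hx))
  refine eventually_nhds_iff.2 ⟨Collapse.mk A '' V, ?_, ?_, mem_image_of_mem _ hxV⟩
  · rintro _ ⟨z, hz, rfl⟩
    exact (hV z hz).1
  · rw [Collapse.isOpen_iff]
    convert! hVo using 1
    ext z
    constructor
    · rintro ⟨w, hw, e⟩
      exact Collapse.mk_eq_mk e (hV w hw).2 ▸ hw
    · exact mem_image_of_mem _

/-- A function on `X` that is constant on `A` descends to `X / A`. -/
def Collapse.lift {β : Type*} (u : X → β) (b : β) (h : ∀ a ∈ A, u a = b) : Collapse A → β :=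
  Quot.lift (Sum.elim u fun _ => b) (by
    rintro (x | x) (y | y) hxy
    · exact hxy.elim
    · exact h x hxy
    · exact hxy.elim
    · exact hxy.elim)

theorem Collapse.continuous_lift {β : Type*} [TopologicalSpace β] {u : X → β} {b : β}
    {h : ∀ a ∈ A, u a = b} (hu : Continuous u) : Continuous (Collapse.lift u b h) :=
  continuous_quot_lift _ (continuous_sumElim.2 ⟨hu, continuous_const⟩)

instance [LocallyPathConnectedSpace X] : LocallyPathConnectedSpace (Collapse A) :=
  inferInstanceAs (LocallyPathConnectedSpace (Quot (collapseRel A)))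

/-- The quotient map as a continuous map of pairs. -/
def Collapse.proj (A : Set X) : C(X, Collapse A) := ⟨Collapse.mk A, Collapse.continuous_mk A⟩

theorem Collapse.mapsTo_proj (A : Set X) : MapsTo (Collapse.proj A) A {Collapse.pt A} :=
  fun _ hx => Collapse.mk_eq_pt hx

/-- A cocycle that is trivial on a compact set `A` has a flat section near `A` with value `1` on
`A`. -/
theorem RelCocycle.exists_flat_near [T2Space X] [CompactSpace X] (hA : IsClosed A)
    (c : RelCocycle G A) : ∃ g : X → G, (∀ a ∈ A, g a = 1) ∧
      ∀ a ∈ A, ∀ᶠ p in 𝓝 a, ∀ᶠ x in 𝓝 p, g x = c.1 p x * g p := by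
  -- Near a ∈ A the transport `c a` is itself a flat section and equals 1 on A.
  have hloc : ∀ a ∈ A, ∃ K : Set X, IsClosed K ∧ K ∈ 𝓝 a ∧ ∃ s : X → G,
      (∀ p ∈ K, ∀ᶠ x in 𝓝 p, s x = c.1 p x * s p) ∧ ∀ b ∈ A ∩ K, s b = 1 := by
    intro a ha
    have h1 := c.2.1 a
    have h2 : ∀ᶠ x in 𝓝 a, x ∈ A → c.1 a x = 1 := eventually_nhdsWithin_iff.1 (c.2.2 a ha)
    obtain ⟨K, hK, hKc, hKs⟩ := exists_mem_nhds_isClosed_subset (h1.and h2)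
    exact ⟨K, hKc, hK, c.1 a, fun p hp => (hKs hp).1, fun b hb => (hKs hb.2).2 hb.1⟩
  choose! K hKc hK s hs hs1 using hloc
  obtain ⟨t, htA, ht'⟩ := hA.isCompact.elim_nhds_subcover (fun a => interior (K a))
    fun a ha => interior_mem_nhds.2 (hK a ha)
  have ht : A ⊆ ⋃ i ∈ t, K i := ht'.trans (iUnion₂_mono fun _ _ => interior_subset)
  have hcov : ∀ x, ∃ i, (x ∈ ⋃ i ∈ t, K i) → i ∈ t ∧ x ∈ K i := by
    intro x
    by_cases hx : x ∈ ⋃ i ∈ t, K i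
    · obtain ⟨i, hi, hxi⟩ := mem_iUnion₂.1 hx
      exact ⟨i, fun _ => ⟨hi, hxi⟩⟩
    · exact ⟨x, fun h => absurd h hx⟩
  choose i hi using hcov
  refine ⟨fun x => s (i x) x, fun a ha => ?_, fun a ha => ?_⟩
  · have := hi a (ht ha)
    exact hs1 _ (htA _ this.1) a ⟨ha, this.2⟩
  -- The index `i x` is chosen pointwise without regularity. This is harmless near A: each `K k`
  -- containing a carries a section that agrees with `c a` near a, and the closed sets `K k` missing
  -- a can be avoided.
  · have key : ∀ᶠ x in 𝓝 a, s (i x) x = s (i a) x := by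
      have h1 : ∀ᶠ x in 𝓝 a, ∀ k ∈ t, x ∈ K k → s k x = c.1 a x := by
        refine (Filter.eventually_all_finset t).2 fun k hk => ?_
        by_cases hak : a ∈ K k
        · filter_upwards [hs k (htA k hk) a hak] with x hx _
          rw [hx, hs1 k (htA k hk) a ⟨ha, hak⟩, mul_one]
        · filter_upwards [(hKc k (htA k hk)).isOpen_compl.mem_nhds hak] with x hx hx'
          exact absurd hx' hx
      have hia := hi a (ht ha)
      have h2 : ∀ᶠ x in 𝓝 a, s (i a) x = c.1 a x := by
        filter_upwards [hs (i a) (htA _ hia.1) a hia.2] with x hx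
        rw [hx, hs1 _ (htA _ hia.1) a ⟨ha, hia.2⟩, mul_one]
      have h3 : ∀ᶠ x in 𝓝 a, x ∈ ⋃ i ∈ t, K i := by
        obtain ⟨j, hj, haj⟩ := mem_iUnion₂.1 (ht' ha)
        filter_upwards [mem_interior_iff_mem_nhds.1 haj] with x hx
        exact mem_iUnion₂.2 ⟨j, hj, hx⟩
      filter_upwards [h1, h2, h3] with x h1 h2 h3
      rw [h1 _ (hi x h3).1 (hi x h3).2, h2]
    have hflat : ∀ᶠ p in 𝓝 a, ∀ᶠ x in 𝓝 p, s (i a) x = c.1 p x * s (i a) p := by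
      have hia := hi a (ht ha)
      filter_upwards [c.2.1 a, (hs (i a) (htA _ hia.1) a hia.2).eventually_nhds] with p hp hp'
      filter_upwards [hp, hp'] with x hx hx'
      rw [hx', hx, hp'.self_of_nhds, mul_assoc]
    filter_upwards [key.eventually_nhds, hflat] with p hp hp'
    filter_upwards [hp, hp'] with x hx hx'
    rw [hx, hx', hp.self_of_nhds]

/-- Excision: `H¹(X / A, *; G) = H¹(X, A; G)`. -/
theorem RelH1.pull_proj_bijective [T2Space X] [CompactSpace X] (hA : IsClosed A) :
    Function.Bijective (RelH1.pull (G := G) (Collapse.proj A) (Collapse.mapsTo_proj A)) := by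
  classical
  constructor
  · intro x x'
    induction x using Quotient.ind with | _ c =>
    induction x' using Quotient.ind with | _ c' =>
    intro e
    obtain ⟨g, hg, h⟩ := relSetoid_iff.1 e
    refine relSetoid_iff.2 ⟨Collapse.lift g 1 hg, ?_, fun y => ?_⟩
    · rintro _ rfl
      rfl
    · rcases Collapse.cases y with rfl | ⟨x, hx, rfl⟩
      · rw [Collapse.eventually_pt]
        refine ⟨by simp [c.2.1.self, c'.2.1.self], fun a ha => ?_⟩
        have aux : ∀ (d d' : Collapse A → Collapse A → G) (k : Collapse A → G),
            (∀ᶠ x in 𝓝 a, d' (Collapse.mk A a) (Collapse.mk A x) = k (Collapse.mk A x) *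
              d (Collapse.mk A a) (Collapse.mk A x) * (k (Collapse.mk A a))⁻¹) →
            ∀ᶠ x in 𝓝 a, d' (Collapse.pt A) (Collapse.mk A x) = k (Collapse.mk A x) *
              d (Collapse.pt A) (Collapse.mk A x) * (k (Collapse.pt A))⁻¹ := by
          intro d d' k h
          rwa [Collapse.mk_eq_pt ha] at h
        exact aux c.1 c'.1 (Collapse.lift g 1 hg) (h a)
      · rw [Collapse.eventually_mk hA hx]
        exact h x
  · intro y
    induction y using Quotient.ind with | _ c =>
    -- For surjectivity, gauging by the inverse of a flat section near A makes the cocycle trivial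
    -- on a neighbourhood of A without changing its class. It can then be declared 1 at pairs that
    -- meet A and pushed down to X/A.
    obtain ⟨g, hgA, hg⟩ := c.exists_flat_near hA
    set c₁ : X → X → G := fun p x => (g⁻¹) x * c.1 p x * ((g⁻¹) p)⁻¹ with hc₁
    have hc₁c : IsCocycle c₁ := c.2.1.gauge _
    have hflat : ∀ a ∈ A, ∀ᶠ p in 𝓝 a, ∀ᶠ x in 𝓝 p, c₁ p x = 1 := fun a ha => by
      filter_upwards [hg a ha] with p hp
      filter_upwards [hp] with x hx
      simp [hc₁, hx]
    let d : Collapse A → Collapse A → G := Collapse.lift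
      (fun x => Collapse.lift (fun y => if x ∈ A ∨ y ∈ A then 1 else c₁ x y) 1
        fun a ha => if_pos (Or.inr ha)) (fun _ => 1) fun a ha => by
          funext y
          rcases Collapse.cases y with rfl | ⟨x, hx, rfl⟩
          · rfl
          · exact if_pos (Or.inl ha)
    have dpt : ∀ y, d (Collapse.pt A) y = 1 := fun _ => rfl
    have dmk : ∀ {x y}, x ∉ A → y ∉ A → d (Collapse.mk A x) (Collapse.mk A y) = c₁ x y :=
      fun hx hy => if_neg (not_or.2 ⟨hx, hy⟩)
    have dA : ∀ {x y}, x ∈ A ∨ y ∈ A → d (Collapse.mk A x) (Collapse.mk A y) = 1 :=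
      fun h => if_pos h
    -- The redefinition on A is invisible to germs: off A a point has a neighbourhood missing A, and
    -- at points of A the gauged cocycle is already 1 nearby.
    have hdc : ∀ p, ∀ᶠ x in 𝓝 p, d (Collapse.mk A p) (Collapse.mk A x) = c₁ p x := by
      intro p
      by_cases hp : p ∈ A
      · filter_upwards [(hflat p hp).self_of_nhds] with x hx
        rw [hx, dA (Or.inl hp)]
      · filter_upwards [hA.isOpen_compl.mem_nhds hp] with x hx
        exact dmk hp hx
    have hd : IsCocycle d := by
      intro y
      rcases Collapse.cases y with rfl | ⟨p, hp, rfl⟩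
      · rw [Collapse.eventually_pt]
        refine ⟨.of_forall fun x => by simp [dpt], fun a ha => ?_⟩
        filter_upwards [hflat a ha] with q hq
        by_cases hqA : q ∈ A
        · rw [Collapse.mk_eq_pt hqA]
          exact .of_forall fun x => by simp [dpt]
        · rw [Collapse.eventually_mk hA hqA]
          filter_upwards [hq, hdc q] with x hx hx'
          simp [dpt, hx', hx]
      · rw [Collapse.eventually_mk hA hp]
        filter_upwards [hc₁c p, hA.isOpen_compl.mem_nhds hp, (hdc p).eventually_nhds]
          with q hq hqA hpq
        rw [Collapse.eventually_mk hA hqA]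
        filter_upwards [hq, hdc q, hpq] with x hx h1 h2
        rw [h2, h1, hpq.self_of_nhds, hx]
    refine ⟨⟦⟨d, hd, ?_⟩⟧, relSetoid_iff.2 ⟨g, hgA, fun p => ?_⟩⟩
    · rintro _ rfl
      exact .of_forall fun x => dpt x
    · filter_upwards [hdc p] with x hx
      change c.1 p x = g x * d (Collapse.mk A p) (Collapse.mk A x) * (g p)⁻¹
      rw [hx]
      simp [hc₁, mul_assoc]

/-- A neighbourhood of `A` can be pushed into `A` by a deformation of `X` that fixes `A`. -/
def PushesInto (A S : Set X) : Prop :=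
  ∃ H : C(I × X, X), (∀ x, H (0, x) = x) ∧ (∀ a ∈ A, ∀ t, H (t, a) = a) ∧
    ∀ a ∈ S, ∀ᶠ x in 𝓝 a, H (1, x) ∈ A

/-- The deformations are composed. Points pushed into A by the first stay there, since the second
fixes A; points near S' ⊆ A remain near S' under the first, which fixes A, and the second then
pushes them in. -/
theorem PushesInto.union {S S' : Set X} (h : PushesInto A S) (h' : PushesInto A S')
    (hS' : S' ⊆ A) : PushesInto A (S ∪ S') := by
  obtain ⟨H, H0, HA, H1⟩ := h
  obtain ⟨H', H0', HA', H1'⟩ := h'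
  refine ⟨⟨fun q => H' (q.1, H q), by fun_prop⟩, fun x => ?_, fun a ha t => ?_, ?_⟩
  · simp [H0, H0']
  · simp [HA a ha, HA' a ha]
  · rintro a (ha | ha)
    · filter_upwards [H1 a ha] with x hx
      simpa [HA' _ hx] using hx
    · have : ContinuousAt (fun x => H (1, x)) a := by fun_prop
      rw [ContinuousAt, HA a (hS' ha)] at this
      exact this.eventually (H1' a ha)

theorem pushesInto_of_local (hA : IsCompact A) (h : ∀ a ∈ A, ∃ S ∈ 𝓝[A] a, PushesInto A S) :
    PushesInto A A := by
  have := hA.induction_on (p := fun S => PushesInto A (S ∩ A))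
    ⟨⟨Prod.snd, continuous_snd⟩, fun _ => rfl, fun _ _ _ => rfl, by simp⟩
    (fun s t hst ⟨H, h0, h1, h2⟩ => ⟨H, h0, h1, fun a ha => h2 a ⟨hst ha.1, ha.2⟩⟩)
    (fun s t hs ht => by
      rw [union_inter_distrib_right]
      exact hs.union ht inter_subset_right)
    (fun a ha => by
      obtain ⟨S, hS, H, h0, h1, h2⟩ := h a ha
      exact ⟨S, hS, H, h0, h1, fun b hb => h2 b hb.1⟩)
  rwa [inter_self] at this

/-- The deformation descends to X/A and contracts a neighbourhood of the collapsed point to that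
point. It is curried to a map into C(I, X/A), so that continuity passes to the quotient without a
product of quotient maps. -/
theorem Collapse.smallLoopsTrivialAt_pt (h : PushesInto A A) :
    SmallLoopsTrivialAt (Collapse.pt A) := by
  obtain ⟨H, H0, HA, H1⟩ := h
  let u : C(X, C(I, Collapse A)) :=
    ((Collapse.proj A).comp (H.comp ⟨Prod.swap, continuous_swap⟩)).curry
  let v : Collapse A → C(I, Collapse A) := Collapse.lift u (ContinuousMap.const I (Collapse.pt A))
    fun a ha => by
      ext t
      change Collapse.mk A (H (t, a)) = Collapse.pt A
      rw [HA a ha, Collapse.mk_eq_pt ha]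
  have hv : Continuous v := Collapse.continuous_lift u.continuous
  have vmk : ∀ x t, v (Collapse.mk A x) t = Collapse.mk A (H (t, x)) := fun _ _ => rfl
  have vpt : ∀ t, v (Collapse.pt A) t = Collapse.pt A := fun _ => rfl
  have v0 : ∀ y, v y 0 = y := fun y => by
    rcases Collapse.cases y with rfl | ⟨x, -, rfl⟩
    · rfl
    · rw [vmk, H0]
  refine ⟨{y | v y 1 = Collapse.pt A}, ?_, fun γ hγ => ?_⟩
  · refine Collapse.eventually_pt.2 ⟨vpt 1, fun a ha => ?_⟩
    filter_upwards [H1 a ha] with x hx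
    rw [vmk, Collapse.mk_eq_pt hx]
  · refine ⟨⟨⟨⟨fun q => v (γ q.2) q.1, ?_⟩, fun t => v0 _, fun t => hγ t⟩, ?_⟩⟩
    · exact ContinuousEval.continuous_eval.comp
        ((hv.comp (γ.continuous.comp continuous_snd)).prodMk continuous_fst)
    · rintro t s (rfl | rfl)
      · simp [vpt]
      · simp [vpt]

/-- Off the closed set A the projection is an open embedding, so a loop avoiding the collapsed point
lifts to X, contracts there, and the contraction is projected back. -/
theorem Collapse.smallLoopsTrivialAt_mk (hA : IsClosed A) {p : X} (hp : p ∉ A)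
    (h : SmallLoopsTrivialAt p) : SmallLoopsTrivialAt (Collapse.mk A p) := by
  obtain ⟨V, hV, hloop⟩ := h
  refine ⟨Collapse.mk A '' (V ∩ Aᶜ), ?_, fun γ hγ => ?_⟩
  · refine (Collapse.eventually_mk hA hp).2 ?_
    filter_upwards [hV, hA.isOpen_compl.mem_nhds hp] with z hz hz'
    exact mem_image_of_mem _ ⟨hz, hz'⟩
  · choose g hg hgγ using hγ
    have hcont : Continuous g := by
      refine continuous_iff_continuousAt.2 fun t => tendsto_def.2 fun U hU => ?_
      have h1 : ∀ᶠ y in 𝓝 (Collapse.mk A (g t)), ∃ x ∈ U ∩ Aᶜ, Collapse.mk A x = y := by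
        refine (Collapse.eventually_mk hA (hg t).2).2 ?_
        filter_upwards [hU, hA.isOpen_compl.mem_nhds (hg t).2] with z hz hz'
        exact ⟨z, ⟨hz, hz'⟩, rfl⟩
      rw [hgγ] at h1
      filter_upwards [γ.continuous.continuousAt.eventually h1] with s ⟨x, hx, e⟩
      rw [← hgγ s] at e
      have := Collapse.mk_eq_mk e hx.2
      exact (this ▸ hx.1 : g s ∈ U)
    have hend : ∀ t, γ t = Collapse.mk A p → g t = p := fun t ht =>
      Collapse.mk_eq_mk ((hgγ t).trans ht) (hg t).2
    let γ' : Path p p := ⟨⟨g, hcont⟩, hend 0 γ.source, hend 1 γ.target⟩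
    have e : γ = γ'.map (Collapse.continuous_mk A) := by
      ext t
      exact (hgγ t).symm
    rw [e]
    exact (hloop γ' fun t => (hg t).1).map (Collapse.proj A)

/-- The hypotheses on a pair `(X, A)` under which `Hom(π₁(X / A), G)` is described by cocycles. -/
structure IsTamePair (A : Set X) : Prop where
  isClosed : IsClosed A
  nonempty : A.Nonempty
  pushes : PushesInto A A
  smallLoops : ∀ p ∉ A, SmallLoopsTrivialAt p
  connected : IsConnected (univ : Set (Collapse A))

theorem IsTamePair.smallLoopsTrivialAt (h : IsTamePair A) (y : Collapse A) :
    SmallLoopsTrivialAt y := by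
  rcases Collapse.cases y with rfl | ⟨x, hx, rfl⟩
  · exact Collapse.smallLoopsTrivialAt_pt h.pushes
  · exact Collapse.smallLoopsTrivialAt_mk h.isClosed hx (h.smallLoops x hx)

/-- For a tame pair, `H¹(X, A; G) = Hom(π₁(X / A), G)`. -/
noncomputable def IsTamePair.homEquiv [T2Space X] [CompactSpace X] [LocallyPathConnectedSpace X]
    (h : IsTamePair A) : (RelPi A →* G) ≃ RelH1 G A :=
  haveI : ConnectedSpace (Collapse A) := connectedSpace_iff_univ.2 h.connected
  haveI : PathConnectedSpace (Collapse A) := PathConnectedSpace.of_locallyPathConnectedSpace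
  (Equiv.ofBijective _ (RelH1.holHom_bijective h.smallLoopsTrivialAt (Collapse.pt A))).symm.trans
    (Equiv.ofBijective _ (RelH1.pull_proj_bijective h.isClosed))

/-- Naturality turns the matching condition on homomorphisms into a matching condition on cohomology
classes. -/
theorem IsTamePair.homEquiv_comp [T2Space X] [CompactSpace X] [LocallyPathConnectedSpace X]
    [T2Space Y] [CompactSpace Y] [LocallyPathConnectedSpace Y] {B : Set Y}
    (h : IsTamePair A) (h' : IsTamePair B) (φ : C(X, Y)) (hφ : MapsTo φ A B)
    (δ : RelPi B →* G) :
    h.homEquiv (δ.comp (RelPi.map φ hφ)) = RelH1.pull φ hφ (h'.homEquiv δ) := by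
  have : ConnectedSpace (Collapse A) := connectedSpace_iff_univ.2 h.connected
  have : PathConnectedSpace (Collapse A) := PathConnectedSpace.of_locallyPathConnectedSpace
  have : ConnectedSpace (Collapse B) := connectedSpace_iff_univ.2 h'.connected
  have : PathConnectedSpace (Collapse B) := PathConnectedSpace.of_locallyPathConnectedSpace
  obtain ⟨x, rfl⟩ := (RelH1.holHom_bijective h'.smallLoopsTrivialAt (Collapse.pt B)).2 δ
  have hm : MapsTo (Collapse.map φ hφ) {Collapse.pt A} {Collapse.pt B} := by
    rintro _ rfl; rfl
  have e1 : (RelH1.holHom (Collapse.pt B) x).comp (RelPi.map φ hφ) =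
      RelH1.holHom (Collapse.pt A) (RelH1.pull (Collapse.map φ hφ) hm x) :=
    (RelH1.holHom_pull (Collapse.map φ hφ) rfl hm x).symm
  rw [e1]
  simp only [homEquiv, Equiv.trans_apply]
  rw [Equiv.ofBijective_symm_apply_apply, Equiv.ofBijective_symm_apply_apply]
  simp only [Equiv.ofBijective_apply]
  rw [RelH1.pull_pull, RelH1.pull_pull]
  rfl

end CollapseTopology

/-! ### Finiteness of relative cohomology. -/

section Finiteness

variable {X G : Type*} [TopologicalSpace X] [Group G] {A : Set X}

/-- A compact subset of an open set meets finitely many of its components. -/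
theorem exists_finite_preconnected_cover [LocallyConnectedSpace X] {K U : Set X}
    (hK : IsCompact K) (hU : IsOpen U) (hKU : K ⊆ U) :
    ∃ F : Finset X, ∀ x ∈ K, ∃ z ∈ F, ∃ C ⊆ U, IsPreconnected C ∧ x ∈ C ∧ z ∈ C := by
  obtain ⟨t, htK, ht⟩ := hK.elim_nhds_subcover (fun x => connectedComponentIn U x) fun x hx =>
    hU.connectedComponentIn.mem_nhds (mem_connectedComponentIn (hKU hx))
  refine ⟨t, fun x hx => ?_⟩
  obtain ⟨z, hz, hxz⟩ := mem_iUnion₂.1 (ht hx)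
  exact ⟨z, hz, connectedComponentIn U z, connectedComponentIn_subset U z,
    isPreconnected_connectedComponentIn, hxz, mem_connectedComponentIn (hKU (htK z hz))⟩

/-- Every cocycle on `X` that is trivial on `A` has a flat section over `V` that is trivial on
`A`. -/
def TrivializesCocycles (G : Type*) [Group G] (A V : Set X) : Prop :=
  ∀ c : RelCocycle G A, ∃ g : X → G, FlatOn c.1 g V ∧ ∀ a ∈ A ∩ V, g a = 1

/-- Over a finite trivialising cover a cocycle is described by transition functions, which are
constant on connected sets. Shrinking the cover to compact sets leaves finitely many components to
test, so finitely many elements of G determine the class. -/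
theorem RelH1.finite [T2Space X] [CompactSpace X] [LocallyConnectedSpace X] [Finite G]
    (h : ∀ p : X, ∃ V, IsOpen V ∧ p ∈ V ∧ TrivializesCocycles G A V) : Finite (RelH1 G A) := by
  classical
  choose V hVo hpV hV using h
  have hK : ∀ p, ∃ K : Set X, K ∈ 𝓝 p ∧ IsClosed K ∧ K ⊆ V p := fun p =>
    exists_mem_nhds_isClosed_subset ((hVo p).mem_nhds (hpV p))
  choose K hKn hKc hKV using hK
  obtain ⟨t, -, ht⟩ := isCompact_univ.elim_nhds_subcover K fun x _ => hKn x
  choose F hF using fun i j => exists_finite_preconnected_cover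
    (((hKc i).inter (hKc j)).isCompact) ((hVo i).inter (hVo j))
    (inter_subset_inter (hKV i) (hKV j))
  choose g hg hgA using fun (i : X) (c : RelCocycle G A) => hV i c
  let D : RelH1 G A → (t × t × t.biUnion fun i => t.biUnion fun j => F i j) → G := fun x q =>
    (g q.1 x.out q.2.2)⁻¹ * g q.2.1 x.out q.2.2
  refine Finite.of_injective D fun x x' hD => ?_
  rw [← x.out_eq, ← x'.out_eq]
  set c := x.out
  set c' := x'.out
  have hcov : ∀ x, ∃ i ∈ t, x ∈ K i := fun x => by simpa using ht (mem_univ x)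
  choose i hit hi using hcov
  -- Equal transition functions make the local gauges, the ratios of flat sections of c' and c,
  -- independent of the index, so they define a global gauge.
  have key : ∀ i ∈ t, ∀ j ∈ t, ∀ x ∈ K i ∩ K j,
      g i c' x * (g i c x)⁻¹ = g j c' x * (g j c x)⁻¹ := by
    intro i hi j hj x hx
    obtain ⟨z, hz, C, hC, hCp, hxC, hzC⟩ := hF i j x hx
    have e := congrFun hD ⟨⟨i, hi⟩, ⟨j, hj⟩, ⟨z, Finset.mem_biUnion.2 ⟨i, hi,
      Finset.mem_biUnion.2 ⟨j, hj, hz⟩⟩⟩⟩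
    change (g i c z)⁻¹ * g j c z = (g i c' z)⁻¹ * g j c' z at e
    have hi' := fun c => (hg i c).mono (hC.trans inter_subset_left)
    have hj' := fun c => (hg j c).mono (hC.trans inter_subset_right)
    rw [(hi' c).ratio (hj' c) hCp hzC hxC, (hi' c').ratio (hj' c') hCp hzC hxC] at e
    rw [mul_inv_eq_iff_eq_mul, mul_assoc, ← mul_right_inj (g j c' x)⁻¹, ← mul_assoc (g j c' x)⁻¹,
      inv_mul_cancel, one_mul, ← inv_inj]
    simpa using e.symm
  refine relSetoid_iff.2 ⟨fun x => g (i x) c' x * (g (i x) c x)⁻¹, fun a ha => ?_, fun p => ?_⟩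
  · have := hKV _ (hi a)
    change g (i a) c' a * (g (i a) c a)⁻¹ = 1
    rw [hgA _ _ a ⟨ha, this⟩, hgA _ _ a ⟨ha, this⟩]
    simp
  · have h1 : ∀ᶠ x in 𝓝 p, ∀ k ∈ t, x ∈ K k → p ∈ K k := by
      refine (Filter.eventually_all_finset t).2 fun k hk => ?_
      by_cases hpk : p ∈ K k
      · exact .of_forall fun _ _ => hpk
      · filter_upwards [(hKc k).isOpen_compl.mem_nhds hpk] with x hx hx'
        exact absurd hx' hx
    have h2 : ∀ c, ∀ᶠ x in 𝓝 p, ∀ k ∈ t, p ∈ K k → g k c x = c.1 p x * g k c p := by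
      intro c
      refine (Filter.eventually_all_finset t).2 fun k hk => ?_
      by_cases hpk : p ∈ K k
      · have := hg k c p (hKV k hpk)
        rw [(hVo k).nhdsWithin_eq (hKV k hpk)] at this
        filter_upwards [this] with x hx _ using hx
      · exact .of_forall fun _ h => absurd h hpk
    filter_upwards [h1, h2 c, h2 c'] with x h1 h2 h3
    have hpx := h1 _ (hit x) (hi x)
    rw [key _ (hit p) _ (hit x) p ⟨hi p, hpx⟩, h2 _ (hit x) hpx, h3 _ (hit x) hpx]
    simp [mul_assoc]

/-- A flat section over V is locally constant on A ∩ V, where the cocycle is trivial. Connectedness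
makes it constant there, and a right multiplication normalises it to 1. -/
theorem TrivializesCocycles.of_simplyConnected [LocallyPathConnectedSpace X] {V : Set X}
    (hVo : IsOpen V) [SimplyConnectedSpace V] (hA : IsPreconnected (A ∩ V)) :
    TrivializesCocycles G A V := by
  classical
  intro c
  have : LocallyPathConnectedSpace V := hVo.locallyPathConnectedSpace
  obtain ⟨g, hg⟩ := (c.2.1.comp (φ := ((↑) : V → X)) continuous_subtype_val).exists_flatOn_univ
  let f : X → G := fun x => if h : x ∈ V then g ⟨x, h⟩ else 1
  have hfg : ∀ x (h : x ∈ V), f x = g ⟨x, h⟩ := fun x h => dif_pos h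
  have hf : FlatOn c.1 f V := by
    intro p hp
    have := hg ⟨p, hp⟩ trivial
    rw [nhdsWithin_univ, nhds_subtype_eq_comap_nhdsWithin, eventually_comap] at this
    filter_upwards [this, self_mem_nhdsWithin] with x hx hxV
    rw [hfg x hxV, hfg p hp]
    exact hx ⟨x, hxV⟩ rfl
  rcases (A ∩ V).eq_empty_or_nonempty with h | ⟨a, ha⟩
  · exact ⟨f, hf, by simp [h]⟩
  · refine ⟨_, hf.mul_const (f a)⁻¹, fun b hb => ?_⟩
    have : f b = f a := by
      refine eq_of_eventually_eq (u := f) hA (fun p hp => ?_) hb ha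
      filter_upwards [nhdsWithin_mono p inter_subset_right (hf p hp.2),
        nhdsWithin_mono p inter_subset_left (c.2.2 p hp.1)] with x h1 h2
      rw [h1, h2, one_mul]
    simp [this]

end Finiteness

/-! ### Descent along closed surjections. -/

section Gluing

variable {X E G : Type*} [TopologicalSpace X] [TopologicalSpace E] [Group G]

/-- For a closed map, a neighbourhood of the whole fibre contains all nearby fibres. Germ conditions
downstairs can thus be checked at each point of the fibre. -/
theorem eventually_of_isClosedMap {q : E → X} (hq : IsClosedMap q) {P : X} {S : E → Prop}
    (h : ∀ e, q e = P → ∀ᶠ e' in 𝓝 e, S e') : ∀ᶠ Q in 𝓝 P, ∀ e, q e = Q → S e := by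
  have h2 : (q '' (interior {e | S e})ᶜ)ᶜ ∈ 𝓝 P := by
    refine (hq _ isOpen_interior.isClosed_compl).isOpen_compl.mem_nhds ?_
    rintro ⟨e, he, rfl⟩
    exact he (mem_interior_iff_mem_nhds.2 (h e rfl))
  filter_upwards [h2] with Q hQ e he
  by_contra hS
  exact hQ ⟨e, fun h => hS (interior_subset (s := {e | S e}) h), he⟩

/-- A cocycle descends along a closed surjection once its transports do. -/
theorem IsCocycle.descend {q : E → X} (hq : IsClosedMap q) (hqs : Function.Surjective q)
    {b : E → E → G} (hb : IsCocycle b) {c : X → X → G}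
    (h : ∀ e, ∀ᶠ e' in 𝓝 e, c (q e) (q e') = b e e') : IsCocycle c := by
  intro P
  have h1 : ∀ᶠ Q in 𝓝 P, ∀ e', q e' = Q → ∃ e, q e = P ∧ c P (q e') = b e e' ∧
      ∀ᶠ e'' in 𝓝 e', c P (q e'') = b e e'' ∧ b e e'' = b e' e'' * b e e' := by
    refine eventually_of_isClosedMap hq fun e he => ?_
    subst he
    filter_upwards [(h e).eventually_nhds, hb e] with e' h1 h2
    refine ⟨e, rfl, h1.self_of_nhds, ?_⟩
    filter_upwards [h1, h2] with e'' h3 h4 using ⟨h3, h4⟩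
  filter_upwards [h1] with Q hQ
  have h2 : ∀ᶠ R in 𝓝 Q, ∀ e'', q e'' = R → c P (q e'') = c Q (q e'') * c P Q := by
    refine eventually_of_isClosedMap hq fun e' he' => ?_
    obtain ⟨e, -, h3, h4⟩ := hQ e' he'
    subst he'
    filter_upwards [h4, h e'] with e'' h5 h6
    rw [h5.1, h5.2, h6, h3]
  filter_upwards [h2] with R hR
  obtain ⟨e'', rfl⟩ := hqs R
  exact hR e'' rfl

theorem IsGauge.descend {q : E → X} (hq : IsClosedMap q) (hqs : Function.Surjective q)
    {c c' : X → X → G} {g : X → G}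
    (h : IsGauge (fun e e' => c (q e) (q e')) (fun e e' => c' (q e) (q e')) (g ∘ q)) :
    IsGauge c c' g := by
  intro P
  have h2 : ∀ᶠ R in 𝓝 P, ∀ e, q e = R → c' P (q e) = g (q e) * c P (q e) * (g P)⁻¹ := by
    refine eventually_of_isClosedMap hq fun e he => ?_
    subst he
    exact h e
  filter_upwards [h2] with R hR
  obtain ⟨e, rfl⟩ := hqs R
  exact hR e rfl

end Gluing

/-! ### Cocycles on a cyclic gluing. -/

section CyclicGluing

variable {S E X G : Type*} [TopologicalSpace S] [TopologicalSpace E] [TopologicalSpace X] [Group G]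

/-- `X` is obtained from `d` copies of the endomorphism `E` of `S` by gluing them cyclically. -/
structure CyclicGluing (d : ℕ) [NeZero d] (inc out : C(S, E)) (X : Type*)
    [TopologicalSpace X] where
  height : C(E, ℝ)
  height_inc : ∀ s, height (inc s) = 0
  height_out : ∀ s, height (out s) = 1
  height_mem : ∀ e, height e ∈ Icc (0 : ℝ) 1
  isEmbedding_inc : IsEmbedding inc
  isEmbedding_out : IsEmbedding out
  piece : Fin d → C(E, X)
  isClosedMap : IsClosedMap fun w : Fin d × E => piece w.1 w.2
  surjective : Function.Surjective fun w : Fin d × E => piece w.1 w.2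
  glue : ∀ j s, piece j (out s) = piece (j + 1) (inc s)
  eq_or : ∀ {j k e e'}, piece j e = piece k e' → (j = k ∧ e = e') ∨
    (∃ s, e = out s ∧ k = j + 1 ∧ e' = inc s) ∨ ∃ s, e = inc s ∧ j = k + 1 ∧ e' = out s

namespace CyclicGluing

set_option linter.unusedSectionVars false

variable {d : ℕ} [NeZero d] {inc out : C(S, E)} (Q : CyclicGluing d inc out X)

theorem eventually_prod {P : Fin d × E → Prop} {j : Fin d} {e : E}
    (h : ∀ᶠ e' in 𝓝 e, P (j, e')) : ∀ᶠ w in 𝓝 (j, e), P w := by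
  rw [nhds_prod_eq, nhds_discrete, pure_prod, eventually_map]
  exact h

theorem inc_ne_out (Q : CyclicGluing d inc out X) (s s' : S) : inc s ≠ out s' := fun h => by
  have := Q.height_inc s
  rw [h, Q.height_out] at this
  exact one_ne_zero this

/-- Cocycles on the pieces that agree along the identifications can be glued. -/
theorem exists_cocycle {b : Fin d → E → E → G} (hb : ∀ j, IsCocycle (b j))
    (hbS : ∀ j s, ∀ᶠ s' in 𝓝 s, b j (out s) (out s') = b (j + 1) (inc s) (inc s')) :
    ∃ c : X → X → G, IsCocycle c ∧
      ∀ j e, ∀ᶠ e' in 𝓝 e, c (Q.piece j e) (Q.piece j e') = b j e e' := by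
  classical
  -- Points near each other in a piece may have several representations by pairs in one piece. The
  -- height bound excludes pairs with one point on each boundary copy, as could occur when few
  -- pieces are glued; the remaining ambiguity is between the two sides of one seam.
  let R : X → X → (Fin d × E) × E → Prop := fun P P' w => Q.piece w.1.1 w.1.2 = P ∧
    Q.piece w.1.1 w.2 = P' ∧ |Q.height w.1.2 - Q.height w.2| < 1 / 2
  let c : X → X → G := fun P P' =>
    if h : ∃ w, R P P' w then b h.choose.1.1 h.choose.1.2 h.choose.2 else 1
  have hc : ∀ j e, ∀ᶠ e' in 𝓝 e, c (Q.piece j e) (Q.piece j e') = b j e e' := by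
    intro j e
    have h1 : ∀ᶠ e' in 𝓝 e, |Q.height e - Q.height e'| < 1 / 2 := by
      have : ContinuousAt (fun e' => |Q.height e - Q.height e'|) e := by fun_prop
      exact this.eventually_lt continuousAt_const (by simp)
    -- When both points lie on a seam, the pair can also be read in the neighbouring piece. The
    -- hypothesis `hbS` makes both readings agree, first from the outgoing side and then from the
    -- incoming side.
    have h2 : ∀ᶠ e' in 𝓝 e, ∀ s s', e = out s → e' = out s' →
        b j (out s) (out s') = b (j + 1) (inc s) (inc s') := by
      by_cases h : ∃ s, e = out s
      · obtain ⟨s, rfl⟩ := h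
        have := hbS j s
        rw [Q.isEmbedding_out.nhds_eq_comap, eventually_comap] at this
        filter_upwards [this] with e' he' s₁ s' e1 e2
        rw [← Q.isEmbedding_out.injective e1]
        exact he' s' e2.symm
      · exact .of_forall fun _ s _ hs => absurd ⟨s, hs⟩ h
    have h3 : ∀ᶠ e' in 𝓝 e, ∀ s s' k, e = inc s → e' = inc s' → j = k + 1 →
        b k (out s) (out s') = b j (inc s) (inc s') := by
      by_cases h : ∃ s, e = inc s
      · obtain ⟨s, rfl⟩ := h
        have := hbS (j - 1) s
        rw [Q.isEmbedding_inc.nhds_eq_comap, eventually_comap] at this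
        filter_upwards [this] with e' he' s₁ s' k e1 e2 ek
        rw [← Q.isEmbedding_inc.injective e1]
        subst ek
        simpa using he' s' e2.symm
      · exact .of_forall fun _ s _ _ hs => absurd ⟨s, hs⟩ h
    filter_upwards [h1, h2, h3] with e' h1 h2 h3
    have hw : ∃ w, R (Q.piece j e) (Q.piece j e') w := ⟨((j, e), e'), rfl, rfl, h1⟩
    have hcw : c (Q.piece j e) (Q.piece j e') = b hw.choose.1.1 hw.choose.1.2 hw.choose.2 :=
      dif_pos hw
    rw [hcw]
    obtain ⟨w1, w2, w3⟩ := hw.choose_spec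
    generalize hw.choose = w at w1 w2 w3
    obtain ⟨⟨k, f⟩, f'⟩ := w
    change b k f f' = b j e e'
    change |Q.height f - Q.height f'| < 1 / 2 at w3
    have mem := fun e => Q.height_mem e
    rw [abs_lt] at h1 w3
    rcases Q.eq_or w1 with ⟨hk, hf⟩ | ⟨s, hf, hj, he⟩ | ⟨s, hf, hk, he⟩
    · have hk' : k = j := hk
      have hf' : f = e := hf
      subst hk' hf'
      rcases Q.eq_or w2 with ⟨-, h⟩ | ⟨s, e1, -, e2⟩ | ⟨s, e1, -, e2⟩
      · rw [show f' = e' from h]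
      · have e1 : f' = out s := e1
        rw [e1, Q.height_out] at w3; rw [e2, Q.height_inc] at h1
        linarith [h1.1, w3.2]
      · have e1 : f' = inc s := e1
        rw [e1, Q.height_inc] at w3; rw [e2, Q.height_out] at h1
        linarith
    · have hf : f = out s := hf
      have hj : j = k + 1 := hj
      rw [hf, Q.height_out] at w3; rw [he, Q.height_inc] at h1
      rcases Q.eq_or w2 with ⟨-, h⟩ | ⟨s', e1, -, e2⟩ | ⟨s', e1, -, e2⟩
      · have h : f' = e' := h
        rw [h] at w3
        linarith
      · have e1 : f' = out s' := e1
        rw [hf, e1, h3 s s' k he e2 hj, he, e2]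
      · have e1 : f' = inc s' := e1
        rw [e1, Q.height_inc] at w3
        linarith
    · have hf : f = inc s := hf
      have hk : k = j + 1 := hk
      rw [hf, Q.height_inc] at w3; rw [he, Q.height_out] at h1
      rcases Q.eq_or w2 with ⟨-, h⟩ | ⟨s', e1, -, e2⟩ | ⟨s', e1, -, e2⟩
      · have h : f' = e' := h
        rw [h] at w3
        linarith
      · have e1 : f' = out s' := e1
        rw [e1, Q.height_out] at w3
        linarith
      · have e1 : f' = inc s' := e1
        rw [hf, e1, he, e2, h2 s s' he e2, hk]
  refine ⟨c, IsCocycle.descend Q.isClosedMap Q.surjective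
    (b := fun w w' => b w.1 w.2 w'.2) ?_ ?_, hc⟩
  · rintro ⟨j, e⟩
    refine eventually_prod ?_
    filter_upwards [hb j e] with e' he'
    exact eventually_prod he'
  · rintro ⟨j, e⟩
    exact eventually_prod (hc j e)

theorem pull_glue {A : Set X} {B : Set E} {D : Set S} (hpiece : ∀ j, MapsTo (Q.piece j) B A)
    (hinc : MapsTo inc D B) (hout : MapsTo out D B) (x : RelH1 G A) (j : Fin d) :
    RelH1.pull out hout (RelH1.pull (Q.piece j) (hpiece j) x) =
      RelH1.pull inc hinc (RelH1.pull (Q.piece (j + 1)) (hpiece (j + 1)) x) := by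
  rw [RelH1.pull_pull, RelH1.pull_pull]
  have e : (Q.piece j).comp out = (Q.piece (j + 1)).comp inc :=
    ContinuousMap.ext fun s => Q.glue j s
  simp only [e]

/-- Cocycles on a cyclic gluing are cyclic sequences of cocycles on the piece. -/
theorem bijective_pull [PreconnectedSpace S] {A : Set X} {B : Set E} {D : Set S} (hD : D.Nonempty)
    (hpiece : ∀ j, MapsTo (Q.piece j) B A) (hminc : MapsTo inc D B) (hmout : MapsTo out D B)
    (hB : ∀ j e, Q.piece j e ∈ A ↔ e ∈ B) (hinc : ∀ s, inc s ∈ B ↔ s ∈ D)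
    (hout : ∀ s, out s ∈ B ↔ s ∈ D) :
    Function.Bijective (fun x : RelH1 G A =>
      (⟨fun j => RelH1.pull (Q.piece j) (hpiece j) x, Q.pull_glue hpiece hminc hmout x⟩ :
      {y : Fin d → RelH1 G B // ∀ j, RelH1.pull out hmout (y j) =
        RelH1.pull inc hminc (y (j + 1))})) := by
  classical
  constructor
  · intro x x' hxx'
    induction x using Quotient.ind with | _ c =>
    induction x' using Quotient.ind with | _ c' =>
    have h : ∀ j, ∃ g : E → G, (∀ a ∈ B, g a = 1) ∧
        IsGauge (fun e e' => c.1 (Q.piece j e) (Q.piece j e'))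
          (fun e e' => c'.1 (Q.piece j e) (Q.piece j e')) g := fun j =>
      relSetoid_iff.1 (congrFun (congrArg Subtype.val hxx') j)
    choose g hgB hg using h
    -- Both restrictions are gauges between the same cocycles on S and equal 1 at a point of D. As S
    -- is connected they coincide, so the gauges on the pieces fit together.
    have hS : ∀ j, g j ∘ out = g (j + 1) ∘ inc := by
      intro j
      obtain ⟨s₀, hs₀⟩ := hD
      have h1 := (hg j).comp out.continuous
      have h2 := (hg (j + 1)).comp inc.continuous
      simp only [Q.glue] at h1
      refine h1.eq_of_preconnected h2 (p := s₀) ?_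
      simp [hgB _ _ ((hout s₀).2 hs₀), hgB _ _ ((hinc s₀).2 hs₀)]
    let s : X → Fin d × E := Function.surjInv Q.surjective
    have hs : ∀ P, Q.piece (s P).1 (s P).2 = P := Function.surjInv_eq Q.surjective
    let f : X → G := fun P => g (s P).1 (s P).2
    have key : ∀ {k j} {e' e}, Q.piece k e' = Q.piece j e → g k e' = g j e := by
      intro k j e' e h
      rcases Q.eq_or h with ⟨rfl, rfl⟩ | ⟨z, rfl, rfl, rfl⟩ | ⟨z, rfl, rfl, rfl⟩
      · rfl
      · exact congrFun (hS _) z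
      · exact (congrFun (hS _) z).symm
    have hf : ∀ j e, f (Q.piece j e) = g j e := fun j e => key (hs _)
    refine relSetoid_iff.2 ⟨f, fun P hP => ?_, IsGauge.descend Q.isClosedMap Q.surjective ?_⟩
    · refine hgB _ _ ((hB (s P).1 _).1 ?_)
      rwa [hs]
    · rintro ⟨j, e⟩
      refine eventually_prod ?_
      filter_upwards [hg j e] with e' he'
      simpa [hf] using he'
  · rintro ⟨y, hy⟩
    have h : ∀ j, ∃ u : S → G, (∀ a ∈ D, u a = 1) ∧
        IsGauge (fun s s' => (y j).out.1 (out s) (out s'))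
          (fun s s' => (y (j + 1)).out.1 (inc s) (inc s')) u := by
      intro j
      have := hy j
      rw [← (y j).out_eq, ← (y (j + 1)).out_eq] at this
      exact relSetoid_iff.1 this
    choose u huD hu using h
    -- Gauge transformations are arbitrary functions, so the seam gauge extends by 1 off the
    -- outgoing copy. It corrects the outgoing end of piece j and leaves the incoming end, which is
    -- disjoint, untouched.
    let v : Fin d → E → G := fun j e => if h : ∃ s, e = out s then u j h.choose else 1
    have vout : ∀ j s, v j (out s) = u j s := fun j s => by
      have h : ∃ s', out s = out s' := ⟨s, rfl⟩
      simp only [v]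
      rw [dif_pos h, ← Q.isEmbedding_out.injective h.choose_spec]
    have vinc : ∀ j s, v j (inc s) = 1 := fun j s =>
      dif_neg fun ⟨s', h⟩ => Q.inc_ne_out s s' h
    have vB : ∀ j, ∀ e ∈ B, v j e = 1 := by
      intro j e he
      by_cases h : ∃ s, e = out s
      · obtain ⟨s, rfl⟩ := h
        rw [vout, huD _ _ ((hout s).1 he)]
      · exact dif_neg h
    let b : Fin d → E → E → G := fun j p x => v j x * (y j).out.1 p x * (v j p)⁻¹
    have hb : ∀ j, IsCocycle (b j) := fun j => (y j).out.2.1.gauge _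
    obtain ⟨c, hc, hcb⟩ := Q.exists_cocycle hb fun j s => by
      filter_upwards [hu j s] with s' hs'
      simp only [b, vout, vinc]
      rw [hs']
      simp
    refine ⟨⟦⟨c, hc, fun P hP => ?_⟩⟧, Subtype.ext (funext fun j => ?_)⟩
    · have : ∀ᶠ P' in 𝓝 P, ∀ w : Fin d × E, Q.piece w.1 w.2 = P' →
          w.2 ∈ B → c P (Q.piece w.1 w.2) = 1 := by
        refine eventually_of_isClosedMap Q.isClosedMap ?_
        rintro ⟨j, e⟩ rfl
        refine eventually_prod ?_
        have heB : e ∈ B := (hB j e).1 hP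
        have := eventually_nhdsWithin_iff.1 ((y j).out.2.2 e heB)
        filter_upwards [this, hcb j e] with e' h1 h2 h3
        rw [h2]
        simp [b, h1 h3, vB j e heB, vB j e' h3]
      refine eventually_nhdsWithin_iff.2 ?_
      filter_upwards [this] with P' h hP'
      obtain ⟨⟨j, e⟩, rfl⟩ := Q.surjective P'
      exact h (j, e) rfl ((hB j e).1 hP')
    · change RelH1.pull (Q.piece j) _ ⟦_⟧ = y j
      rw [eq_comm, ← (y j).out_eq]
      refine relSetoid_iff.2 ⟨v j, vB j, fun e => ?_⟩
      filter_upwards [hcb j e] with e' he'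
      exact he'

end CyclicGluing

end CyclicGluing

/-! ### Convex local models of pairs. -/

section ConvexModel

variable {V : Type*} [NormedAddCommGroup V] [InnerProductSpace ℝ V]

/-- The nearest point retraction onto a closed convex set. -/
theorem exists_convex_retraction [CompleteSpace V] {K : Set V} (hK : Convex ℝ K)
    (hKc : IsClosed K) (hne : K.Nonempty) :
    ∃ P : V → V, (∀ u, P u ∈ K) ∧ (∀ u v, ‖P u - P v‖ ≤ ‖u - v‖) ∧ ∀ v ∈ K, P v = v := by
  choose P hP hPn using fun u => exists_norm_eq_iInf_of_complete_convex hne hKc.isComplete hK u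
  have hin : ∀ u, ∀ w ∈ K, inner ℝ (u - P u) (w - P u) ≤ 0 := fun u =>
    (norm_eq_iInf_iff_real_inner_le_zero hK (hP u)).1 (hPn u)
  have hlip : ∀ u v, ‖P u - P v‖ ≤ ‖u - v‖ := by
    intro u v
    have h1 := hin u (P v) (hP v)
    have h2 := hin v (P u) (hP u)
    have h3 : ‖P u - P v‖ * ‖P u - P v‖ ≤ ‖u - v‖ * ‖P u - P v‖ := by
      rw [← real_inner_self_eq_norm_mul_norm]
      refine le_trans ?_ (real_inner_le_norm (u - v) (P u - P v))
      have e : inner ℝ (u - v) (P u - P v) - inner ℝ (P u - P v) (P u - P v) =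
          -(inner ℝ (u - P u) (P v - P u)) - inner ℝ (v - P v) (P u - P v) := by
        simp only [inner_sub_left, inner_sub_right]
        ring
      linarith
    rcases (norm_nonneg (P u - P v)).eq_or_lt with h | h
    · rw [← h]; exact norm_nonneg _
    · exact le_of_mul_le_mul_right h3 h
  refine ⟨P, hP, hlip, fun v hv => ?_⟩
  have h := hin v v hv
  rw [real_inner_self_eq_norm_sq] at h
  have : ‖v - P v‖ = 0 := by nlinarith [norm_nonneg (v - P v)]
  exact (sub_eq_zero.1 (norm_eq_zero.1 this)).symm

variable {X : Type*} [TopologicalSpace X]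

/-- A chart of `X` at `p` onto a relatively open ball in a closed convex set that takes `A` to a
closed convex set. -/
structure ConvexModel (V : Type*) [NormedAddCommGroup V] [InnerProductSpace ℝ V] (A : Set X)
    (p : X) where
  carrier : Set V
  sub : Set V
  center : V
  radius : ℝ
  map : ↥(carrier ∩ Metric.ball center radius) → X
  convex : Convex ℝ carrier
  isClosed : IsClosed carrier
  sub_subset : sub ⊆ carrier
  convex_sub : Convex ℝ sub
  isClosed_sub : IsClosed sub
  center_mem : center ∈ carrier
  radius_pos : 0 < radius
  isOpenEmbedding : IsOpenEmbedding map
  map_center : map ⟨center, center_mem, Metric.mem_ball_self radius_pos⟩ = p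
  mem_iff : ∀ v, map v ∈ A ↔ (v : V) ∈ sub

namespace ConvexModel

variable {A : Set X} {p : X}

/-- The parameter domain of the chart. -/
abbrev domain (φ : ConvexModel V A p) : Set V := φ.carrier ∩ Metric.ball φ.center φ.radius

theorem convex_domain (φ : ConvexModel V A p) : Convex ℝ φ.domain := φ.convex.inter (convex_ball _ _)

/-- The center of the parameter domain. -/
def base (φ : ConvexModel V A p) : φ.domain := ⟨φ.center, φ.center_mem, Metric.mem_ball_self φ.radius_pos⟩

theorem map_base (φ : ConvexModel V A p) : φ.map φ.base = p := φ.map_center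

theorem contractibleSpace_domain (φ : ConvexModel V A p) : ContractibleSpace φ.domain :=
  φ.convex_domain.contractibleSpace ⟨_, φ.base.2⟩

theorem range_mem_nhds (φ : ConvexModel V A p) : range φ.map ∈ 𝓝 p :=
  φ.isOpenEmbedding.isOpen_range.mem_nhds ⟨_, φ.map_base⟩

theorem smallLoopsTrivialAt (φ : ConvexModel V A p) : SmallLoopsTrivialAt p := by
  refine ⟨range φ.map, φ.range_mem_nhds, fun γ hγ => ?_⟩
  have := φ.contractibleSpace_domain
  let e := φ.isOpenEmbedding.toIsEmbedding.toHomeomorph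
  have he : ∀ y, φ.map (e.symm y) = y := fun y => congrArg Subtype.val (e.apply_symm_apply y)
  have hend : ∀ t, γ t = p → e.symm ⟨γ t, hγ t⟩ = φ.base := fun t ht =>
    φ.isOpenEmbedding.injective ((he _).trans (ht.trans φ.map_base.symm))
  let γ' : Path φ.base φ.base := ⟨⟨fun t => e.symm ⟨γ t, hγ t⟩, by fun_prop⟩,
    hend 0 γ.source, hend 1 γ.target⟩
  have h : γ'.Homotopic (Path.refl _) := SimplyConnectedSpace.paths_homotopic _ _
  have h2 := h.map ⟨φ.map, φ.isOpenEmbedding.continuous⟩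
  obtain ⟨H⟩ := h2
  refine ⟨(H.pathCast φ.map_base.symm φ.map_base.symm).cast ?_ ?_⟩
  · ext t
    exact he _
  · ext t
    exact φ.map_base

/-- The chart image is contractible and A meets it in the image of a convex set, hence in a
connected set. -/
theorem trivializesCocycles (φ : ConvexModel V A p) (G : Type*) [Group G] [LocallyPathConnectedSpace X] :
    TrivializesCocycles G A (range φ.map) := by
  have := φ.contractibleSpace_domain
  let e := φ.isOpenEmbedding.toIsEmbedding.toHomeomorph
  have : ContractibleSpace (range φ.map) := e.symm.contractibleSpace
  refine TrivializesCocycles.of_simplyConnected φ.isOpenEmbedding.isOpen_range ?_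
  have : PreconnectedSpace ↥(φ.sub ∩ φ.domain) :=
    Subtype.preconnectedSpace (φ.convex_sub.inter φ.convex_domain).isPreconnected
  have h : A ∩ range φ.map =
      range fun v : ↥(φ.sub ∩ φ.domain) => φ.map (inclusion inter_subset_right v) := by
    ext x
    constructor
    · rintro ⟨hx, v, rfl⟩
      exact ⟨⟨v, (φ.mem_iff v).1 hx, v.2⟩, rfl⟩
    · rintro ⟨v, rfl⟩
      exact ⟨(φ.mem_iff _).2 v.2.1, _, rfl⟩
  rw [h]
  exact isPreconnected_range (φ.isOpenEmbedding.continuous.comp (continuous_inclusion _))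

theorem exists_pathConnected_nhd (φ : ConvexModel V A p) {U : Set X} (hU : U ∈ 𝓝 p) :
    ∃ W ∈ 𝓝 p, IsPathConnected W ∧ W ⊆ U := by
  have h1 : φ.map ⁻¹' U ∈ 𝓝 φ.base := by
    refine φ.isOpenEmbedding.continuous.continuousAt ?_
    rwa [φ.map_base]
  obtain ⟨ε, hε, hball⟩ := Metric.mem_nhds_iff.1 h1
  refine ⟨φ.map '' Metric.ball φ.base ε, ?_, ?_, image_subset_iff.2 hball⟩
  · have := φ.isOpenEmbedding.isOpenMap.image_mem_nhds (Metric.ball_mem_nhds φ.base hε)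
    rwa [φ.map_base] at this
  · refine IsPathConnected.image ?_ φ.isOpenEmbedding.continuous
    have h2 : Metric.ball φ.base ε = ((↑) : φ.domain → V) ⁻¹' (φ.domain ∩ Metric.ball φ.center ε) := by
      ext v
      simp [Subtype.dist_eq, base]
      intro _
      exact v.2
    rw [h2]
    exact ((φ.convex_domain.inter (convex_ball _ _)).isPathConnected
      ⟨φ.center, φ.base.2, Metric.mem_ball_self hε⟩).preimage_coe inter_subset_left

/-- In the chart, points move linearly towards their nearest point in the convex set modelling A. A
cutoff equal to 1 on the ball of radius r/3 and 0 outside radius 2r/3 makes the motion extend by the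
identity. -/
theorem exists_pushesInto (φ : ConvexModel V A p) [FiniteDimensional ℝ V] [T2Space X] (hp : p ∈ A) :
    ∃ S ∈ 𝓝[A] p, PushesInto A S := by
  classical
  have hcen : φ.center ∈ φ.sub := (φ.mem_iff φ.base).1 (by rwa [φ.map_base])
  obtain ⟨P, hPK, hPl, hPid⟩ := exists_convex_retraction φ.convex_sub φ.isClosed_sub ⟨_, hcen⟩
  have hPc : Continuous P := (LipschitzWith.of_dist_le_mul (K := 1) fun u v => by
    simpa [dist_eq_norm] using hPl u v).continuous
  have hr := φ.radius_pos
  set r := φ.radius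
  let η : V → ℝ := fun v => max 0 (min 1 (2 - 3 * ‖v - φ.center‖ / r))
  have hη0 : ∀ v, 0 ≤ η v := fun v => le_max_left _ _
  have hη1 : ∀ v, η v ≤ 1 := fun v => max_le zero_le_one (min_le_left _ _)
  have hηc : Continuous η := by fun_prop
  have hηin : ∀ v, ‖v - φ.center‖ < r / 3 → η v = 1 := fun v hv => by
    have : 3 * ‖v - φ.center‖ / r ≤ 1 := by rw [div_le_one hr]; linarith
    simp only [η]
    rw [min_eq_left (by linarith), max_eq_right zero_le_one]
  have hηout : ∀ v, 2 * r / 3 < ‖v - φ.center‖ → η v = 0 := fun v hv => by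
    have : 2 ≤ 3 * ‖v - φ.center‖ / r := by rw [le_div_iff₀ hr]; linarith
    simp only [η]
    exact max_eq_left ((min_le_right _ _).trans (by linarith))
  -- The retraction is nonexpansive and fixes the centre, so it keeps points in the ball; convexity
  -- does the rest.
  have hmem : ∀ (t : I) (v : φ.domain), (v : V) + (t * η v) • (P v - v) ∈ φ.domain := by
    intro t v
    have hPv : P v ∈ φ.domain := by
      refine ⟨φ.sub_subset (hPK v), ?_⟩
      have := hPl v φ.center
      rw [hPid _ hcen] at this
      have hv := v.2.2
      rw [Metric.mem_ball, dist_eq_norm] at hv ⊢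
      exact this.trans_lt hv
    exact φ.convex_domain.add_smul_sub_mem v.2 hPv
      ⟨mul_nonneg t.2.1 (hη0 _), mul_le_one₀ t.2.2 (hη0 _) (hη1 _)⟩
  let F : I × φ.domain → φ.domain := fun q => ⟨q.2 + (q.1 * η q.2) • (P q.2 - q.2), hmem q.1 q.2⟩
  have hF : Continuous F := by
    refine Continuous.subtype_mk ?_ _
    fun_prop
  let H : I × X → X := fun q => if h : ∃ v, φ.map v = q.2 then φ.map (F (q.1, h.choose)) else q.2
  have Hmap : ∀ t v, H (t, φ.map v) = φ.map (F (t, v)) := fun t v => by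
    have h : ∃ w, φ.map w = φ.map v := ⟨v, rfl⟩
    simp only [H]
    rw [dif_pos h, φ.isOpenEmbedding.injective h.choose_spec]
  have Hout : ∀ t x, x ∉ range φ.map → H (t, x) = x := fun t x hx => dif_neg hx
  -- Compactness makes this set closed in the Hausdorff space X, so H is the identity near every
  -- point outside the chart.
  let L : Set X := φ.map '' {v | ‖(v : V) - φ.center‖ ≤ 2 * r / 3}
  have hL : IsClosed L := by
    refine IsCompact.isClosed (IsCompact.image ?_ φ.isOpenEmbedding.continuous)
    rw [Subtype.isCompact_iff]
    have : ((↑) '' {v : φ.domain | ‖(v : V) - φ.center‖ ≤ 2 * r / 3} : Set V) =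
        φ.carrier ∩ Metric.closedBall φ.center (2 * r / 3) := by
      ext v
      constructor
      · rintro ⟨w, hw, rfl⟩
        exact ⟨w.2.1, by simpa [dist_eq_norm] using hw⟩
      · rintro ⟨h1, h2⟩
        rw [Metric.mem_closedBall, dist_eq_norm] at h2
        refine ⟨⟨v, h1, ?_⟩, h2, rfl⟩
        rw [Metric.mem_ball, dist_eq_norm]
        linarith
    rw [this]
    exact (isCompact_closedBall _ _).inter_left φ.isClosed
  have hHc : Continuous H := by
    refine continuous_iff_continuousAt.2 ?_
    rintro ⟨t, x⟩
    by_cases hx : x ∈ range φ.map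
    · obtain ⟨v, rfl⟩ := hx
      have he : IsOpenEmbedding (Prod.map (id : I → I) φ.map) :=
        IsOpenEmbedding.id.prodMap φ.isOpenEmbedding
      have := (he.continuousAt_iff (g := H) (x := (t, v))).1 ?_
      · exact this
      · have e : H ∘ Prod.map id φ.map = φ.map ∘ F := by
          funext q
          exact Hmap q.1 q.2
        rw [e]
        exact (φ.isOpenEmbedding.continuous.comp hF).continuousAt
    · have hxL : x ∉ L := fun h => hx (image_subset_range _ _ h)
      have : H =ᶠ[𝓝 (t, x)] Prod.snd := by
        have h1 : ∀ᶠ q : I × X in 𝓝 (t, x), q.2 ∈ Lᶜ :=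
          continuous_snd.continuousAt (hL.isOpen_compl.mem_nhds hxL)
        filter_upwards [h1] with ⟨s, y⟩ hy
        by_cases hyr : y ∈ range φ.map
        · obtain ⟨v, rfl⟩ := hyr
          have hv : 2 * r / 3 < ‖(v : V) - φ.center‖ := by
            by_contra h
            exact hy ⟨v, not_lt.1 h, rfl⟩
          rw [Hmap]
          congr 1
          ext
          simp [F, hηout _ hv]
        · exact Hout s y hyr
      exact continuousAt_snd.congr this.symm
  refine ⟨φ.map '' Metric.ball φ.base (r / 3) ∩ A, ?_, ⟨H, hHc⟩, fun x => ?_, fun a ha t => ?_, ?_⟩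
  · refine inter_mem (mem_nhdsWithin_of_mem_nhds ?_) self_mem_nhdsWithin
    have := φ.isOpenEmbedding.isOpenMap.image_mem_nhds
      (Metric.ball_mem_nhds φ.base (by positivity : 0 < r / 3))
    rwa [φ.map_base] at this
  · by_cases hx : x ∈ range φ.map
    · obtain ⟨v, rfl⟩ := hx
      change H _ = _
      rw [Hmap]
      congr 1
      ext
      simp [F]
    · exact Hout 0 x hx
  · by_cases hx : a ∈ range φ.map
    · obtain ⟨v, rfl⟩ := hx
      change H _ = _
      rw [Hmap]
      congr 1
      ext
      simp [F, hPid _ ((φ.mem_iff v).1 ha)]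
    · exact Hout t a hx
  · rintro _ ⟨⟨v, hv, rfl⟩, -⟩
    have := φ.isOpenEmbedding.isOpenMap.image_mem_nhds (Metric.isOpen_ball.mem_nhds hv)
    filter_upwards [this]
    rintro _ ⟨w, hw, rfl⟩
    change H _ ∈ A
    rw [Hmap, φ.mem_iff]
    have hw' : ‖(w : V) - φ.center‖ < r / 3 := by
      simpa [Subtype.dist_eq, dist_eq_norm, base] using hw
    simp [F, hηin _ hw', hPK]

end ConvexModel

/-- A space that has a convex model at each point is locally path connected. -/
theorem locallyPathConnectedSpace_of_convexModel {A : Set X} (h : ∀ p, Nonempty (ConvexModel V A p)) :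
    LocallyPathConnectedSpace X where
  path_connected_basis p := by
    rw [hasBasis_self]
    intro U hU
    obtain ⟨φ⟩ := h p
    exact φ.exists_pathConnected_nhd hU

theorem isTamePair_of_convexModel [FiniteDimensional ℝ V] [T2Space X] [CompactSpace X] {A : Set X}
    (h : ∀ p, Nonempty (ConvexModel V A p)) (hA : IsClosed A) (hne : A.Nonempty)
    (hconn : IsConnected (univ : Set (Collapse A))) : IsTamePair A where
  isClosed := hA
  nonempty := hne
  pushes := pushesInto_of_local hA.isCompact fun a ha => (h a).some.exists_pushesInto ha
  smallLoops p _ := (h p).some.smallLoopsTrivialAt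
  connected := hconn

theorem finite_relH1_of_convexModel (G : Type*) [Group G] [Finite G] [T2Space X] [CompactSpace X]
    {A : Set X} (h : ∀ p, Nonempty (ConvexModel V A p)) : Finite (RelH1 G A) := by
  have := locallyPathConnectedSpace_of_convexModel h
  refine RelH1.finite fun p => ?_
  obtain ⟨φ⟩ := h p
  exact ⟨range φ.map, φ.isOpenEmbedding.isOpen_range, mem_of_mem_nhds φ.range_mem_nhds,
    φ.trivializesCocycles G⟩

end ConvexModel

/-! ### Lipschitz straightening of functions and immersions. -/

section Straightening

open scoped NNReal

variable {V W : Type*} [NormedAddCommGroup V] [NormedSpace ℝ V]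
  [NormedAddCommGroup W] [NormedSpace ℝ W]

/-- A map that is Lipschitz close to the identity is a homeomorphism. -/
theorem exists_homeomorph_of_approximates_id [FiniteDimensional ℝ V] {g : V → V} {c : ℝ≥0}
    (hg : ApproximatesLinearOn g (ContinuousLinearMap.id ℝ V) univ c) (hc : c < 1) :
    ∃ T : V ≃ₜ V, ⇑T = g := by
  have h : Subsingleton V ∨
      c < ‖((ContinuousLinearEquiv.refl ℝ V).symm : V →L[ℝ] V)‖₊⁻¹ := by
    rcases subsingleton_or_nontrivial V with h | h
    · exact Or.inl h
    · right
      have e : ((ContinuousLinearEquiv.refl ℝ V).symm : V →L[ℝ] V) =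
        ContinuousLinearMap.id ℝ V := rfl
      rw [e, ContinuousLinearMap.nnnorm_id, inv_one]
      exact hc
  have hg' : ApproximatesLinearOn g ((ContinuousLinearEquiv.refl ℝ V : V ≃L[ℝ] V) : V →L[ℝ] V)
    univ c := hg
  exact ⟨hg'.toHomeomorph g h, rfl⟩

/-- A function that is Lipschitz close to a linear one becomes linear after a homeomorphism that
moves points in a prescribed transverse direction only. -/
theorem exists_straightening [FiniteDimensional ℝ V] {F : V → ℝ} {l : V →L[ℝ] ℝ} {b : V}
    (hb : l b = 1) {s : Set V} {c : ℝ≥0} (hF : ApproximatesLinearOn F l s c) (hc : c * ‖b‖₊ < 1) :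
    ∃ T : V ≃ₜ V, (∀ v, ∃ r : ℝ, T v = v + r • b) ∧ ∀ v ∈ s, l (T v) = F v := by
  -- With u a Lipschitz extension of F − l, the map v ↦ v + u(v)b is close to the identity and l
  -- takes it to l + u, which is F on s.
  obtain ⟨u, hu, hus⟩ := hF.lipschitzOnWith.extend_real
  have happ : ApproximatesLinearOn (fun v => v + u v • b) (ContinuousLinearMap.id ℝ V) univ
      (c * ‖b‖₊) := by
    intro x _ y _
    have e : x + u x • b - (y + u y • b) - (ContinuousLinearMap.id ℝ V) (x - y) =
        (u x - u y) • b := by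
      rw [ContinuousLinearMap.id_apply, sub_smul]; abel
    rw [e, norm_smul, NNReal.coe_mul, coe_nnnorm]
    have := hu.dist_le_mul x y
    rw [dist_eq_norm, dist_eq_norm] at this
    nlinarith [norm_nonneg b]
  obtain ⟨T, hT⟩ := exists_homeomorph_of_approximates_id happ hc
  refine ⟨T, fun v => ⟨u v, by rw [hT]⟩, fun v hv => ?_⟩
  rw [hT]
  have := hus hv
  simp only [Pi.sub_apply] at this
  simp only [map_add, map_smul, hb, smul_eq_mul, mul_one, ← this]
  ring

/-- A `C¹` function is Lipschitz close to its derivative. -/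
theorem exists_approximatesLinearOn {f : V → W} {s : Set V} (hs : Convex ℝ s)
    (hu : UniqueDiffOn ℝ s) {x : V} (hx : x ∈ s) (hf : ContDiffWithinAt ℝ 1 f s x) {c : ℝ≥0}
    (hc : 0 < c) : ∃ r > 0, ApproximatesLinearOn f (fderivWithin ℝ f s x)
      (s ∩ Metric.ball x r) c := by
  obtain ⟨u, hus, -, -, f', hf', hf'c⟩ :=
    (contDiffWithinAt_succ_iff_hasFDerivWithinAt' (n := 0) (by simp)).1 (by simpa using hf)
  rw [insert_eq_of_mem hx] at hus
  have hxu : x ∈ u := mem_of_mem_nhdsWithin hx hus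
  have e : fderivWithin ℝ f s x = f' x := (hf' x hxu).fderivWithin (hu x hx)
  have h1 : ∀ᶠ y in 𝓝[s] x, dist (f' y) (f' x) < c :=
    hf'c.continuousWithinAt.eventually (Metric.ball_mem_nhds _ hc)
  obtain ⟨r, hr, hball⟩ := Metric.mem_nhdsWithin_iff.1 (inter_mem hus h1)
  refine ⟨r, hr, fun y hy z hz => ?_⟩
  rw [e]
  refine Convex.norm_image_sub_le_of_norm_hasFDerivWithin_le' (s := s ∩ Metric.ball x r)
    (f' := f') (fun w hw => (hf' w (hball ⟨hw.2, hw.1⟩).1).mono inter_subset_left) (fun w hw => ?_)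
    (hs.inter (convex_ball _ _)) hz hy
  rw [← dist_eq_norm]
  exact (hball ⟨hw.2, hw.1⟩).2.le

/-- A map that is Lipschitz close to a linear embedding is the restriction of that embedding up to
a homeomorphism close to the identity. -/
theorem exists_homeomorph_of_immersion [FiniteDimensional ℝ V] [FiniteDimensional ℝ W]
    {J : V → W} {J' : V →L[ℝ] W} (hJ' : Function.Injective J') {s : Set V} {x : V}
    (hJ : ∀ c : ℝ≥0, 0 < c → ∃ r > 0, ApproximatesLinearOn J J' (s ∩ Metric.ball x r) c)
    {c : ℝ≥0} (hc : 0 < c) (hc1 : c < 1) :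
    ∃ g : W ≃ₜ W, ApproximatesLinearOn g (ContinuousLinearMap.id ℝ W) univ c ∧
      ∃ r > 0, ∀ v ∈ s ∩ Metric.ball x r, g (J' v) = J v := by
  obtain ⟨P₀, hP₀⟩ := LinearMap.exists_leftInverse_of_injective (J' : V →ₗ[ℝ] W)
    (LinearMap.ker_eq_bot.2 hJ')
  let P : W →L[ℝ] V := LinearMap.toContinuousLinearMap P₀
  have hP : ∀ v, P (J' v) = v := fun v => LinearMap.congr_fun hP₀ v
  -- The homeomorphism is id + u ∘ P with u extending J − J'. Extension and composition with P
  -- multiply the Lipschitz constant by at most the denominator; the extra 1 avoids division by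
  -- zero.
  set a : ℝ≥0 := c / (lipschitzExtensionConstant W * (‖P‖₊ + 1)) with ha
  have hL := lipschitzExtensionConstant_pos W
  have hapos : 0 < a := by positivity
  obtain ⟨r, hr, hJr⟩ := hJ a hapos
  obtain ⟨u, hu, hus⟩ := hJr.lipschitzOnWith.extend_finite_dimension
  have hk : lipschitzExtensionConstant W * a * ‖P‖₊ ≤ c := by
    calc lipschitzExtensionConstant W * a * ‖P‖₊
        ≤ lipschitzExtensionConstant W * a * (‖P‖₊ + 1) := by gcongr; simp
      _ = c := by
        rw [ha]
        field_simp
  have happ : ApproximatesLinearOn (fun v => v + u (P v)) (ContinuousLinearMap.id ℝ W) univ c := by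
    intro v _ w _
    have e : v + u (P v) - (w + u (P w)) - (ContinuousLinearMap.id ℝ W) (v - w) =
        u (P v) - u (P w) := by
      rw [ContinuousLinearMap.id_apply]; abel
    rw [e, ← dist_eq_norm]
    refine (hu.dist_le_mul _ _).trans ?_
    have h2 : dist (P v) (P w) ≤ ‖P‖₊ * ‖v - w‖ := by
      rw [dist_eq_norm, ← map_sub]
      exact P.le_opNorm _
    calc ((lipschitzExtensionConstant W * a : ℝ≥0) : ℝ) * dist (P v) (P w)
        ≤ ((lipschitzExtensionConstant W * a : ℝ≥0) : ℝ) * (‖P‖₊ * ‖v - w‖) := by gcongr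
      _ = ((lipschitzExtensionConstant W * a * ‖P‖₊ : ℝ≥0) : ℝ) * ‖v - w‖ := by
        push_cast; ring
      _ ≤ c * ‖v - w‖ := by gcongr
  obtain ⟨g, hg⟩ := exists_homeomorph_of_approximates_id happ hc1
  refine ⟨g, by rwa [hg], r, hr, fun v hv => ?_⟩
  have := hus hv
  simp only [Pi.sub_apply] at this
  rw [hg]
  simp only [hP]
  rw [← this]
  abel

/-- Precomposition with a map close to the identity does not change the derivative much. -/
theorem ApproximatesLinearOn.comp_near_id {F : W → ℝ} {l : W →L[ℝ] ℝ} {s : Set W} {g : W → W}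
    {a c : ℝ≥0} (hF : ApproximatesLinearOn F l s a)
    (hg : ApproximatesLinearOn g (ContinuousLinearMap.id ℝ W) univ c) :
    ApproximatesLinearOn (F ∘ g) l (g ⁻¹' s) (a * (1 + c) + ‖l‖₊ * c) := by
  intro x hx y hy
  have h1 := hF (g x) hx (g y) hy
  have h2 := hg x trivial y trivial
  rw [ContinuousLinearMap.id_apply] at h2
  have h3 : ‖g x - g y‖ ≤ (1 + c) * ‖x - y‖ := by
    have : g x - g y = (x - y) + (g x - g y - (x - y)) := by abel
    rw [this]
    refine (norm_add_le _ _).trans ?_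
    linarith
  have h4 : ‖l (g x - g y - (x - y))‖ ≤ ‖l‖ * (c * ‖x - y‖) :=
    (l.le_opNorm _).trans (by gcongr)
  have e : (F ∘ g) x - (F ∘ g) y - l (x - y) =
      (F (g x) - F (g y) - l (g x - g y)) + l (g x - g y - (x - y)) := by
    simp only [Function.comp_apply, map_sub]; ring
  rw [e]
  refine (norm_add_le _ _).trans ?_
  have h5 : (a : ℝ) * ‖g x - g y‖ ≤ a * ((1 + c) * ‖x - y‖) := by gcongr
  push_cast
  linarith

end Straightening

end Cohomology

/-! ### Convex models from manifold charts. -/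

section ManifoldModel

variable {m : ℕ} [NeZero m] {M : Type*} [TopologicalSpace M] [ChartedSpace (EuclideanHalfSpace m) M]

/-- A convex model from a chart of a manifold and a homeomorphism of the coordinate space that
straightens the chart domain and the subspace. -/
theorem exists_convexModel_of_chart {x : M} {A : Set M}
    (g : EuclideanSpace ℝ (Fin m) ≃ₜ EuclideanSpace ℝ (Fin m)) {z₀ : EuclideanSpace ℝ (Fin m)}
    (hz : g z₀ = extChartAt (𝓡∂ m) x x) {C K : Set (EuclideanSpace ℝ (Fin m))}
    (hC : Convex ℝ C) (hCc : IsClosed C) (hK : Convex ℝ K) (hKc : IsClosed K) (hKC : K ⊆ C)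
    (h1 : ∀ᶠ z in 𝓝 z₀, g z ∈ range (𝓡∂ m) ↔ z ∈ C)
    (h2 : ∀ᶠ z in 𝓝 z₀, z ∈ C → ((extChartAt (𝓡∂ m) x).symm (g z) ∈ A ↔ z ∈ K))
    {P : EuclideanSpace ℝ (Fin m) → M → Prop}
    (h3 : ∀ᶠ z in 𝓝 z₀, z ∈ C → P z ((extChartAt (𝓡∂ m) x).symm (g z))) :
    ∃ φ : ConvexModel (EuclideanSpace ℝ (Fin m)) A x, ∀ v : φ.domain, P v (φ.map v) := by
  set e := extChartAt (𝓡∂ m) x with he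
  have hgc : Continuous g := g.continuous
  have h4 : ∀ᶠ z in 𝓝 z₀, g z ∈ range (𝓡∂ m) → g z ∈ e.target := by
    have := extChartAt_target_mem_nhdsWithin (I := 𝓡∂ m) x
    rw [← he, ← hz] at this
    exact hgc.continuousAt.eventually (eventually_nhdsWithin_iff.1 this)
  obtain ⟨ρ, hρ, hball⟩ := Metric.eventually_nhds_iff_ball.1 (h1.and (h2.and (h3.and h4)))
  have hxe : x ∈ e.source := mem_extChartAt_source x
  have hz0C : z₀ ∈ C := by
    refine (hball z₀ (Metric.mem_ball_self hρ)).1.1 ?_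
    rw [hz]
    exact extChartAt_target_subset_range x (e.map_source hxe)
  have htar : ∀ v : ↥(C ∩ Metric.ball z₀ ρ), g v ∈ e.target := fun v =>
    (hball v v.2.2).2.2.2 ((hball v v.2.2).1.2 v.2.1)
  let ψ : ↥(C ∩ Metric.ball z₀ ρ) → M := fun v => e.symm (g v)
  have hψc : Continuous ψ :=
    (continuousOn_extChartAt_symm x).comp_continuous (hgc.comp continuous_subtype_val) htar
  have hinv : ∀ v, g.symm (e (ψ v)) = v := fun v => by
    simp only [ψ]
    rw [e.right_inv (htar v), g.symm_apply_apply]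
  have hψi : Function.Injective ψ := fun v w h => Subtype.ext (by rw [← hinv v, h, hinv w])
  have hopen : IsOpenMap ψ := by
    intro U hU
    obtain ⟨U', hU', rfl⟩ := isOpen_induced_iff.1 hU
    have himg : ψ '' (Subtype.val ⁻¹' U') =
        e.source ∩ (fun y => g.symm (e y)) ⁻¹' (U' ∩ Metric.ball z₀ ρ) := by
      ext y
      constructor
      · rintro ⟨v, hv, rfl⟩
        refine ⟨e.map_target (htar v), ?_⟩
        rw [mem_preimage, hinv]
        exact ⟨hv, v.2.2⟩
      · rintro ⟨hy, hyU, hyb⟩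
        have hyb' : g.symm (e y) ∈ Metric.ball z₀ ρ := hyb
        have hmem : g.symm (e y) ∈ C := by
          refine (hball _ hyb').1.1 ?_
          rw [g.apply_symm_apply]
          exact extChartAt_target_subset_range x (e.map_source hy)
        refine ⟨⟨_, hmem, hyb'⟩, hyU, ?_⟩
        simp only [ψ]
        rw [g.apply_symm_apply, e.left_inv hy]
    rw [himg]
    exact (g.symm.continuous.comp_continuousOn (continuousOn_extChartAt x)).isOpen_inter_preimage
      (isOpen_extChartAt_source x) (hU'.inter Metric.isOpen_ball)
  refine ⟨⟨C, K, z₀, ρ, ψ, hC, hCc, hKC, hK, hKc, hz0C, hρ,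
    .of_continuous_injective_isOpenMap hψc hψi hopen, ?_, fun v => ?_⟩, fun v => ?_⟩
  · simp only [ψ]
    rw [hz, e.left_inv hxe]
  · exact (hball v v.2.2).2.1 v.2.1
  · exact (hball v v.2.2).2.2.1 v.2.1

/-- The half-space as a convex set. -/
theorem convex_range_halfSpace : Convex ℝ (range (𝓡∂ m)) := by
  rw [range_modelWithCornersEuclideanHalfSpace]
  intro x hx y hy a b ha hb _
  have hx : 0 ≤ x 0 := hx
  have hy : 0 ≤ y 0 := hy
  change 0 ≤ (a • x + b • y) 0
  simp only [PiLp.add_apply, PiLp.smul_apply, smul_eq_mul]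
  positivity

variable {A : Set M} {x : M}

/-- Off the subspace, a manifold has a convex model. -/
theorem exists_convexModel_of_notMem (hA : IsClosed A) (hx : x ∉ A) :
    Nonempty (ConvexModel (EuclideanSpace ℝ (Fin m)) A x) := by
  have hxA : ∀ᶠ z in 𝓝 (extChartAt (𝓡∂ m) x x), (extChartAt (𝓡∂ m) x).symm z ∉ A :=
    (continuousAt_extChartAt_symm (I := 𝓡∂ m) x).eventually (by
      rw [extChartAt_to_inv]
      exact hA.isOpen_compl.mem_nhds hx)
  obtain ⟨φ, -⟩ := exists_convexModel_of_chart (A := A) (Homeomorph.refl _) (x := x) rfl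
    convex_range_halfSpace (𝓡∂ m).isClosed_range convex_empty isClosed_empty (empty_subset _)
    (.of_forall fun _ => Iff.rfl) (hxA.mono fun z hz _ => iff_of_false hz id) (P := fun _ _ => True)
    (.of_forall fun _ _ => trivial)
  exact ⟨φ⟩

/-- The set `{v | 0 ≤ v 0}` near a boundary point, or the whole space near an interior point. -/
theorem exists_local_range (x : M) : ∃ C : Set (EuclideanSpace ℝ (Fin m)), Convex ℝ C ∧
    IsClosed C ∧ (∀ᶠ z in 𝓝 (extChartAt (𝓡∂ m) x x), z ∈ range (𝓡∂ m) ↔ z ∈ C) ∧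
    ∀ b : EuclideanSpace ℝ (Fin m), ((𝓡∂ m).IsBoundaryPoint x → b 0 = 0) →
      ∀ z (r : ℝ), z + r • b ∈ C ↔ z ∈ C := by
  rcases (𝓡∂ m).isInteriorPoint_or_isBoundaryPoint x with h | h
  · refine ⟨univ, convex_univ, isClosed_univ, ?_, fun _ _ _ _ => by simp⟩
    filter_upwards [mem_interior_iff_mem_nhds.1 h] with z hz
    exact iff_of_true hz trivial
  · refine ⟨range (𝓡∂ m), convex_range_halfSpace, (𝓡∂ m).isClosed_range,
      .of_forall fun _ => Iff.rfl, fun b hb z r => ?_⟩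
    rw [range_modelWithCornersEuclideanHalfSpace]
    change 0 ≤ (z + r • b) 0 ↔ 0 ≤ z 0
    simp [hb h]

/-- Off the subspace, a function with nonzero derivative along the boundary can be made linear in a
convex model. -/
theorem exists_convexModel_linear_of_notMem (hA : IsClosed A) (hx : x ∉ A) {F : M → ℝ}
    (hF : ContMDiffAt (𝓡∂ m) 𝓘(ℝ, ℝ) 1 F x) {b : EuclideanSpace ℝ (Fin m)}
    (hb : (mfderiv (𝓡∂ m) 𝓘(ℝ, ℝ) F x : EuclideanSpace ℝ (Fin m) →L[ℝ] ℝ) b ≠ 0)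
    (hb0 : (𝓡∂ m).IsBoundaryPoint x → b 0 = 0) :
    ∃ (φ : ConvexModel (EuclideanSpace ℝ (Fin m)) A x) (l : EuclideanSpace ℝ (Fin m) →L[ℝ] ℝ),
      ∀ v : φ.domain, F (φ.map v) = l v := by
  set e := extChartAt (𝓡∂ m) x with he
  set l : EuclideanSpace ℝ (Fin m) →L[ℝ] ℝ :=
    fderivWithin ℝ (F ∘ e.symm) (range (𝓡∂ m)) (e x) with hl
  have hml : (mfderiv (𝓡∂ m) 𝓘(ℝ, ℝ) F x : EuclideanSpace ℝ (Fin m) →L[ℝ] ℝ) = l :=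
    (hF.mdifferentiableAt one_ne_zero).mfderiv
  rw [hml] at hb
  set b' := (l b)⁻¹ • b
  have hlb' : l b' = 1 := by
    simp only [b', map_smul, smul_eq_mul]
    exact inv_mul_cancel₀ hb
  have hcd : ContDiffWithinAt ℝ 1 (F ∘ e.symm) (range (𝓡∂ m)) (e x) := (contMDiffAt_iff.1 hF).2
  -- The smallness required for straightening along b'.
  obtain ⟨c, hc, hc1⟩ : ∃ c : NNReal, 0 < c ∧ c * ‖b'‖₊ < 1 := by
    refine ⟨(‖b'‖₊ + 1)⁻¹, by positivity, ?_⟩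
    rw [inv_mul_lt_iff₀ (by positivity)]
    simp
  obtain ⟨r, hr, happ⟩ := exists_approximatesLinearOn convex_range_halfSpace
    (𝓡∂ m).uniqueDiffOn (extChartAt_target_subset_range x (mem_extChartAt_target x)) hcd hc
  obtain ⟨T, hT, hTl⟩ := exists_straightening hlb' happ hc1
  obtain ⟨C, hC, hCc, hCI, hCb⟩ := exists_local_range (m := m) x
  -- T moves points along b' only, and b' is tangent to the boundary at a boundary point, so the
  -- half-space is preserved.
  have hTC : ∀ z, T.symm z ∈ C ↔ z ∈ C := fun z => by
    obtain ⟨s, hs⟩ := hT (T.symm z)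
    rw [T.apply_symm_apply] at hs
    have := hCb b' (fun h => by simp [b', hb0 h]) (T.symm z) s
    rw [← hs] at this
    exact this.symm
  have hz : T.symm (T (e x)) = e x := T.symm_apply_apply _
  have hTt : Tendsto T.symm (𝓝 (T (e x))) (𝓝 (e x)) := by
    have := T.symm.continuous.continuousAt (x := T (e x))
    rwa [ContinuousAt, hz] at this
  have hxA : ∀ᶠ z in 𝓝 (e x), e.symm z ∉ A :=
    (continuousAt_extChartAt_symm (I := 𝓡∂ m) x).eventually (by
      rw [extChartAt_to_inv]
      exact hA.isOpen_compl.mem_nhds hx)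
  obtain ⟨φ, hφ⟩ := exists_convexModel_of_chart (A := A) T.symm (x := x) hz hC hCc
    convex_empty isClosed_empty (empty_subset _)
    ((hTt.eventually hCI).mono fun z hz => hz.trans (hTC z))
    ((hTt.eventually hxA).mono fun z hz _ => iff_of_false hz id) (P := fun v y => F y = l v) (by
      filter_upwards [hTt.eventually hCI, hTt.eventually (Metric.ball_mem_nhds _ hr)] with z h1 h2 h3
      have := hTl (T.symm z) ⟨h1.2 ((hTC z).2 h3), h2⟩
      rw [T.apply_symm_apply] at this
      exact this.symm)
  exact ⟨φ, l, hφ⟩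

variable {k : ℕ} [NeZero k] {N : Type*} [TopologicalSpace N]
  [ChartedSpace (EuclideanHalfSpace k) N] {ι : C(N, M)}

theorem extChartAt_target_mem_nhds_of_isInteriorPoint {x : M} (hx : (𝓡∂ m).IsInteriorPoint x) :
    (extChartAt (𝓡∂ m) x).target ∈ 𝓝 (extChartAt (𝓡∂ m) x x) := by
  have := extChartAt_target_mem_nhdsWithin (I := 𝓡∂ m) x
  rwa [nhdsWithin_eq_nhds.2 (mem_interior_iff_mem_nhds.1 hx)] at this

/-- An interior submanifold is straightened in a chart by a homeomorphism close to the identity. -/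
theorem IsInteriorSubmanifold.exists_straightening (hι : IsInteriorSubmanifold k m ι) (y : N)
    {J' : EuclideanSpace ℝ (Fin k) →L[ℝ] EuclideanSpace ℝ (Fin m)}
    (hJ' : J' = mfderiv (𝓡∂ k) (𝓡∂ m) ι y) {c : NNReal} (hc : 0 < c) (hc1 : c < 1) :
    ∃ g : EuclideanSpace ℝ (Fin m) ≃ₜ EuclideanSpace ℝ (Fin m),
      ApproximatesLinearOn g (ContinuousLinearMap.id ℝ _) univ c ∧
      ∃ z₀, g z₀ = extChartAt (𝓡∂ m) (ι y) (ι y) ∧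
      ∃ K : Set (EuclideanSpace ℝ (Fin m)), Convex ℝ K ∧ IsClosed K ∧
        (∀ β : EuclideanSpace ℝ (Fin k), ((𝓡∂ k).IsBoundaryPoint y → β 0 = 0) →
          ∀ z (r : ℝ), z + r • J' β ∈ K ↔ z ∈ K) ∧
        ∀ᶠ z in 𝓝 z₀, (extChartAt (𝓡∂ m) (ι y)).symm (g z) ∈ range ι ↔ z ∈ K := by
  set e := extChartAt (𝓡∂ m) (ι y) with he
  set e' := extChartAt (𝓡∂ k) y with he'
  have hsm : ContMDiffAt (𝓡∂ k) (𝓡∂ m) 1 ι y := (hι.smooth y).of_le (by simp)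
  have hcd : ContDiffWithinAt ℝ 1 (e ∘ ι ∘ e'.symm) (range (𝓡∂ k)) (e' y) :=
    (contMDiffAt_iff.1 hsm).2
  have hJ : J' = fderivWithin ℝ (e ∘ ι ∘ e'.symm) (range (𝓡∂ k)) (e' y) :=
    hJ'.trans (hsm.mdifferentiableAt one_ne_zero).mfderiv
  have hinj : Function.Injective J' := by
    rw [hJ']
    exact hι.immersion y
  have hwr : e' y ∈ range (𝓡∂ k) := extChartAt_target_subset_range y (mem_extChartAt_target y)
  obtain ⟨g, hg, r, hr, hgr⟩ := exists_homeomorph_of_immersion hinj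
    (fun c hc => by
      rw [hJ]
      exact exists_approximatesLinearOn convex_range_halfSpace (𝓡∂ k).uniqueDiffOn hwr hcd hc) hc hc1
  obtain ⟨R, hR, hRc, hRI, hRb⟩ := exists_local_range (m := k) y
  have hz : g (J' (e' y)) = e (ι y) := by
    rw [hgr _ ⟨hwr, Metric.mem_ball_self hr⟩]
    rw [Function.comp_apply, Function.comp_apply, extChartAt_to_inv]
  have hemb : IsClosedEmbedding J' :=
    LinearMap.isClosedEmbedding_of_injective
      (f := (J' : EuclideanSpace ℝ (Fin k) →ₗ[ℝ] EuclideanSpace ℝ (Fin m)))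
      (LinearMap.ker_eq_bot.2 hinj)
  refine ⟨g, hg, J' (e' y), hz, J' '' R, hR.linear_image (J' : EuclideanSpace ℝ (Fin k) →ₗ[ℝ] EuclideanSpace ℝ (Fin m)),
    hemb.isClosedMap _ hRc, fun β hβ z s => ?_, ?_⟩
  · constructor
    · rintro ⟨w, hw, hwz⟩
      refine ⟨w + (-s) • β, (hRb β hβ w (-s)).2 hw, ?_⟩
      rw [map_add, map_smul, hwz]
      module
    · rintro ⟨w, hw, rfl⟩
      exact ⟨w + s • β, (hRb β hβ w s).2 hw, by rw [map_add, map_smul]⟩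
  · have hsrc : ∀ᶠ w in 𝓝 (e' y), ι (e'.symm w) ∈ e.source := by
      have hcont : ContinuousAt (ι ∘ e'.symm) (e' y) :=
        ι.continuous.continuousAt.comp (continuousAt_extChartAt_symm (I := 𝓡∂ k) y)
      refine hcont.eventually (p := fun x => x ∈ e.source) ?_
      simp only [Function.comp_apply, e', extChartAt_to_inv]
      exact extChartAt_source_mem_nhds (I := 𝓡∂ m) (ι y)
    -- The two inclusions use different topologies: here that J' is a closed embedding, and in
    -- `hforw` that ι is an embedding, so that no remote part of N returns near ι y.
    have hback : ∀ᶠ z in 𝓝 (J' (e' y)), ∀ w, J' w = z →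
        ((w ∈ range (𝓡∂ k) ↔ w ∈ R) ∧ w ∈ Metric.ball (e' y) r ∧ ι (e'.symm w) ∈ e.source) := by
      rw [← eventually_comap, ← hemb.isInducing.nhds_eq_comap]
      have hball : ∀ᶠ w in 𝓝 (e' y), w ∈ Metric.ball (e' y) r := Metric.ball_mem_nhds _ hr
      exact hRI.and (hball.and hsrc)
    have htend : Tendsto (fun z => e.symm (g z)) (𝓝 (J' (e' y))) (𝓝 (ι y)) := by
      have h1 : Tendsto g (𝓝 (J' (e' y))) (𝓝 (e (ι y))) := by
        rw [← hz]
        exact g.continuous.continuousAt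
      have h2 : Tendsto e.symm (𝓝 (e (ι y))) (𝓝 (ι y)) := by
        have := continuousAt_extChartAt_symm (I := 𝓡∂ m) (ι y)
        rwa [ContinuousAt, extChartAt_to_inv] at this
      exact h2.comp h1
    have hforw : ∀ᶠ z in 𝓝 (J' (e' y)), ∀ y', ι y' = e.symm (g z) →
        (y' ∈ e'.source ∧ e' y' ∈ Metric.ball (e' y) r ∧
          (e' y' ∈ range (𝓡∂ k) ↔ e' y' ∈ R)) := by
      refine htend.eventually (p := fun x => ∀ y', ι y' = x →
        (y' ∈ e'.source ∧ e' y' ∈ Metric.ball (e' y) r ∧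
          (e' y' ∈ range (𝓡∂ k) ↔ e' y' ∈ R))) ?_
      rw [← eventually_comap, ← hι.isEmbedding.isInducing.nhds_eq_comap]
      have hcont : ContinuousAt e' y := continuousAt_extChartAt y
      have hs : ∀ᶠ w in 𝓝 y, w ∈ e'.source := extChartAt_source_mem_nhds (I := 𝓡∂ k) y
      exact hs.and
        ((hcont.eventually (Metric.ball_mem_nhds _ hr)).and (hcont.eventually hRI))
    have htar : ∀ᶠ z in 𝓝 (J' (e' y)), g z ∈ e.target := by
      refine g.continuous.continuousAt.eventually (p := fun v => v ∈ e.target) ?_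
      rw [hz]
      exact extChartAt_target_mem_nhds_of_isInteriorPoint (hι.interior y)
    filter_upwards [hback, hforw, htar] with z hb hf ht
    constructor
    · rintro ⟨y', hy'⟩
      obtain ⟨h1, h2, h3⟩ := hf y' hy'
      have h4 : e' y' ∈ range (𝓡∂ k) := extChartAt_target_subset_range y (e'.map_source h1)
      refine ⟨e' y', h3.1 h4, g.injective ?_⟩
      rw [hgr _ ⟨h4, h2⟩, Function.comp_apply, Function.comp_apply, e'.left_inv h1, hy',
        e.right_inv ht]
    · rintro ⟨w, hw, rfl⟩
      obtain ⟨h1, h2, h3⟩ := hb w rfl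
      refine ⟨e'.symm w, ?_⟩
      rw [hgr _ ⟨h1.2 hw, h2⟩, Function.comp_apply, Function.comp_apply, e.left_inv h3]

/-- The value 1/2 is arbitrary below 1. As ι y is interior to M, the ambient convex set is the whole
space. -/
theorem IsInteriorSubmanifold.exists_convexModel (hι : IsInteriorSubmanifold k m ι) (y : N) :
    Nonempty (ConvexModel (EuclideanSpace ℝ (Fin m)) (range ι) (ι y)) := by
  obtain ⟨g, -, z₀, hz, K, hK, hKc, -, hev⟩ := hι.exists_straightening y rfl
    (c := 1 / 2) (by simp) (by rw [div_lt_one] <;> norm_num)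
  obtain ⟨φ, -⟩ := exists_convexModel_of_chart (A := range ι) g hz convex_univ isClosed_univ
    hK hKc (subset_univ _) (by
      have : range (𝓡∂ m) ∈ 𝓝 (g z₀) := by
        rw [hz]
        exact mem_interior_iff_mem_nhds.1 (hι.interior y)
      filter_upwards [g.continuous.continuousAt.eventually this] with z hz
      exact iff_of_true hz trivial)
    (hev.mono fun z hz _ => hz) (P := fun _ _ => True) (.of_forall fun _ _ => trivial)
  exact ⟨φ⟩

/-- At a point of a submanifold, a function with nonzero derivative along the submanifold and along
its boundary can be made linear in a convex model. -/
theorem IsInteriorSubmanifold.exists_convexModel_linear (hι : IsInteriorSubmanifold k m ι) (y : N)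
    {F : M → ℝ} (hF : ContMDiffAt (𝓡∂ m) 𝓘(ℝ, ℝ) 1 F (ι y)) {β : EuclideanSpace ℝ (Fin k)}
    (hβ : (mfderiv (𝓡∂ m) 𝓘(ℝ, ℝ) F (ι y) : EuclideanSpace ℝ (Fin m) →L[ℝ] ℝ)
      ((mfderiv (𝓡∂ k) (𝓡∂ m) ι y :
        EuclideanSpace ℝ (Fin k) →L[ℝ] EuclideanSpace ℝ (Fin m)) β) ≠ 0)
    (hβ0 : (𝓡∂ k).IsBoundaryPoint y → β 0 = 0) :
    ∃ (φ : ConvexModel (EuclideanSpace ℝ (Fin m)) (range ι) (ι y))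
      (l : EuclideanSpace ℝ (Fin m) →L[ℝ] ℝ), ∀ v : φ.domain, F (φ.map v) = l v := by
  set e := extChartAt (𝓡∂ m) (ι y) with he
  set J' : EuclideanSpace ℝ (Fin k) →L[ℝ] EuclideanSpace ℝ (Fin m) :=
    mfderiv (𝓡∂ k) (𝓡∂ m) ι y with hJ'
  set l : EuclideanSpace ℝ (Fin m) →L[ℝ] ℝ :=
    fderivWithin ℝ (F ∘ e.symm) (range (𝓡∂ m)) (e (ι y)) with hl
  have hml : (mfderiv (𝓡∂ m) 𝓘(ℝ, ℝ) F (ι y) : EuclideanSpace ℝ (Fin m) →L[ℝ] ℝ) = l :=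
    (hF.mdifferentiableAt one_ne_zero).mfderiv
  rw [hml] at hβ
  set β' := (l (J' β))⁻¹ • β
  have hlb : l (J' β') = 1 := by
    simp only [β', map_smul, smul_eq_mul]
    exact inv_mul_cancel₀ hβ
  have hcd : ContDiffWithinAt ℝ 1 (F ∘ e.symm) (range (𝓡∂ m)) (e (ι y)) := (contMDiffAt_iff.1 hF).2
  -- N is straightened by g first and the function F ∘ g afterwards. By `comp_near_id` the bracket
  -- is the error of F ∘ g, so the last bound is what straightening along J'β' requires.
  obtain ⟨c, hc, hc1, hcs⟩ : ∃ c : NNReal, 0 < c ∧ c < 1 ∧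
      (c * (1 + c) + ‖l‖₊ * c) * ‖J' β'‖₊ < 1 := by
    set D : NNReal := (2 + ‖l‖₊) * (‖J' β'‖₊ + 1) + 1 with hD
    have hD1 : 1 < D := by
      rw [hD]
      refine lt_add_of_pos_left _ (by positivity)
    have hD0 : 0 < D := zero_lt_one.trans hD1
    have hi : D⁻¹ < 1 := inv_lt_one_of_one_lt₀ hD1
    refine ⟨D⁻¹, by positivity, hi, ?_⟩
    calc (D⁻¹ * (1 + D⁻¹) + ‖l‖₊ * D⁻¹) * ‖J' β'‖₊
        ≤ (D⁻¹ * (1 + 1) + ‖l‖₊ * D⁻¹) * ‖J' β'‖₊ := by gcongr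
      _ = D⁻¹ * ((2 + ‖l‖₊) * ‖J' β'‖₊) := by ring
      _ < D⁻¹ * D := by
        gcongr
        rw [hD, mul_add, mul_one, add_assoc]
        exact lt_add_of_pos_right _ (by positivity)
      _ = 1 := inv_mul_cancel₀ hD0.ne'
  obtain ⟨r, hr, happ⟩ := exists_approximatesLinearOn convex_range_halfSpace
    (𝓡∂ m).uniqueDiffOn (extChartAt_target_subset_range (ι y) (mem_extChartAt_target (ι y))) hcd hc
  obtain ⟨g, hg, z₀, hz, K, hK, hKc, hKb, hev⟩ := hι.exists_straightening y hJ' hc hc1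
  obtain ⟨T, hT, hTl⟩ := CyclicTQFT.exists_straightening hlb (ApproximatesLinearOn.comp_near_id happ hg) hcs
  -- The second straightening moves points along J'β', a direction tangent to N and at boundary
  -- points to ∂N, so the already straightened N is kept.
  have hTK : ∀ z, T.symm z ∈ K ↔ z ∈ K := fun z => by
    obtain ⟨s, hs⟩ := hT (T.symm z)
    rw [T.apply_symm_apply] at hs
    have := hKb β' (fun h => by simp [β', hβ0 h]) (T.symm z) s
    rw [← hs] at this
    exact this.symm
  have hz' : T.symm (T z₀) = z₀ := T.symm_apply_apply _
  have hTt : Tendsto T.symm (𝓝 (T z₀)) (𝓝 z₀) := by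
    have := T.symm.continuous.continuousAt (x := T z₀)
    rwa [ContinuousAt, hz'] at this
  have hgt : Tendsto g (𝓝 z₀) (𝓝 (e (ι y))) := by
    rw [← hz]
    exact g.continuous.continuousAt
  have hint : ∀ᶠ z in 𝓝 (e (ι y)), z ∈ range (𝓡∂ m) :=
    mem_interior_iff_mem_nhds.1 (hι.interior y)
  obtain ⟨φ, hφ⟩ := exists_convexModel_of_chart (A := range ι) (T.symm.trans g) (x := ι y)
    (z₀ := T z₀) (by rw [Homeomorph.trans_apply, hz', hz]) convex_univ isClosed_univ hK hKc
    (subset_univ _)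
    ((hTt.eventually (hgt.eventually hint)).mono fun z hz => iff_of_true hz trivial)
    ((hTt.eventually hev).mono fun z hz _ => hz.trans (hTK z)) (P := fun v y => F y = l v) (by
      filter_upwards [hTt.eventually (hgt.eventually hint),
        hTt.eventually (hgt.eventually (Metric.ball_mem_nhds _ hr))] with z h1 h2 _
      have := hTl (T.symm z) ⟨h1, h2⟩
      rw [T.apply_symm_apply] at this
      exact this.symm)
  exact ⟨φ, l, hφ⟩

end ManifoldModel

/-! ### The angle of f near the Seifert manifold. -/

section SeifertModel

variable {m : ℕ} [NeZero m] {M : Type*} [TopologicalSpace M] [ChartedSpace (EuclideanHalfSpace m) M]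
  {x₀ : M} {χ : FundamentalGroup M x₀ →* Multiplicative ℤ}

/-- The angle of a map to the circle is differentiable where the map is `1`. -/
theorem contMDiffAt_arg {f : M → Circle} (hf : ContMDiff (𝓡∂ m) (𝓡 1) ∞ f) {x : M}
    (hx : f x = 1) : ContMDiffAt (𝓡∂ m) 𝓘(ℝ, ℝ) 1 (fun y => Complex.arg (f y : ℂ)) x := by
  have := finrank_real_complex_fact'
  have h1 : ContMDiffAt (𝓡∂ m) 𝓘(ℝ, ℂ) 1 (fun y => (f y : ℂ)) x :=
    (contMDiff_coe_sphere (E := ℂ) (n := 1) (m := 1)).contMDiffAt.comp x ((hf x).of_le (by simp))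
  have h2 : ContDiffAt ℝ 1 Complex.arg (f x : ℂ) := by
    have : ContDiffAt ℝ 1 (fun z => (Complex.log z).im) (f x : ℂ) := by
      refine Complex.imCLM.contDiff.contDiffAt.comp _
        (ContDiffAt.restrict_scalars ℝ (Complex.contDiffAt_log ?_))
      rw [hx]
      simp
    simpa only [Complex.log_im] using this
  exact h2.contMDiffAt.comp x h1

/-- Since f is the exponential of its angle, the chain rule makes every vector killed by the
derivative of the angle be killed by that of f. -/
theorem mfderiv_arg_ne_zero {f : M → Circle} (hf : ContMDiff (𝓡∂ m) (𝓡 1) ∞ f) {x : M}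
    (hx : f x = 1) {v : EuclideanSpace ℝ (Fin m)}
    (hv : (mfderiv (𝓡∂ m) (𝓡 1) f x : EuclideanSpace ℝ (Fin m) →L[ℝ] EuclideanSpace ℝ (Fin 1)) v ≠ 0) :
    (mfderiv (𝓡∂ m) 𝓘(ℝ, ℝ) (fun y => Complex.arg (f y : ℂ)) x :
      EuclideanSpace ℝ (Fin m) →L[ℝ] ℝ) v ≠ 0 := by
  intro h
  apply hv
  have e : f = Circle.exp ∘ fun y => Complex.arg (f y : ℂ) := by
    ext1 y
    simp
  have h1 : MDifferentiableAt 𝓘(ℝ, ℝ) (𝓡 1) Circle.exp (Complex.arg (f x : ℂ)) :=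
    (contMDiff_circleExp (m := 1)).contMDiffAt.mdifferentiableAt one_ne_zero
  have h2 := mfderiv_comp x h1 ((contMDiffAt_arg hf hx).mdifferentiableAt one_ne_zero)
  rw [← e] at h2
  have h3 := DFunLike.congr_fun h2 v
  refine h3.trans ?_
  refine (congrArg (mfderiv 𝓘(ℝ, ℝ) (𝓡 1) Circle.exp (Complex.arg (f x : ℂ))) h).trans ?_
  exact map_zero _

variable {k : ℕ} [NeZero k] {N : Type*} [TopologicalSpace N]
  [ChartedSpace (EuclideanHalfSpace k) N] {ι : C(N, M)}

theorem IsInteriorSubmanifold.nonempty_convexModel (hι : IsInteriorSubmanifold k m ι)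
    (hcl : IsClosed (range ι)) (x : M) :
    Nonempty (ConvexModel (EuclideanSpace ℝ (Fin m)) (range ι) x) := by
  by_cases hx : x ∈ range ι
  · obtain ⟨y, rfl⟩ := hx
    exact hι.exists_convexModel y
  · exact exists_convexModel_of_notMem hcl hx

theorem exists_map_ne_zero_of_sup_ker_eq_top {V W : Type*} [AddCommGroup V] [Module ℝ V]
    [AddCommGroup W] [Module ℝ W] {l : V →ₗ[ℝ] W} (hl : l ≠ 0) {U : Submodule ℝ V}
    (h : U ⊔ LinearMap.ker l = ⊤) : ∃ v ∈ U, l v ≠ 0 := by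
  by_contra! h0
  refine hl (LinearMap.ker_eq_top.1 ?_)
  rwa [sup_eq_right.2 (fun v hv => h0 v hv)] at h

/-- Near a point of the Seifert manifold the angle is linear in a convex model. -/
theorem SeifertManifold.exists_convexModel (S : SeifertManifold m χ)
    (hι : IsInteriorSubmanifold k m ι) (hcl : IsClosed (range ι)) (hS : S.IsTransverse k ι) {x : M}
    (hx : S.f x = 1) : ∃ (φ : ConvexModel (EuclideanSpace ℝ (Fin m)) (range ι) x)
      (l : EuclideanSpace ℝ (Fin m) →L[ℝ] ℝ),
      ∀ v : φ.domain, Complex.arg (S.f (φ.map v) : ℂ) = l v := by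
  have hsm := contMDiffAt_arg S.smooth hx
  have hne : (mfderiv (𝓡∂ m) (𝓡 1) S.f x).toLinearMap ≠ 0 := fun h =>
    S.regular x hx (ContinuousLinearMap.coe_injective h)
  by_cases hxN : x ∈ range ι
  · obtain ⟨y, rfl⟩ := hxN
    obtain ⟨β, hβ, hβ0⟩ : ∃ β : EuclideanSpace ℝ (Fin k),
        (mfderiv (𝓡∂ m) (𝓡 1) S.f (ι y) :
            EuclideanSpace ℝ (Fin m) →L[ℝ] EuclideanSpace ℝ (Fin 1))
          ((mfderiv (𝓡∂ k) (𝓡∂ m) ι y :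
            EuclideanSpace ℝ (Fin k) →L[ℝ] EuclideanSpace ℝ (Fin m)) β) ≠ 0 ∧
        ((𝓡∂ k).IsBoundaryPoint y → β 0 = 0) := by
      by_cases hy : (𝓡∂ k).IsBoundaryPoint y
      · obtain ⟨v, hv, hv0⟩ := exists_map_ne_zero_of_sup_ker_eq_top hne (hS.boundary y hx hy)
        obtain ⟨β, hβ, rfl⟩ := hv
        exact ⟨β, hv0, fun _ => hβ⟩
      · obtain ⟨v, hv, hv0⟩ := exists_map_ne_zero_of_sup_ker_eq_top hne (hS.inside y hx)
        obtain ⟨β, rfl⟩ := hv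
        exact ⟨β, hv0, fun h => (hy h).elim⟩
    exact hι.exists_convexModel_linear y hsm (mfderiv_arg_ne_zero S.smooth hx hβ) hβ0
  · obtain ⟨b, hb, hb0⟩ : ∃ b : EuclideanSpace ℝ (Fin m),
        (mfderiv (𝓡∂ m) (𝓡 1) S.f x :
          EuclideanSpace ℝ (Fin m) →L[ℝ] EuclideanSpace ℝ (Fin 1)) b ≠ 0 ∧
        ((𝓡∂ m).IsBoundaryPoint x → b 0 = 0) := by
      by_cases hxb : (𝓡∂ m).IsBoundaryPoint x
      · obtain ⟨v, hv, hv0⟩ := S.regular_boundary x hx hxb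
        exact ⟨v, hv0, fun _ => hv⟩
      · obtain ⟨v, hv⟩ : ∃ v, (mfderiv (𝓡∂ m) (𝓡 1) S.f x) v ≠ 0 := by
          by_contra! h
          exact S.regular x hx (ContinuousLinearMap.ext h)
        exact ⟨v, hv, fun h => (hxb h).elim⟩
    exact exists_convexModel_linear_of_notMem hcl hxN hsm (mfderiv_arg_ne_zero S.smooth hx hb) hb0

end SeifertModel

/-- A convex model at a point of a space that is locally embedded onto a convex part of a space with
a convex model. -/
theorem ConvexModel.nonempty_lift {V : Type*} [NormedAddCommGroup V] [InnerProductSpace ℝ V]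
    {X X' : Type*} [TopologicalSpace X] [TopologicalSpace X'] {A : Set X} {π : X' → X} {p' : X'}
    (φ : ConvexModel V A (π p')) {O : Set X'} (hO : IsOpen O) (hp' : p' ∈ O)
    (hemb : IsEmbedding (O.domRestrict π)) {C₀ : Set V} (hC : Convex ℝ C₀) (hCc : IsClosed C₀)
    (h : ∀ᶠ v in 𝓝 φ.base, (∃ x' ∈ O, π x' = φ.map v) ↔ (v : V) ∈ C₀) :
    Nonempty (ConvexModel V (π ⁻¹' A) p') := by
  obtain ⟨ε, hε, hball⟩ := Metric.eventually_nhds_iff_ball.1 h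
  set ρ := min ε φ.radius with hρ
  have hρ0 : 0 < ρ := lt_min hε φ.radius_pos
  have hdom : (φ.carrier ∩ C₀) ∩ Metric.ball φ.center ρ ⊆ φ.domain := fun v hv =>
    ⟨hv.1.1, Metric.ball_subset_ball (min_le_right _ _) hv.2⟩
  have hiff : ∀ v : φ.domain, (v : V) ∈ Metric.ball φ.center ρ →
      ((∃ x' ∈ O, π x' = φ.map v) ↔ (v : V) ∈ C₀) := fun v hv =>
    hball v (Metric.ball_subset_ball (min_le_left _ _) hv)
  have hex : ∀ v : ↥((φ.carrier ∩ C₀) ∩ Metric.ball φ.center ρ),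
      ∃ x' : O, π x' = φ.map (inclusion hdom v) := fun v => by
    obtain ⟨x', hx', he⟩ := (hiff (inclusion hdom v) v.2.2).2 v.2.1.2
    exact ⟨⟨x', hx'⟩, he⟩
  choose ψ hψ using hex
  have hincl : IsEmbedding (φ.map ∘ inclusion hdom) :=
    φ.isOpenEmbedding.toIsEmbedding.comp (IsEmbedding.inclusion hdom)
  have hcomp : O.domRestrict π ∘ ψ = φ.map ∘ inclusion hdom := funext hψ
  have hψc : Continuous ψ := by
    rw [hemb.continuous_iff, hcomp]
    exact hincl.continuous
  have hψe : IsEmbedding ψ := IsEmbedding.of_comp hψc hemb.continuous (hcomp ▸ hincl)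
  have hrange : range ψ = O.domRestrict π ⁻¹' (φ.map '' {v | (v : V) ∈ Metric.ball φ.center ρ}) := by
    ext x'
    constructor
    · rintro ⟨v, rfl⟩
      exact ⟨_, v.2.2, (hψ v).symm⟩
    · rintro ⟨v, hv, hvx⟩
      have hvC : (v : V) ∈ C₀ := (hiff v hv).1 ⟨x', x'.2, hvx.symm⟩
      refine ⟨⟨v, ⟨v.2.1, hvC⟩, hv⟩, hemb.injective ?_⟩
      exact (hψ _).trans hvx
  have hopen : IsOpen (range ψ) := by
    rw [hrange]
    exact (φ.isOpenEmbedding.isOpenMap _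
      (Metric.isOpen_ball.preimage continuous_subtype_val)).preimage hemb.continuous
  have hcen : φ.center ∈ C₀ :=
    (hiff φ.base (Metric.mem_ball_self hρ0)).1 ⟨p', hp', φ.map_base.symm⟩
  refine ⟨⟨φ.carrier ∩ C₀, φ.sub ∩ C₀, φ.center, ρ, fun v => ψ v, φ.convex.inter hC,
    φ.isClosed.inter hCc, inter_subset_inter_left _ φ.sub_subset, φ.convex_sub.inter hC,
    φ.isClosed_sub.inter hCc, ⟨φ.center_mem, hcen⟩, hρ0,
    hO.isOpenEmbedding_subtypeVal.comp ⟨hψe, hopen⟩, ?_, fun v => ?_⟩⟩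
  · have : ψ ⟨φ.center, ⟨φ.center_mem, hcen⟩, Metric.mem_ball_self hρ0⟩ = ⟨p', hp'⟩ :=
      hemb.injective ((hψ _).trans φ.map_base)
    rw [this]
  · rw [mem_preimage, hψ, φ.mem_iff]
    exact ⟨fun h => ⟨h, v.2.1.2⟩, fun h => h.1⟩

theorem ConvexModel.nonempty_of_isLocalHomeomorph {V : Type*} [NormedAddCommGroup V]
    [InnerProductSpace ℝ V] {X X' : Type*} [TopologicalSpace X] [TopologicalSpace X'] {A : Set X}
    {π : X' → X} (hπ : IsLocalHomeomorph π) (h : ∀ x, Nonempty (ConvexModel V A x)) (p' : X') :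
    Nonempty (ConvexModel V (π ⁻¹' A) p') := by
  obtain ⟨φ⟩ := h (π p')
  obtain ⟨e, he, rfl⟩ := hπ p'
  refine φ.nonempty_lift e.open_source he e.isOpenEmbedding_restrict.toIsEmbedding
    convex_univ isClosed_univ ?_
  have h1 : ∀ᶠ v in 𝓝 φ.base, φ.map v ∈ e.target := by
    refine φ.isOpenEmbedding.continuous.continuousAt.eventually (p := fun x => x ∈ e.target) ?_
    rw [φ.map_base]
    exact e.open_target.mem_nhds (e.map_source he)
  filter_upwards [h1] with v hv
  exact iff_of_true ⟨e.symm (φ.map v), e.map_target hv, e.right_inv hv⟩ trivial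

theorem arg_circleExp_of_abs_lt {t : ℝ} (h : |t| < 1 / 2) :
    Complex.arg (Circle.exp (2 * Real.pi * t) : ℂ) = 2 * Real.pi * t := by
  rw [abs_lt] at h
  have := Real.pi_pos
  exact Circle.arg_exp (by nlinarith) (by nlinarith)

theorem circle_eq_exp_arg (z : Circle) :
    z = Circle.exp (2 * Real.pi * (Complex.arg (z : ℂ) / (2 * Real.pi))) := by
  rw [mul_div_cancel₀ _ (by positivity), Circle.exp_arg]

theorem circleExp_two_pi_inj {s t : ℝ}
    (h : Circle.exp (2 * Real.pi * s) = Circle.exp (2 * Real.pi * t)) (hst : |s - t| < 1) :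
    s = t := by
  rw [Circle.exp_eq_exp] at h
  obtain ⟨n, hn⟩ := h
  have h1 : s - t = n := by
    have := Real.pi_pos
    have h2 : 2 * Real.pi * (s - t) = 2 * Real.pi * n := by linarith
    exact mul_left_cancel₀ (by positivity) h2
  rw [h1] at hst
  have h3 : n = 0 := by
    rw [← Int.abs_lt_one_iff]
    exact_mod_cast hst
  rw [h3] at h1
  push_cast at h1
  linarith

/-! ### Convex models for Σ and for the slit manifold. -/

section SeifertModel

variable {m : ℕ} [NeZero m] {M : Type*} [TopologicalSpace M] [ChartedSpace (EuclideanHalfSpace m) M]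
  {x₀ : M} {χ : FundamentalGroup M x₀ →* Multiplicative ℤ} (S : SeifertManifold m χ)
  {k : ℕ} [NeZero k] {N : Type*} [TopologicalSpace N]
  [ChartedSpace (EuclideanHalfSpace k) N] {ι : C(N, M)}

namespace SeifertManifold

theorem continuous_f : Continuous S.f := S.smooth.continuous

theorem isClosed_surface : IsClosed {x | S.f x = 1} := isClosed_eq S.continuous_f continuous_const

theorem compactSpace_surface [CompactSpace M] : CompactSpace S.Surface :=
  S.isClosed_surface.isClosedEmbedding_subtypeVal.compactSpace

theorem compactSpace_slit [CompactSpace M] : CompactSpace S.Slit := by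
  have h : IsClosed {q : M × unitInterval | S.f q.1 = Circle.exp (2 * Real.pi * (q.2 : ℝ))} :=
    isClosed_eq (S.continuous_f.comp continuous_fst) (by fun_prop)
  exact h.isClosedEmbedding_subtypeVal.compactSpace

theorem arg_eq_zero_iff (x : M) : Complex.arg (S.f x : ℂ) = 0 ↔ S.f x = 1 := by
  constructor
  · intro h
    rw [← Circle.exp_arg (S.f x), h, Circle.exp_zero]
  · intro h
    rw [h, Circle.coe_one, Complex.arg_one]

/-- Once the angle is linear, Σ is the slice l = 0 of the model of M. Convex sets may have empty
interior, so the model stays in m-dimensional space. -/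
theorem nonempty_convexModel_surface (hι : IsInteriorSubmanifold k m ι) (hcl : IsClosed (range ι))
    (hS : S.IsTransverse k ι) (x : S.Surface) :
    Nonempty (ConvexModel (EuclideanSpace ℝ (Fin m)) (S.surfaceInter (range ι)) x) := by
  obtain ⟨φ, l, hl⟩ := S.exists_convexModel hι hcl hS x.2
  refine φ.nonempty_lift (π := Subtype.val) isOpen_univ trivial
    (IsEmbedding.subtypeVal.comp IsEmbedding.subtypeVal) (C₀ := {v | l v = 0})
    (convex_hyperplane l.isLinear 0) (isClosed_eq l.continuous continuous_const)
    (.of_forall fun v => ?_)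
  rw [Set.mem_ofPred_eq, ← hl, S.arg_eq_zero_iff]
  exact ⟨fun ⟨x', _, h⟩ => h ▸ x'.2, fun h => ⟨⟨_, h⟩, trivial, rfl⟩⟩

/-- Two parameters within 1/4 of t differ by less than a full turn, so the point of M determines the
parameter. Compactness of the closed strip turns injectivity into an embedding. -/
theorem isEmbedding_slit [T2Space M] [CompactSpace M] (t : ℝ) :
    IsEmbedding ({q : S.Slit | |(q.1.2 : ℝ) - t| < 1 / 4}.domRestrict fun q => q.1.1) := by
  have := S.compactSpace_slit
  have hK : IsClosed {q : S.Slit | |(q.1.2 : ℝ) - t| ≤ 1 / 4} :=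
    isClosed_le (by fun_prop) continuous_const
  have : CompactSpace {q : S.Slit | |(q.1.2 : ℝ) - t| ≤ 1 / 4} :=
    hK.isClosedEmbedding_subtypeVal.compactSpace
  have h : IsClosedEmbedding ({q : S.Slit | |(q.1.2 : ℝ) - t| ≤ 1 / 4}.domRestrict fun q => q.1.1) := by
    refine Continuous.isClosedEmbedding (by unfold Set.domRestrict; fun_prop) ?_
    rintro ⟨⟨⟨x, s⟩, hs⟩, hst⟩ ⟨⟨⟨x', s'⟩, hs'⟩, hst'⟩ (rfl : x = x')
    have h1 : (s : ℝ) = s' := by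
      refine circleExp_two_pi_inj (hs.symm.trans hs') ?_
      have h2 : |(s : ℝ) - t| ≤ 1 / 4 := hst
      have h3 : |(s' : ℝ) - t| ≤ 1 / 4 := hst'
      have := abs_sub_le (s : ℝ) t s'
      rw [abs_sub_comm t] at this
      linarith
    obtain rfl : s = s' := Subtype.ext h1
    rfl
  have hsub : {q : S.Slit | |(q.1.2 : ℝ) - t| < 1 / 4} ⊆ {q : S.Slit | |(q.1.2 : ℝ) - t| ≤ 1 / 4} :=
    fun q (hq : |(q.1.2 : ℝ) - t| < 1 / 4) => show |(q.1.2 : ℝ) - t| ≤ 1 / 4 from hq.le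
  exact h.toIsEmbedding.comp (IsEmbedding.inclusion hsub)

/-- On the incoming copy the slit manifold looks like l ≥ 0, on the outgoing copy like l ≤ 0, and
elsewhere like M. -/
theorem nonempty_convexModel_slit [T2Space M] [CompactSpace M] (hι : IsInteriorSubmanifold k m ι)
    (hcl : IsClosed (range ι)) (hS : S.IsTransverse k ι) (q : S.Slit) :
    Nonempty (ConvexModel (EuclideanSpace ℝ (Fin m)) (S.slitInter (range ι)) q) := by
  have hO : IsOpen {q' : S.Slit | |(q'.1.2 : ℝ) - q.1.2| < 1 / 4} :=
    isOpen_lt (by fun_prop) continuous_const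
  have hq : q ∈ {q' : S.Slit | |(q'.1.2 : ℝ) - q.1.2| < 1 / 4} := by simp
  have hpi := Real.pi_pos
  by_cases h1 : S.f q.1.1 = 1
  · obtain ⟨φ, l, hl⟩ := S.exists_convexModel hι hcl hS h1
    have hl0 : l φ.base = 0 := by
      rw [← hl, φ.map_base, S.arg_eq_zero_iff]
      exact h1
    have hsmall : ∀ᶠ v : φ.domain in 𝓝 φ.base, |l v / (2 * Real.pi)| < 1 / 4 := by
      have hc : Continuous fun v : φ.domain => |l v / (2 * Real.pi)| := by fun_prop
      refine hc.continuousAt.eventually (p := fun r => r < 1 / 4) (Iio_mem_nhds ?_)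
      simp only [hl0]
      norm_num
    have hf : ∀ v : φ.domain, S.f (φ.map v) = Circle.exp (2 * Real.pi * (l v / (2 * Real.pi))) :=
      fun v => by
        rw [← hl]
        exact circle_eq_exp_arg _
    have ht : (q.1.2 : ℝ) = 0 ∨ (q.1.2 : ℝ) = 1 := by
      by_contra! hne
      refine hne.1 (circleExp_two_pi_inj (q.2.symm.trans (h1.trans (by simp))) ?_)
      rw [sub_zero, abs_of_nonneg q.1.2.2.1]
      exact lt_of_le_of_ne q.1.2.2.2 hne.2
    rcases ht with ht | ht
    · refine φ.nonempty_lift (π := fun q => q.1.1) hO hq (S.isEmbedding_slit _) (C₀ := {v | 0 ≤ l v})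
        (convex_halfSpace_ge l.isLinear 0) (isClosed_le continuous_const l.continuous) ?_
      filter_upwards [hsmall] with v hv
      constructor
      · rintro ⟨q', hq', he⟩
        rw [ht, sub_zero] at hq'
        have h2 := q'.2
        rw [he] at h2
        rw [← hl, h2, arg_circleExp_of_abs_lt (hq'.trans (by norm_num))]
        have := q'.1.2.2.1
        positivity
      · intro h0
        have h3 : 0 ≤ l v / (2 * Real.pi) := by positivity
        rw [abs_of_nonneg h3] at hv
        refine ⟨⟨(φ.map v, ⟨l v / (2 * Real.pi), h3, by linarith⟩), hf v⟩, ?_, rfl⟩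
        rwa [ht, sub_zero, abs_of_nonneg h3]
    · refine φ.nonempty_lift (π := fun q => q.1.1) hO hq (S.isEmbedding_slit _) (C₀ := {v | l v ≤ 0})
        (convex_halfSpace_le l.isLinear 0) (isClosed_le l.continuous continuous_const) ?_
      have hper : ∀ s : ℝ, Circle.exp (2 * Real.pi * s) = Circle.exp (2 * Real.pi * (s - 1)) :=
        fun s => by rw [mul_sub, mul_one, Circle.exp_sub_two_pi]
      filter_upwards [hsmall] with v hv
      constructor
      · rintro ⟨q', hq', he⟩
        rw [ht] at hq'
        have h2 := q'.2
        rw [he, hper] at h2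
        rw [← hl, h2, arg_circleExp_of_abs_lt (hq'.trans (by norm_num))]
        have := q'.1.2.2.2
        nlinarith
      · intro h0
        have h3 : l v / (2 * Real.pi) ≤ 0 := div_nonpos_of_nonpos_of_nonneg h0 (by positivity)
        have hv' := hv
        rw [abs_of_nonpos h3] at hv'
        refine ⟨⟨(φ.map v, ⟨1 + l v / (2 * Real.pi), by linarith, by linarith⟩), ?_⟩, ?_, rfl⟩
        · change S.f (φ.map v) = Circle.exp (2 * Real.pi * (1 + l v / (2 * Real.pi)))
          rw [hper, hf, add_sub_cancel_left]
        · rwa [ht, add_sub_cancel_left]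
  · obtain ⟨φ⟩ := hι.nonempty_convexModel hcl q.1.1
    refine φ.nonempty_lift (π := fun q => q.1.1) hO hq (S.isEmbedding_slit _)
      convex_univ isClosed_univ ?_
    have ht0 : (q.1.2 : ℝ) ≠ 0 := fun h => h1 (by rw [q.2, h]; simp)
    have ht1 : (q.1.2 : ℝ) ≠ 1 := fun h => h1 (by rw [q.2, h]; simp)
    have hlt : 0 < (q.1.2 : ℝ) ∧ (q.1.2 : ℝ) < 1 :=
      ⟨lt_of_le_of_ne q.1.2.2.1 ht0.symm, lt_of_le_of_ne q.1.2.2.2 ht1⟩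
    let τ : M → ℝ := fun x => Complex.arg ((S.f x / S.f q.1.1 : Circle) : ℂ) / (2 * Real.pi)
    have hτ0 : τ q.1.1 = 0 := by simp [τ]
    have hτc : ContinuousAt τ q.1.1 := by
      refine ContinuousAt.div_const (ContinuousAt.comp (g := Complex.arg) ?_ ?_) _
      · refine Complex.continuousAt_arg ?_
        rw [div_self']
        simp
      · have := S.continuous_f
        fun_prop
    have hev : ∀ᶠ x in 𝓝 q.1.1, |τ x| < 1 / 4 ∧ -(q.1.2 : ℝ) < τ x ∧ τ x < 1 - (q.1.2 : ℝ) := by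
      have hopen : IsOpen {r : ℝ | |r| < 1 / 4 ∧ -(q.1.2 : ℝ) < r ∧ r < 1 - (q.1.2 : ℝ)} :=
        (isOpen_lt continuous_abs continuous_const).inter
          ((isOpen_lt continuous_const continuous_id).inter
            (isOpen_lt continuous_id continuous_const))
      refine hτc.eventually (hopen.mem_nhds ?_)
      rw [hτ0]
      refine ⟨by norm_num, by linarith, by linarith⟩
    have hφ : Tendsto φ.map (𝓝 φ.base) (𝓝 q.1.1) := by
      have := φ.isOpenEmbedding.continuous.continuousAt (x := φ.base)
      rwa [ContinuousAt, φ.map_base] at this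
    filter_upwards [hφ.eventually hev] with v hv
    refine iff_of_true ⟨⟨(φ.map v, ⟨q.1.2 + τ (φ.map v), by linarith, by linarith⟩), ?_⟩, ?_, rfl⟩
      trivial
    · change S.f (φ.map v) = Circle.exp (2 * Real.pi * ((q.1.2 : ℝ) + τ (φ.map v)))
      rw [mul_add, Circle.exp_add, ← q.2, ← circle_eq_exp_arg, mul_div_cancel]
    · change |(q.1.2 : ℝ) + τ (φ.map v) - q.1.2| < 1 / 4
      rw [add_sub_cancel_left]
      exact hv.1

end SeifertManifold

end SeifertModel

theorem circleExp_two_pi_eq_iff {s t : ℝ} :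
    Circle.exp (2 * Real.pi * s) = Circle.exp (2 * Real.pi * t) ↔ ∃ n : ℤ, s = t + n := by
  rw [Circle.exp_eq_exp]
  refine exists_congr fun n => ⟨fun h => ?_, fun h => by rw [h]; ring⟩
  have h1 : 2 * Real.pi * s = 2 * Real.pi * (t + n) := by linarith
  exact mul_left_cancel₀ (by positivity) h1

/-! ### Degrees of circle-valued maps along paths. -/

section Degree

variable {X : Type*} [TopologicalSpace X] {f : X → Circle}

/-- The angles between the values of a map to the circle at nearby points. -/
noncomputable def angleCocycle (f : X → Circle) (x y : X) : Multiplicative ℝ :=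
  .ofAdd (Complex.arg ((f y / f x : Circle) : ℂ) / (2 * Real.pi))

theorem eventually_abs_arg_div_lt (hf : Continuous f) (x : X) {ε : ℝ} (hε : 0 < ε) :
    ∀ᶠ y in 𝓝 x, |Complex.arg ((f y / f x : Circle) : ℂ) / (2 * Real.pi)| < ε := by
  have hc : ContinuousAt (fun y => Complex.arg ((f y / f x : Circle) : ℂ) / (2 * Real.pi)) x := by
    refine ContinuousAt.div_const (ContinuousAt.comp (g := Complex.arg) ?_ ?_) _
    · refine Complex.continuousAt_arg ?_
      rw [div_self']
      simp
    · fun_prop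
  refine hc.abs.eventually (p := fun r => r < ε) (Iio_mem_nhds ?_)
  simp only [div_self', Circle.coe_one, Complex.arg_one, zero_div, abs_zero]
  exact hε

/-- Angles below a quarter turn add without wrapping. The degree thereby becomes a holonomy, and its
additivity comes from the general theory. -/
theorem isCocycle_angleCocycle (hf : Continuous f) : IsCocycle (angleCocycle f) := by
  intro p
  filter_upwards [eventually_abs_arg_div_lt hf p (ε := 1 / 4) (by norm_num)] with q hq
  filter_upwards [eventually_abs_arg_div_lt hf q (ε := 1 / 4) (by norm_num)] with x hx
  rw [angleCocycle, angleCocycle, angleCocycle, ← ofAdd_add]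
  congr 1
  rw [div_eq_iff (by positivity), mul_comm, ← arg_circleExp_of_abs_lt, mul_add, Circle.exp_add,
    ← circle_eq_exp_arg, ← circle_eq_exp_arg, div_mul_div_cancel]
  exact (abs_add_le _ _).trans_lt (by linarith)

/-- The total variation of the angle of `f` along a path, as a number of turns. -/
noncomputable def degree (f : X → Circle) {x y : X} (γ : Path x y) : ℝ :=
  (hol (angleCocycle f) γ).toAdd

theorem degree_trans (hf : Continuous f) {x y z : X} (γ : Path x y) (γ' : Path y z) :
    degree f (γ.trans γ') = degree f γ + degree f γ' := by
  rw [degree, (isCocycle_angleCocycle hf).hol_trans, toAdd_mul, add_comm, degree, degree]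

theorem degree_symm (hf : Continuous f) {x y : X} (γ : Path x y) :
    degree f γ.symm = -degree f γ := by
  rw [degree, (isCocycle_angleCocycle hf).hol_symm, toAdd_inv, degree]

theorem degree_map {Y : Type*} [TopologicalSpace Y] {φ : Y → X} (hφ : Continuous φ) {x y : Y}
    (γ : Path x y) : degree f (γ.map hφ) = degree (f ∘ φ) γ := rfl

theorem degree_eq {x y : X} {γ : Path x y} {θ : C(unitInterval, ℝ)}
    (h : ∀ t, f (γ t) = Circle.exp (2 * Real.pi * θ t)) : degree f γ = θ 1 - θ 0 := by
  rw [degree, hol_eq (g := fun t => .ofAdd (θ t)), ← ofAdd_neg, ← ofAdd_add, toAdd_ofAdd,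
    sub_eq_add_neg]
  intro s _
  rw [nhdsWithin_univ]
  have hc : ContinuousAt (fun t => |θ t - θ s|) s := by fun_prop
  have h1 : ∀ᶠ t in 𝓝 s, |θ t - θ s| < 1 / 2 :=
    hc.eventually (p := fun r => r < 1 / 2) (Iio_mem_nhds (by simp))
  filter_upwards [h1] with t ht
  rw [angleCocycle, ← ofAdd_add, h, h, ← Circle.exp_sub, ← mul_sub, arg_circleExp_of_abs_lt ht,
    mul_div_cancel_left₀ _ (by positivity), sub_add_cancel]

theorem exists_angle_lift (ψ : C(unitInterval, Circle)) :
    ∃ θ : C(unitInterval, ℝ), ∀ t, ψ t = Circle.exp (2 * Real.pi * θ t) := by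
  obtain ⟨θ, hθ, -⟩ := Circle.isCoveringMap_exp.exists_path_lifts ψ (Complex.arg (ψ 0 : ℂ))
    (Circle.exp_arg _).symm
  refine ⟨⟨fun t => θ t / (2 * Real.pi), by fun_prop⟩, fun t => ?_⟩
  change ψ t = Circle.exp (2 * Real.pi * (θ t / (2 * Real.pi)))
  rw [mul_div_cancel₀ _ (by positivity), ← congrFun hθ t, Function.comp_apply]

theorem exists_degree_lift (hf : Continuous f) {x y : X} (γ : Path x y) :
    ∃ θ : C(unitInterval, ℝ), (∀ t, f (γ t) = Circle.exp (2 * Real.pi * θ t)) ∧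
      degree f γ = θ 1 - θ 0 := by
  obtain ⟨θ, hθ⟩ := exists_angle_lift ⟨fun t => f (γ t), by fun_prop⟩
  exact ⟨θ, hθ, degree_eq hθ⟩

theorem Represents.eval_eq_degree {x₀ : X} {χ : FundamentalGroup X x₀ →* Multiplicative ℤ}
    (h : Represents f χ) (hf : Continuous f) (γ : Path x₀ x₀) : (eval χ γ : ℝ) = degree f γ := by
  obtain ⟨θ, hθ, hd⟩ := exists_degree_lift hf γ
  rw [hd, h γ θ hθ]

/-- If f misses 1, then −f misses the branch cut of the argument, which gives a single-valued
continuous angle. -/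
theorem degree_loop_of_ne_one (hf : Continuous f) (h1 : ∀ x, f x ≠ 1) {x : X} (γ : Path x x) :
    degree f γ = 0 := by
  have hs : ∀ x, (-(f x : ℂ)) ∈ Complex.slitPlane := fun x => by
    rw [Complex.mem_slitPlane_iff_arg]
    refine ⟨fun h => h1 x ?_, by simp⟩
    have h2 := Complex.norm_mul_exp_arg_mul_I (-(f x : ℂ))
    rw [h, norm_neg, Circle.norm_coe, Complex.exp_pi_mul_I] at h2
    ext1
    simpa using h2.symm
  let θ : C(unitInterval, ℝ) :=
    ⟨fun t => (Complex.arg (-(f (γ t) : ℂ)) + Real.pi) / (2 * Real.pi), by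
      refine Continuous.div_const (Continuous.add ?_ continuous_const) _
      refine continuous_iff_continuousAt.2 fun t => ContinuousAt.comp (g := Complex.arg)
        (Complex.continuousAt_arg (hs _)) ?_
      fun_prop⟩
  rw [degree_eq (θ := θ)]
  · simp [θ]
  · intro t
    change _ = Circle.exp (2 * Real.pi * ((Complex.arg (-(f (γ t) : ℂ)) + Real.pi) / (2 * Real.pi)))
    rw [mul_div_cancel₀ _ (by positivity), Circle.exp_add]
    ext1
    have h2 := Complex.norm_mul_exp_arg_mul_I (-(f (γ t) : ℂ))
    rw [norm_neg, Circle.norm_coe, Complex.ofReal_one, one_mul] at h2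
    rw [Circle.coe_mul, Circle.coe_exp, Circle.coe_exp, h2, Complex.exp_pi_mul_I]
    ring

end Degree

/-! ### Connectedness of the collapsed spaces. -/

section Connected

variable {X : Type*} [TopologicalSpace X] {A : Set X}

theorem Collapse.isConnected_univ [PreconnectedSpace X] (hA : A.Nonempty) :
    IsConnected (univ : Set (Collapse A)) := by
  have hs : Function.Surjective (Collapse.mk A) := fun y => by
    rcases Collapse.cases y with rfl | ⟨x, -, rfl⟩
    · exact ⟨hA.some, Collapse.mk_eq_pt hA.some_mem⟩
    · exact ⟨x, rfl⟩
  refine ⟨⟨Collapse.pt A, trivial⟩, ?_⟩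
  rw [← hs.range_eq]
  exact isPreconnected_range (Collapse.continuous_mk A)

theorem Collapse.isConnected_univ_of_isClopen
    (h : ∀ W : Set X, IsClopen W → A ⊆ W → W = univ) : IsConnected (univ : Set (Collapse A)) := by
  refine ⟨⟨Collapse.pt A, trivial⟩, ?_⟩
  have key : ∀ U : Set (Collapse A), IsClopen U → Collapse.pt A ∈ U → U = univ := by
    intro U hU hpt
    have h1 := h _ (hU.preimage (Collapse.continuous_mk A)) fun a ha => by
      rw [mem_preimage, Collapse.mk_eq_pt ha]
      exact hpt
    refine eq_univ_of_forall fun y => ?_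
    rcases Collapse.cases y with rfl | ⟨x, -, rfl⟩
    · exact hpt
    · exact h1.ge (mem_univ x)
  have : PreconnectedSpace (Collapse A) := by
    rw [preconnectedSpace_iff_clopen]
    intro U hU
    by_cases hpt : Collapse.pt A ∈ U
    · exact Or.inr (key U hU hpt)
    · exact Or.inl (compl_univ_iff.1 (key _ hU.compl hpt))
  exact this.isPreconnected_univ

end Connected

section SeifertModel

variable {m : ℕ} [NeZero m] {M : Type*} [TopologicalSpace M] [ChartedSpace (EuclideanHalfSpace m) M]
  {x₀ : M} {χ : FundamentalGroup M x₀ →* Multiplicative ℤ} (S : SeifertManifold m χ)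
  {N : Type*} [TopologicalSpace N] {ι : C(N, M)}

namespace SeifertManifold

theorem nonempty_inter (hχN : NontrivialOn χ ι) : ∃ y, S.f (ι y) = 1 := by
  by_contra! h
  obtain ⟨y, γ, σ, hne⟩ := hχN
  apply hne
  have h1 := S.represents.eval_eq_degree S.continuous_f ((σ.trans (γ.map ι.continuous)).trans σ.symm)
  rw [degree_trans S.continuous_f, degree_trans S.continuous_f, degree_symm S.continuous_f,
    degree_map, degree_loop_of_ne_one (S.continuous_f.comp ι.continuous) h] at h1
  have h2 : ((eval χ ((σ.trans (γ.map ι.continuous)).trans σ.symm) : ℤ) : ℝ) = 0 := by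
    rw [h1]; ring
  exact_mod_cast h2

theorem exists_slit (x : M) : ∃ t : unitInterval, S.f x = Circle.exp (2 * Real.pi * (t : ℝ)) := by
  refine ⟨⟨Int.fract (Complex.arg (S.f x : ℂ) / (2 * Real.pi)), Int.fract_nonneg _,
    (Int.fract_lt_one _).le⟩, ?_⟩
  change _ = Circle.exp (2 * Real.pi * Int.fract (Complex.arg (S.f x : ℂ) / (2 * Real.pi)))
  refine (circle_eq_exp_arg _).trans (circleExp_two_pi_eq_iff.2 ⟨_, (Int.fract_add_floor _).symm⟩)

theorem slit_eq_or {x : M} {s t : unitInterval} (hs : S.f x = Circle.exp (2 * Real.pi * (s : ℝ)))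
    (ht : S.f x = Circle.exp (2 * Real.pi * (t : ℝ))) : s = t ∨ S.f x = 1 ∧ (s = 0 ∨ s = 1) := by
  by_cases h : |(s : ℝ) - t| < 1
  · exact Or.inl (Subtype.ext (circleExp_two_pi_inj (hs.symm.trans ht) h))
  · have hs01 : s = 0 ∨ s = 1 := by
      have := s.2.1
      have := s.2.2
      have := t.2.1
      have := t.2.2
      rcases le_abs.1 (not_lt.1 h) with h | h
      · exact Or.inr (Subtype.ext (le_antisymm s.2.2 (by simp only [Icc.coe_one]; linarith)))
      · exact Or.inl (Subtype.ext (le_antisymm (by simp only [Icc.coe_zero]; linarith) s.2.1))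
    refine Or.inr ⟨?_, hs01⟩
    rw [hs]
    rcases hs01 with rfl | rfl <;> simp

/-- A clopen set containing the part over A contains both copies of Σ, as Σ is connected and meets
A. It is then saturated for the projection to M, and its image is clopen in a connected space.
Connectedness of the slit manifold itself is not needed. -/
theorem isConnected_collapse_slit [T2Space M] [CompactSpace M] [PreconnectedSpace M] {A : Set M}
    (hA : ∃ x ∈ A, S.f x = 1) : IsConnected (univ : Set (Collapse (S.slitInter A))) := by
  have := S.compactSpace_slit
  obtain ⟨a, haA, ha⟩ := hA
  refine Collapse.isConnected_univ_of_isClopen fun W hW hAW => ?_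
  have hend : ∀ j : C(S.Surface, S.Slit), (∀ x, (j x).1.1 = x.1) → ∀ x, j x ∈ W := by
    intro j hj x
    have : PreconnectedSpace S.Surface := isPreconnected_iff_preconnectedSpace.1 S.connected.isPreconnected
    have h1 : j ⁻¹' W = univ := (hW.preimage j.continuous).eq_univ
      ⟨⟨a, ha⟩, hAW (show (j ⟨a, ha⟩).1.1 ∈ A by rwa [hj])⟩
    exact h1.ge (mem_univ x)
  let π : S.Slit → M := fun q => q.1.1
  have hπ : IsClosedMap π := (show Continuous π by fun_prop).isClosedMap
  have hdisj : ∀ q ∈ Wᶜ, ∀ q' ∈ W, π q ≠ π q' := by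
    rintro ⟨⟨x, t⟩, ht⟩ hq ⟨⟨x', t'⟩, ht'⟩ hq' (rfl : x = x')
    rcases S.slit_eq_or ht ht' with rfl | ⟨h1, rfl | rfl⟩
    · exact hq hq'
    · exact hq (hend S.incoming (fun _ => rfl) ⟨x, h1⟩)
    · exact hq (hend S.outgoing (fun _ => rfl) ⟨x, h1⟩)
  have hcover : (π '' W)ᶜ = π '' Wᶜ := by
    ext x
    constructor
    · intro hx
      obtain ⟨t, ht⟩ := S.exists_slit x
      exact ⟨⟨(x, t), ht⟩, fun h => hx ⟨_, h, rfl⟩, rfl⟩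
    · rintro ⟨q, hq, rfl⟩ ⟨q', hq', h⟩
      exact hdisj q hq q' hq' h.symm
  have hcl : IsClopen (π '' W) := by
    refine ⟨hπ _ hW.1, ?_⟩
    rw [← isClosed_compl_iff, hcover]
    exact hπ _ hW.compl.1
  have h1 := hcl.eq_univ ⟨a, _, hend S.incoming (fun _ => rfl) ⟨a, ha⟩, rfl⟩
  rw [h1, compl_univ, eq_comm, image_eq_empty] at hcover
  exact compl_empty_iff.1 hcover

end SeifertManifold

end SeifertModel

/-! ### The cyclic cover as the space of d-th roots of f. -/

section Cover

variable {M M' : Type*} [TopologicalSpace M] [TopologicalSpace M'] {x₀ : M}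
  {χ : FundamentalGroup M x₀ →* Multiplicative ℤ} {d : ℕ} {p : M' → M} {f : M → Circle}

theorem IsCyclicCover.surjective [PathConnectedSpace M] (h : IsCyclicCover χ d p) :
    Function.Surjective p := by
  intro x
  have := h.connected
  obtain ⟨e⟩ : Nonempty M' := inferInstance
  let γ : Path (p e) x := PathConnectedSpace.somePath _ _
  obtain ⟨Γ, hΓ, -⟩ := h.isCoveringMap.exists_path_lifts γ e γ.source
  exact ⟨Γ 1, (congrFun hΓ 1).trans γ.target⟩

/-- A `d`-th root of a map to the circle changes along a path by a `d`-th of the degree. -/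
theorem root_eq_mul_exp [NeZero d] {x y : M} (γ : Path x y) {Γ : unitInterval → Circle}
    (hΓc : Continuous Γ) (hΓ : ∀ t, Γ t ^ d = f (γ t)) :
    Γ 1 = Γ 0 * Circle.exp (2 * Real.pi * (degree f γ / d)) := by
  obtain ⟨θ, hθ⟩ := exists_angle_lift ⟨Γ, hΓc⟩
  have hθ' : ∀ t, Γ t = Circle.exp (2 * Real.pi * θ t) := hθ
  have h1 : ∀ t, f (γ t) = Circle.exp (2 * Real.pi * (((d : ℝ) • θ) t)) := fun t => by
    rw [← hΓ, hθ', ← Circle.exp_nsmul]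
    congr 1
    simp only [ContinuousMap.smul_apply, smul_eq_mul, nsmul_eq_mul]
    ring
  have hd : (d : ℝ) ≠ 0 := NeZero.ne _
  rw [degree_eq h1, hθ', hθ', ← Circle.exp_add]
  congr 1
  simp only [ContinuousMap.smul_apply, smul_eq_mul]
  field_simp
  ring

theorem isCoveringMap_circle_pow (d : ℕ) [NeZero d] : IsCoveringMap fun z : Circle => z ^ d :=
  (Circle.isQuotientCoveringMap_npow d).isCoveringMap

theorem exists_circle_root (d : ℕ) [NeZero d] (z : Circle) : ∃ w : Circle, w ^ d = z := by
  refine ⟨Circle.exp (Complex.arg (z : ℂ) / d), ?_⟩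
  rw [← Circle.exp_nsmul, nsmul_eq_mul, mul_div_cancel₀ _ (NeZero.ne (d : ℝ)), Circle.exp_arg]

theorem circle_root_eq_mul_exp [NeZero d] {z w : Circle} (h : z ^ d = w ^ d) :
    ∃ n : ℤ, z = w * Circle.exp (2 * Real.pi * (n / d)) := by
  have hd : (d : ℝ) ≠ 0 := NeZero.ne _
  have h1 := circle_eq_exp_arg (z / w)
  set a := Complex.arg ((z / w : Circle) : ℂ) / (2 * Real.pi)
  have h2 : Circle.exp (2 * Real.pi * (d * a)) = Circle.exp (2 * Real.pi * 0) := by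
    have h3 : (z / w) ^ d = 1 := by rw [div_pow, h, div_self']
    rw [h1, ← Circle.exp_nsmul, nsmul_eq_mul] at h3
    rw [mul_zero, Circle.exp_zero, ← h3]
    congr 1
    ring
  obtain ⟨n, hn⟩ := circleExp_two_pi_eq_iff.1 h2
  refine ⟨n, ?_⟩
  have h4 : (n : ℝ) / d = a := by
    rw [div_eq_iff hd]
    linarith
  rw [h4, ← h1, mul_div_cancel]

/-- A lift of a concatenated path passes through the end of a lift of the first path. -/
theorem _root_.IsCoveringMap.lift_trans_half (h : IsCoveringMap p) {e e₁ e₂ : M'} {y z : M}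
    (γ : Path e e₁) (α : Path e e₂) (he : p e = y) (he' : p e₂ = z) {x' : M} (δ : Path z x')
    (hγ : ∀ t, p (γ t) = (((α.map h.continuous).cast he.symm he'.symm).trans δ) t) :
    γ ⟨1 / 2, by norm_num, by norm_num⟩ = e₂ := by
  let r : unitInterval → unitInterval := fun t => ⟨t / 2, by constructor <;> linarith [t.2.1, t.2.2]⟩
  have hr : Continuous r := by fun_prop
  have h1 : (fun t => γ (r t)) = α := by
    refine h.eq_of_comp_eq (γ.continuous.comp hr) α.continuous (funext fun t => ?_) 0 ?_
    · rw [Function.comp_apply, hγ, Path.trans_apply, dif_pos]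
      · change p (α _) = p (α t)
        congr 2
        exact Subtype.ext (by simp only [r]; ring)
      · have := t.2.2
        change (t : ℝ) / 2 ≤ 1 / 2
        linarith
    · have h0 : r 0 = 0 := Subtype.ext (by simp [r])
      simp only [h0, γ.source, α.source]
  have h2 := congrFun h1 1
  rw [α.target] at h2
  rw [← h2]
  congr 1

variable [PathConnectedSpace M]

/-- The lifting criterion for z ↦ z^d applies to f ∘ p: two paths in the cover with common ends
project to a loop of degree divisible by d, so the root returns to the same value. -/
theorem IsCyclicCover.exists_root [LocallyPathConnectedSpace M'] [NeZero d] (h : IsCyclicCover χ d p) (hf : Continuous f)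
    (hr : Represents f χ) : ∃ F : C(M', Circle), ∀ e, F e ^ d = f (p e) := by
  have := h.connected
  have : PathConnectedSpace M' := PathConnectedSpace.of_locallyPathConnectedSpace
  have hpc := h.isCoveringMap.continuous
  obtain ⟨e₀, rfl⟩ := h.surjective x₀
  obtain ⟨z, hz⟩ := exists_circle_root d (f (p e₀))
  have hd : (d : ℝ) ≠ 0 := NeZero.ne _
  obtain ⟨F, ⟨-, hF⟩, -⟩ := (isCoveringMap_circle_pow d).isLocalHomeomorph.existsUnique_continuousMap_lifts
    ⟨fun e => f (p e), by fun_prop⟩ e₀ z hz (fun γ hγ => by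
      obtain ⟨Γ, hΓ, h0⟩ := (isCoveringMap_circle_pow d).exists_path_lifts
        (ContinuousMap.comp ⟨fun e => f (p e), by fun_prop⟩ γ) z (by simp [hγ, hz])
      exact ⟨Γ, h0, hΓ⟩)
    (fun γ γ' Γ Γ' h0 h0' hΓ0 hΓ0' hΓ hΓ' h1 => by
      let α : Path e₀ (γ 1) := ⟨γ, h0, rfl⟩
      let β : Path e₀ (γ 1) := ⟨γ', h0', h1.symm⟩
      have hα := root_eq_mul_exp (f := f) (α.map hpc) Γ.continuous fun t => congrFun hΓ t
      have hβ := root_eq_mul_exp (f := f) (β.map hpc) Γ'.continuous fun t => congrFun hΓ' t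
      obtain ⟨n, hn⟩ := (h.lift_closed_iff e₀ rfl ((α.trans β.symm).map hpc)).1
        ⟨α.trans β.symm, fun t => rfl⟩
      have hdeg : ((eval χ ((α.trans β.symm).map hpc) : ℤ) : ℝ) =
          degree f (α.map hpc) - degree f (β.map hpc) := by
        rw [hr.eval_eq_degree hf, degree_map, degree_trans (hf.comp hpc), degree_symm (hf.comp hpc),
          degree_map, degree_map, sub_eq_add_neg]
      rw [hα, hβ, hΓ0, hΓ0', mul_right_inj, circleExp_two_pi_eq_iff]
      refine ⟨n, ?_⟩
      rw [hn] at hdeg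
      push_cast at hdeg
      field_simp
      linarith)
  exact ⟨F, fun e => congrFun hF e⟩

/-- Paths from a base point to e and e' project to a loop whose degree is divisible by d because the
roots agree. The loop lifts to a closed one, whose midpoint is e when traversed forwards and e' when
traversed backwards. -/
theorem IsCyclicCover.eq_of_root_eq [LocallyPathConnectedSpace M'] [NeZero d] (h : IsCyclicCover χ d p) (hf : Continuous f)
    (hr : Represents f χ) {F : C(M', Circle)} (hF : ∀ e, F e ^ d = f (p e)) {e e' : M'}
    (hp : p e = p e') (hFe : F e = F e') : e = e' := by
  have := h.connected
  have : PathConnectedSpace M' := PathConnectedSpace.of_locallyPathConnectedSpace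
  have hpc := h.isCoveringMap.continuous
  have hd : (d : ℝ) ≠ 0 := NeZero.ne _
  obtain ⟨e₀, rfl⟩ := h.surjective x₀
  let α : Path e₀ e := PathConnectedSpace.somePath _ _
  let β : Path e₀ e' := PathConnectedSpace.somePath _ _
  let α' : Path (p e₀) (p e) := (α.map hpc).cast rfl rfl
  let β' : Path (p e₀) (p e) := (β.map hpc).cast rfl hp
  have hα : F e = F e₀ * Circle.exp (2 * Real.pi * (degree f α' / d)) := by
    have := root_eq_mul_exp (f := f) α' (Γ := fun t => F (α t)) (by fun_prop) fun t => hF _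
    simpa using this
  have hβ : F e' = F e₀ * Circle.exp (2 * Real.pi * (degree f β' / d)) := by
    have := root_eq_mul_exp (f := f) β' (Γ := fun t => F (β t)) (by fun_prop) fun t => hF _
    simpa using this
  rw [hα, hβ, mul_right_inj, circleExp_two_pi_eq_iff] at hFe
  obtain ⟨n, hn⟩ := hFe
  have hdeg := hr.eval_eq_degree hf (α'.trans β'.symm)
  rw [degree_trans hf, degree_symm hf] at hdeg
  have hdvd : (d : ℤ) ∣ eval χ (α'.trans β'.symm) := by
    refine ⟨n, ?_⟩
    have : ((eval χ (α'.trans β'.symm) : ℤ) : ℝ) = ((d * n : ℤ) : ℝ) := by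
      rw [hdeg]
      field_simp at hn
      push_cast
      linarith
    exact_mod_cast this
  obtain ⟨γ, hγ⟩ := (h.lift_closed_iff e₀ rfl _).2 hdvd
  have h1 := h.isCoveringMap.lift_trans_half γ α rfl rfl β'.symm hγ
  have h2 := h.isCoveringMap.lift_trans_half γ.symm β rfl hp.symm α'.symm fun t => by
    change p (γ _) = _
    rw [hγ]
    change (α'.trans β'.symm).symm t = _
    rw [Path.trans_symm, Path.symm_symm]
  rw [← h1, ← h2]
  change _ = γ _
  congr 1
  exact Subtype.ext (by rw [unitInterval.coe_symm_eq]; norm_num)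

/-- Lifting a loop of degree n rotates the root by n/d of a turn. Surjectivity of χ supplies loops
of every degree, so all d roots occur in the fibre. -/
theorem IsCyclicCover.exists_root_eq [NeZero d] (h : IsCyclicCover χ d p)
    (hχ : Function.Surjective χ) (hf : Continuous f)
    (hr : Represents f χ) {F : C(M', Circle)} (hF : ∀ e, F e ^ d = f (p e)) {x : M} {z : Circle}
    (hz : z ^ d = f x) : ∃ e, p e = x ∧ F e = z := by
  obtain ⟨e, rfl⟩ := h.surjective x
  obtain ⟨n, hn⟩ := circle_root_eq_mul_exp (hz.trans (hF e).symm)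
  obtain ⟨g, hg⟩ := hχ (.ofAdd n)
  obtain ⟨γ, rfl⟩ : ∃ γ : Path x₀ x₀, FundamentalGroup.fromPath (Path.Homotopic.Quotient.mk γ) = g := by
    induction g using Quotient.ind with | _ γ => exact ⟨γ, rfl⟩
  have hγ : eval χ γ = n := by rw [eval, hg, toAdd_ofAdd]
  have hγd := hr.eval_eq_degree hf γ
  let σ : Path (p e) x₀ := PathConnectedSpace.somePath _ _
  let τ : Path (p e) (p e) := σ.trans (γ.trans σ.symm)
  have hτ : degree f τ = n := by
    rw [degree_trans hf, degree_trans hf, degree_symm hf, ← hγd, hγ]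
    ring
  obtain ⟨Γ, hΓ, h0⟩ := h.isCoveringMap.exists_path_lifts τ e τ.source
  have h1 := root_eq_mul_exp (f := f) τ (Γ := fun t => F (Γ t)) (by fun_prop) fun t => by
    rw [hF]
    exact congrArg f (congrFun hΓ t)
  refine ⟨Γ 1, (congrFun hΓ 1).trans τ.target, ?_⟩
  rw [h1, hτ, hn, h0]

/-- The cyclic cover as the space of `d`-th roots of `f`. -/
theorem IsCyclicCover.exists_homeomorph [LocallyPathConnectedSpace M'] [NeZero d] (h : IsCyclicCover χ d p)
    (hχ : Function.Surjective χ) (hf : Continuous f) (hr : Represents f χ) :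
    ∃ Φ : M' ≃ₜ {q : M × Circle // q.2 ^ d = f q.1}, ∀ e, (Φ e).1.1 = p e := by
  obtain ⟨F, hF⟩ := h.exists_root hf hr
  have hpc := h.isCoveringMap.continuous
  let Φ : M' → {q : M × Circle // q.2 ^ d = f q.1} := fun e => ⟨(p e, F e), hF e⟩
  have hΦc : Continuous Φ := by fun_prop
  have hΦb : Function.Bijective Φ := by
    refine ⟨fun e e' he => ?_, fun q => ?_⟩
    · have h1 := congrArg Subtype.val he
      exact h.eq_of_root_eq hf hr hF (congrArg Prod.fst h1) (congrArg Prod.snd h1)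
    · obtain ⟨e, he, he'⟩ := h.exists_root_eq hχ hf hr hF q.2
      exact ⟨e, Subtype.ext (Prod.ext he he')⟩
  have hΦo : IsOpenMap Φ := by
    intro U hU
    rw [isOpen_iff_mem_nhds]
    rintro _ ⟨e, he, rfl⟩
    -- The covering map p is open, and near `F e` a root is determined by its d-th power, so nearby
    -- pairs over p(U) are hit from U.
    obtain ⟨V, hV, heV, hinj⟩ :=
      (isCoveringMap_circle_pow d).isLocalHomeomorph.isLocallyInjective (F e)
    have hU' : IsOpen (U ∩ F ⁻¹' V) := hU.inter (hV.preimage F.continuous)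
    have hO : IsOpen {q : {q : M × Circle // q.2 ^ d = f q.1} |
        q.1.1 ∈ p '' (U ∩ F ⁻¹' V) ∧ q.1.2 ∈ V} :=
      ((h.isCoveringMap.isOpenMap _ hU').preimage (by fun_prop)).inter (hV.preimage (by fun_prop))
    refine mem_of_superset (hO.mem_nhds ⟨⟨e, ⟨he, heV⟩, rfl⟩, heV⟩) ?_
    rintro ⟨⟨x, z⟩, hz⟩ ⟨⟨u, ⟨huU, huV⟩, rfl⟩, hzV⟩
    refine ⟨u, huU, Subtype.ext (Prod.ext rfl ?_)⟩
    exact hinj huV hzV ((hF u).trans hz.symm)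
  exact ⟨(Equiv.ofBijective Φ hΦb).toHomeomorphOfContinuousOpen hΦc hΦo, fun _ => rfl⟩

end Cover

/-! ### Cutting the cyclic cover into d slit copies of M. -/

section CoverGluing

/-- The `d`-th root of unity at the angle of `r / d` turns. -/
noncomputable def rootAt (d : ℕ) (r : ℝ) : Circle := Circle.exp (2 * Real.pi * (r / d))

variable {d : ℕ} [NeZero d]

theorem rootAt_eq_iff {r s : ℝ} : rootAt d r = rootAt d s ↔ ∃ n : ℤ, r = s + n * d := by
  have hd : (d : ℝ) ≠ 0 := NeZero.ne _
  rw [rootAt, rootAt, circleExp_two_pi_eq_iff]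
  refine exists_congr fun n => ?_
  field_simp

theorem rootAt_pow (r : ℝ) : rootAt d r ^ d = Circle.exp (2 * Real.pi * r) := by
  have hd : (d : ℝ) ≠ 0 := NeZero.ne _
  rw [rootAt, ← Circle.exp_nsmul, nsmul_eq_mul]
  congr 1
  field_simp

theorem rootAt_add_nat (j : ℕ) (t : ℝ) : rootAt d (t + j) ^ d = Circle.exp (2 * Real.pi * t) := by
  rw [rootAt_pow, circleExp_two_pi_eq_iff]
  exact ⟨j, by simp⟩

theorem continuous_rootAt {d : ℕ} : Continuous (rootAt d) := by
  unfold rootAt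
  fun_prop

theorem exists_rootAt (z : Circle) : ∃ (j : Fin d) (t : unitInterval), z = rootAt d (t + (j : ℕ)) := by
  have hd : (0 : ℝ) < d := by exact_mod_cast NeZero.pos d
  set a := Int.fract (Complex.arg (z : ℂ) / (2 * Real.pi)) with ha
  have hz : z = Circle.exp (2 * Real.pi * a) :=
    (circle_eq_exp_arg _).trans (circleExp_two_pi_eq_iff.2 ⟨_, (Int.fract_add_floor _).symm⟩)
  have h0 : 0 ≤ d * a := mul_nonneg hd.le (Int.fract_nonneg _)
  have h1 : d * a < d := by
    have := mul_lt_mul_of_pos_left (Int.fract_lt_one (Complex.arg (z : ℂ) / (2 * Real.pi))) hd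
    rwa [mul_one] at this
  refine ⟨⟨⌊d * a⌋₊, (Nat.floor_lt h0).2 h1⟩, ⟨d * a - ⌊d * a⌋₊, sub_nonneg.2 (Nat.floor_le h0), ?_⟩, ?_⟩
  · have := Nat.lt_floor_add_one (d * a)
    linarith
  · rw [hz, rootAt]
    congr 2
    change a = (d * a - ⌊d * a⌋₊ + ⌊d * a⌋₊) / d
    field_simp
    ring

theorem fin_eq_add_one_of_int {j k : Fin d} {n : ℤ} (h : (k : ℤ) = (j : ℤ) + 1 + n * d) :
    k = j + 1 := by
  have h1 : ((k : ℕ) : ℤ) ≡ ((j : ℕ) + 1 : ℕ) [ZMOD d] := by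
    rw [Int.modEq_iff_dvd]
    refine ⟨-n, ?_⟩
    push_cast
    linarith
  have h2 := (Int.natCast_modEq_iff).1 h1
  apply Fin.ext
  rw [Fin.val_add, Fin.val_one', Nat.add_mod_mod]
  rw [← Nat.mod_eq_of_lt k.2]
  exact h2

theorem exists_fin_add_one (j : Fin d) : ∃ n : ℤ, (((j + 1 : Fin d) : ℕ) : ℝ) = (j : ℕ) + 1 + n * d := by
  rw [Fin.val_add, Fin.val_one', Nat.add_mod_mod]
  have h := Nat.mod_add_div ((j : ℕ) + 1) d
  generalize ((j : ℕ) + 1) / d = q at h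
  generalize ((j : ℕ) + 1) % d = r at h ⊢
  have h' : (r : ℝ) + d * q = (j : ℕ) + 1 := by exact_mod_cast h
  refine ⟨-q, ?_⟩
  push_cast
  linarith

variable {m : ℕ} [NeZero m] {M : Type*} [TopologicalSpace M] [ChartedSpace (EuclideanHalfSpace m) M]
  {x₀ : M} {χ : FundamentalGroup M x₀ →* Multiplicative ℤ} {M' : Type*} [TopologicalSpace M']

/-- The cyclic cover is glued from copies of the slit manifold. -/
noncomputable def SeifertManifold.cyclicGluing [T2Space M] [CompactSpace M]
    (S : SeifertManifold m χ) (Φ : M' ≃ₜ {q : M × Circle // q.2 ^ d = S.f q.1}) :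
    CyclicGluing d S.incoming S.outgoing M' where
  height := ⟨fun q => q.1.2, by fun_prop⟩
  height_inc _ := rfl
  height_out _ := rfl
  height_mem q := q.1.2.2
  isEmbedding_inc := IsEmbedding.of_comp S.incoming.continuous
    (show Continuous fun q : S.Slit => q.1.1 by fun_prop) IsEmbedding.subtypeVal
  isEmbedding_out := IsEmbedding.of_comp S.outgoing.continuous
    (show Continuous fun q : S.Slit => q.1.1 by fun_prop) IsEmbedding.subtypeVal
  -- Piece j consists of the roots whose argument lies between j/d and (j + 1)/d of a turn.
  piece j := ⟨fun q => Φ.symm ⟨(q.1.1, rootAt d (q.1.2 + (j : ℕ))), by rw [rootAt_add_nat, q.2]⟩, by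
    have := continuous_rootAt (d := d)
    fun_prop⟩
  isClosedMap := by
    have := S.compactSpace_slit
    have : T2Space M' := Φ.symm.t2Space
    refine Continuous.isClosedMap ?_
    refine continuous_prod_of_discrete_left.2 fun j => ?_
    have := continuous_rootAt (d := d)
    refine Φ.symm.continuous.comp (Continuous.subtype_mk (?_ : Continuous fun q : S.Slit =>
      (q.1.1, rootAt d ((q.1.2 : ℝ) + (j : ℕ)))) _)
    fun_prop
  surjective := by
    intro e
    obtain ⟨j, t, ht⟩ := exists_rootAt (d := d) (Φ e).1.2
    have hf : S.f (Φ e).1.1 = Circle.exp (2 * Real.pi * (t : ℝ)) := by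
      rw [← (Φ e).2, ht, rootAt_add_nat]
    refine ⟨(j, ⟨((Φ e).1.1, t), hf⟩), Φ.injective (Subtype.ext (Prod.ext ?_ ?_))⟩
    · simp
    · simp [ht]
  glue j s := by
    refine Φ.symm.injective.eq_iff.2 (Subtype.ext (Prod.ext rfl ?_))
    obtain ⟨n, hn⟩ := exists_fin_add_one j
    change rootAt d (((1 : unitInterval) : ℝ) + (j : ℕ)) =
      rootAt d (((0 : unitInterval) : ℝ) + ((j + 1 : Fin d) : ℕ))
    rw [hn, rootAt_eq_iff]
    refine ⟨-n, ?_⟩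
    push_cast
    simp
    ring
  eq_or {j k e e'} h := by
    have h1 := congrArg Subtype.val (Φ.symm.injective h)
    obtain ⟨⟨x, t⟩, ht⟩ := e
    obtain ⟨⟨x', t'⟩, ht'⟩ := e'
    obtain rfl : x = x' := congrArg Prod.fst h1
    obtain ⟨n, hn⟩ := rootAt_eq_iff.1 (congrArg Prod.snd h1)
    change (t : ℝ) + (j : ℕ) = t' + (k : ℕ) + n * d at hn
    change S.f x = Circle.exp (2 * Real.pi * (t : ℝ)) at ht
    change S.f x = Circle.exp (2 * Real.pi * (t' : ℝ)) at ht'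
    have key : ∀ {s s' : unitInterval} {i l : Fin d} {n : ℤ},
        S.f x = Circle.exp (2 * Real.pi * (s : ℝ)) →
        (s : ℝ) + (i : ℕ) = s' + (l : ℕ) + n * d → s = 0 → s' = 1 → S.f x = 1 ∧ i = l + 1 := by
      rintro s s' i l n hs hn rfl rfl
      refine ⟨by rw [hs]; simp, fin_eq_add_one_of_int (n := n) ?_⟩
      have : ((i : ℕ) : ℝ) = (l : ℕ) + 1 + n * d := by
        simp only [Icc.coe_zero, Icc.coe_one] at hn
        linarith
      exact_mod_cast this
    by_cases htt : t = t'
    · subst htt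
      refine Or.inl ⟨?_, rfl⟩
      have : ((j : ℕ) : ℝ) = (k : ℕ) + n * d := by linarith
      have h2 : ((j : ℕ) : ℤ) = (k : ℕ) + n * d := by exact_mod_cast this
      have h3 : ((j : ℕ) : ℤ) ≡ (k : ℕ) [ZMOD d] := by
        rw [Int.modEq_iff_dvd]
        exact ⟨-n, by linarith⟩
      have h4 := Int.natCast_modEq_iff.1 h3
      exact Fin.ext (h4.eq_of_lt_of_lt j.2 k.2)
    · have h01 := ((S.slit_eq_or ht ht').resolve_left htt).2
      have h01' := ((S.slit_eq_or ht' ht).resolve_left (Ne.symm htt)).2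
      rcases h01 with h0 | h0 <;> rcases h01' with h0' | h0'
      · exact (htt (h0.trans h0'.symm)).elim
      · obtain ⟨hx, hjk⟩ := key ht hn h0 h0'
        subst h0 h0'
        exact Or.inr (Or.inr ⟨⟨x, hx⟩, rfl, hjk, rfl⟩)
      · obtain ⟨hx, hjk⟩ := key (i := k) (l := j) (n := -n) ht' (by push_cast; linarith) h0' h0
        subst h0 h0'
        exact Or.inr (Or.inl ⟨⟨x, hx⟩, rfl, hjk, rfl⟩)
      · exact (htt (h0.trans h0'.symm)).elim

end CoverGluing

/-! ### Closed walks, traces and Cayley–Hamilton. -/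

section Trace

/-- The entry of a power of a counting matrix counts walks. -/
theorem pow_apply_eq_card {V E : Type*} [Fintype V] [DecidableEq V] [Finite E] (s t : E → V)
    (Z : Matrix V V ℤ) (hZ : ∀ v' v, Z v' v = Nat.card {e // s e = v ∧ t e = v'}) (n : ℕ) (v' v : V) :
    (Z ^ (n + 1)) v' v = Nat.card {w : Fin (n + 1) → E // s (w 0) = v ∧ t (w (Fin.last n)) = v' ∧
      ∀ j : Fin n, t (w j.castSucc) = s (w j.succ)} := by
  induction n generalizing v' with
  | zero =>
    rw [show Z ^ (0 + 1) = Z from pow_one Z, hZ]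
    refine congrArg _ (Nat.card_congr ?_)
    refine (Equiv.funUnique (Fin 1) E).symm.subtypeEquiv fun e => ?_
    simp
  | succ n ih =>
    -- The new factor is on the left, so it is the last edge of the walk and `Fin.snoc` appends it.
    rw [pow_succ', Matrix.mul_apply]
    simp_rw [hZ, ih, ← Nat.cast_mul, ← Nat.cast_sum, ← Nat.card_prod]
    rw [← Nat.card_sigma]
    have hsnoc0 : ∀ (w : Fin (n + 1) → E) (e : E), Fin.snoc (α := fun _ => E) w e 0 = w 0 :=
      fun w e => Fin.snoc_castSucc (α := fun _ => E) e w 0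
    refine congrArg _ (Nat.card_congr (Equiv.ofBijective
      (fun x => ⟨Fin.snoc x.2.2.1 x.2.1.1, ?_⟩) ⟨?_, ?_⟩))
    · obtain ⟨u, ⟨e, rfl, rfl⟩, ⟨w, rfl, hw, hw'⟩⟩ := x
      refine ⟨congrArg s (hsnoc0 _ _), by simp, fun j => ?_⟩
      refine Fin.lastCases ?_ (fun j => ?_) j
      · rw [Fin.snoc_castSucc, Fin.succ_last, Fin.snoc_last]
        exact hw
      · rw [Fin.snoc_castSucc, Fin.succ_castSucc, Fin.snoc_castSucc]
        exact hw' j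
    · rintro ⟨_, ⟨e, rfl, he⟩, ⟨w, hw1, hw⟩⟩ ⟨_, ⟨e', rfl, he'⟩, ⟨w', hw1', hw'⟩⟩ h
      have h' : Fin.snoc (α := fun _ => E) w e = Fin.snoc (α := fun _ => E) w' e' :=
        congrArg Subtype.val h
      obtain ⟨h1, h2⟩ := Fin.snoc_injective2 h'
      subst h1 h2
      rfl
    · rintro ⟨w, h1, h2, h3⟩
      refine ⟨⟨s (w (Fin.last _)), ⟨w (Fin.last _), rfl, h2⟩, ⟨Fin.init w, h1, h3 (Fin.last n),
        fun j => ?_⟩⟩, Subtype.ext (Fin.snoc_init_self w)⟩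
      have := h3 j.castSucc
      rwa [Fin.succ_castSucc] at this

/-- The trace of a power of a counting matrix counts closed walks. -/
theorem trace_pow_eq_card {V E : Type*} [Fintype V] [DecidableEq V] [Finite E] (s t : E → V)
    (Z : Matrix V V ℤ) (hZ : ∀ v' v, Z v' v = Nat.card {e // s e = v ∧ t e = v'}) (d : ℕ) [NeZero d] :
    (Z ^ d).trace = Nat.card {w : Fin d → E // ∀ j, t (w j) = s (w (j + 1))} := by
  obtain ⟨n, rfl⟩ := Nat.exists_eq_succ_of_ne_zero (NeZero.ne d)
  rw [Matrix.trace]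
  simp_rw [Matrix.diag_apply]
  rw [Finset.sum_congr rfl fun v _ => pow_apply_eq_card s t Z hZ n v v, ← Nat.cast_sum,
    ← Nat.card_sigma]
  refine congrArg _ (Nat.card_congr ?_)
  refine
    { toFun := fun x => ⟨x.2.1, fun j => ?_⟩
      invFun := fun w => ⟨s (w.1 0), w.1, rfl, ?_, fun j => ?_⟩
      left_inv := ?_
      right_inv := ?_ }
  · obtain ⟨v, w, h1, h2, h3⟩ := x
    refine Fin.lastCases ?_ (fun j => ?_) j
    · rw [Fin.last_add_one]
      exact h2.trans h1.symm
    · rw [Fin.coeSucc_eq_succ]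
      exact h3 j
  · rw [w.2, Fin.last_add_one]
  · rw [w.2, Fin.coeSucc_eq_succ]
  · rintro ⟨v, w, rfl, h2, h3⟩
    rfl
  · exact fun _ => rfl

/-- The traces of the powers of a matrix satisfy the recursion of its characteristic polynomial. -/
theorem sum_charpoly_coeff_mul_trace {V : Type*} [Fintype V] [DecidableEq V] (Z : Matrix V V ℤ)
    (d : ℕ) : ∑ i ∈ Finset.range (Z.charpoly.natDegree + 1),
      Z.charpoly.coeff i * (Z ^ (d + i)).trace = 0 := by
  have h := Matrix.aeval_self_charpoly Z
  rw [Polynomial.aeval_eq_sum_range] at h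
  have h2 := congrArg (fun A => (Z ^ d * A).trace) h
  simp only [Finset.mul_sum, Matrix.trace_sum, mul_zero, Matrix.trace_zero] at h2
  rw [← h2]
  refine Finset.sum_congr rfl fun i _ => ?_
  rw [mul_smul_comm, Matrix.trace_smul, ← pow_add, smul_eq_mul]

end Trace

/-! ### Assembling the count. -/

section Main

variable {G : Type*} [Group G] {m k : ℕ} [NeZero m] [NeZero k]
    {M : Type*} [TopologicalSpace M] [T2Space M]
    [ChartedSpace (EuclideanHalfSpace m) M]
    {N : Type*} [TopologicalSpace N] [CompactSpace N] [ChartedSpace (EuclideanHalfSpace k) N]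
    {x₀ : M} {χ : FundamentalGroup M x₀ →* Multiplicative ℤ}
    {ι : C(N, M)} (S : SeifertManifold m χ)

namespace SeifertManifold

theorem isTamePair_surface [CompactSpace M] (hι : IsInteriorSubmanifold k m ι) (hχN : NontrivialOn χ ι)
    (hS : S.IsTransverse k ι) : IsTamePair (S.surfaceInter (range ι)) := by
  have hcl : IsClosed (range ι) := (isCompact_range ι.continuous).isClosed
  have := S.compactSpace_surface
  have : PreconnectedSpace S.Surface :=
    isPreconnected_iff_preconnectedSpace.1 S.connected.isPreconnected
  obtain ⟨y, hy⟩ := S.nonempty_inter hχN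
  have hne : (S.surfaceInter (range ι)).Nonempty := ⟨⟨ι y, hy⟩, y, rfl⟩
  exact isTamePair_of_convexModel (S.nonempty_convexModel_surface hι hcl hS)
    (hcl.preimage continuous_subtype_val) hne (Collapse.isConnected_univ hne)

theorem isTamePair_slit [CompactSpace M] [PreconnectedSpace M] (hι : IsInteriorSubmanifold k m ι) (hχN : NontrivialOn χ ι)
    (hS : S.IsTransverse k ι) : IsTamePair (S.slitInter (range ι)) := by
  have hcl : IsClosed (range ι) := (isCompact_range ι.continuous).isClosed
  have := S.compactSpace_slit
  obtain ⟨y, hy⟩ := S.nonempty_inter hχN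
  exact isTamePair_of_convexModel (S.nonempty_convexModel_slit hι hcl hS)
    (hcl.preimage (by fun_prop)) ⟨S.incoming ⟨ι y, hy⟩, y, rfl⟩
    (S.isConnected_collapse_slit ⟨ι y, ⟨y, rfl⟩, hy⟩)

theorem pathConnectedSpace_of_convexModel [ConnectedSpace M] (hι : IsInteriorSubmanifold k m ι) :
    PathConnectedSpace M := by
  have := locallyPathConnectedSpace_of_convexModel
    (hι.nonempty_convexModel (isCompact_range ι.continuous).isClosed)
  exact PathConnectedSpace.of_locallyPathConnectedSpace

/-- The homomorphisms from the relative fundamental group of the cyclic cover are the closed walks of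
the slit manifold. -/
theorem finite_and_card_cover [Finite G] [CompactSpace M] [ConnectedSpace M] (hι : IsInteriorSubmanifold k m ι)
    (hχN : NontrivialOn χ ι) (hS : S.IsTransverse k ι) (hχ : Function.Surjective χ) {d : ℕ} [NeZero d]
    {M' : Type*} [TopologicalSpace M'] {p : M' → M} (hp : IsCyclicCover χ d p) :
    Finite (RelPi (p ⁻¹' range ι) →* G) ∧
    Nat.card (RelPi (p ⁻¹' range ι) →* G) = Nat.card {w : Fin d → (RelPi (S.slitInter (range ι)) →* G) //
      ∀ j, (w j).comp (RelPi.map S.outgoing (fun _ hx => hx)) =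
        (w (j + 1)).comp (RelPi.map (A := S.surfaceInter (range ι)) S.incoming (fun _ hx => hx))} := by
  have hcl : IsClosed (range ι) := (isCompact_range ι.continuous).isClosed
  have hmodel := ConvexModel.nonempty_of_isLocalHomeomorph hp.isCoveringMap.isLocalHomeomorph
    (hι.nonempty_convexModel hcl)
  have := pathConnectedSpace_of_convexModel hι
  have := locallyPathConnectedSpace_of_convexModel hmodel
  have := S.compactSpace_surface
  have := S.compactSpace_slit
  have := locallyPathConnectedSpace_of_convexModel (S.nonempty_convexModel_surface hι hcl hS)
  have := locallyPathConnectedSpace_of_convexModel (S.nonempty_convexModel_slit hι hcl hS)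
  have : PreconnectedSpace S.Surface :=
    isPreconnected_iff_preconnectedSpace.1 S.connected.isPreconnected
  obtain ⟨Φ, hΦ⟩ := hp.exists_homeomorph hχ S.continuous_f S.represents
  have : CompactSpace {q : M × Circle // q.2 ^ d = S.f q.1} := by
    have h : IsClosed {q : M × Circle | q.2 ^ d = S.f q.1} :=
      isClosed_eq (by fun_prop) (S.continuous_f.comp continuous_fst)
    exact h.isClosedEmbedding_subtypeVal.compactSpace
  have : CompactSpace M' := Φ.symm.compactSpace
  have : T2Space M' := Φ.symm.t2Space
  have := hp.connected
  obtain ⟨y, hy⟩ := S.nonempty_inter hχN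
  have hne : (p ⁻¹' range ι).Nonempty := by
    obtain ⟨e, he⟩ := hp.surjective (ι y)
    exact ⟨e, y, he.symm⟩
  have htame : IsTamePair (p ⁻¹' range ι) := isTamePair_of_convexModel hmodel
    (hcl.preimage hp.isCoveringMap.continuous) hne (Collapse.isConnected_univ hne)
  have hfin : Finite (RelPi (p ⁻¹' range ι) →* G) := by
    have := finite_relH1_of_convexModel G hmodel
    exact Finite.of_equiv _ htame.homEquiv.symm
  refine ⟨hfin, ?_⟩
  have hE := S.isTamePair_slit hι hχN hS
  have hY := S.isTamePair_surface hι hχN hS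
  let Q := S.cyclicGluing Φ
  have hB : ∀ j q, Q.piece j q ∈ p ⁻¹' range ι ↔ q ∈ S.slitInter (range ι) := fun j q => by
    rw [mem_preimage, ← hΦ]
    change (Φ (Φ.symm _)).1.1 ∈ range ι ↔ _
    rw [Φ.apply_symm_apply]
    rfl
  have hbij := Q.bijective_pull (G := G) (A := p ⁻¹' range ι) (B := S.slitInter (range ι))
    (D := S.surfaceInter (range ι)) ⟨⟨ι y, hy⟩, y, rfl⟩ (fun j q hq => (hB j q).2 hq)
    (fun _ hx => hx) (fun _ hx => hx) hB (fun _ => Iff.rfl) (fun _ => Iff.rfl)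
  -- From homomorphisms to classes on the cover, then to cyclic sequences of classes on the slit
  -- manifold, and back to homomorphisms piece by piece; naturality matches the seam conditions.
  rw [Nat.card_congr htame.homEquiv, Nat.card_congr (Equiv.ofBijective _ hbij)]
  refine (Nat.card_congr ((Equiv.piCongrRight fun _ : Fin d => hE.homEquiv).subtypeEquiv
    fun w => forall_congr' fun j => ?_)).symm
  have h1 := hY.homEquiv_comp hE S.outgoing (fun _ hx => hx) (w j)
  have h2 := hY.homEquiv_comp hE S.incoming (fun _ hx => hx) (w (j + 1))
  exact hY.homEquiv.injective.eq_iff.symm.trans (Iff.of_eq (congrArg₂ Eq h1 h2))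

end SeifertManifold

end Main

end CyclicTQFT


open CyclicTQFT in
theorem proposition2p6 {G : Type*} [Group G] [Finite G]
    {m k : ℕ} [NeZero m] [NeZero k]
    {M : Type*} [TopologicalSpace M] [T2Space M] [CompactSpace M] [ConnectedSpace M]
    [ChartedSpace (EuclideanHalfSpace m) M] [IsManifold (𝓡∂ m) ∞ M]
    {N : Type*} [TopologicalSpace N] [CompactSpace N]
    [ChartedSpace (EuclideanHalfSpace k) N] [IsManifold (𝓡∂ k) ∞ N]
    {x₀ : M} (χ : FundamentalGroup M x₀ →* Multiplicative ℤ) (hχ : Function.Surjective χ)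
    (ι : C(N, M)) (hι : IsInteriorSubmanifold k m ι) (hχN : NontrivialOn χ ι)
    (S : SeifertManifold m χ) (hS : S.IsTransverse k ι)
    {Md : ℕ → Type*} [∀ d, TopologicalSpace (Md d)] (p : ∀ d, Md d → M)
    (hp : ∀ d, 1 ≤ d → IsCyclicCover χ d (p d)) :
    Finite (RelPi (S.surfaceInter (Set.range ι)) →* G) ∧
    Finite (RelPi (S.slitInter (Set.range ι)) →* G) ∧
    (∀ d, 1 ≤ d → Finite (RelPi (p d ⁻¹' Set.range ι) →* G)) ∧
    ∀ [Fintype (RelPi (S.surfaceInter (Set.range ι)) →* G)]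
      [DecidableEq (RelPi (S.surfaceInter (Set.range ι)) →* G)] (P : Polynomial ℤ),
      P = ((S.matrix G (Set.range ι)).map (Nat.cast : ℕ → ℤ)).charpoly →
      ∀ d, 1 ≤ d → ∑ i ∈ Finset.range (P.natDegree + 1),
        P.coeff i * (Nat.card (RelPi (p (d + i) ⁻¹' Set.range ι) →* G) : ℤ) = 0 := by
  have hcl : IsClosed (Set.range ι) := (isCompact_range ι.continuous).isClosed
  have := S.compactSpace_surface
  have := S.compactSpace_slit
  have hYm := S.nonempty_convexModel_surface hι hcl hS
  have hEm := S.nonempty_convexModel_slit hι hcl hS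
  have := locallyPathConnectedSpace_of_convexModel hYm
  have := locallyPathConnectedSpace_of_convexModel hEm
  have := finite_relH1_of_convexModel G hYm
  have := finite_relH1_of_convexModel G hEm
  have hYf : Finite (RelPi (S.surfaceInter (Set.range ι)) →* G) :=
    Finite.of_equiv _ (S.isTamePair_surface hι hχN hS).homEquiv.symm
  have hEf : Finite (RelPi (S.slitInter (Set.range ι)) →* G) :=
    Finite.of_equiv _ (S.isTamePair_slit hι hχN hS).homEquiv.symm
  refine ⟨hYf, hEf, fun d hd => ?_, ?_⟩
  · have : NeZero d := ⟨Nat.one_le_iff_ne_zero.1 hd⟩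
    exact (S.finite_and_card_cover hι hχN hS hχ (hp d hd)).1
  · rintro _ _ P rfl d hd
    refine Eq.trans ?_ (sum_charpoly_coeff_mul_trace
      ((S.matrix G (Set.range ι)).map (Nat.cast : ℕ → ℤ)) d)
    refine Finset.sum_congr rfl fun i _ => ?_
    -- The identification of the trace with a count of closed walks needs a positive exponent, which
    -- d ≥ 1 guarantees even at i = 0.
    have : NeZero (d + i) := ⟨by omega⟩
    rw [(S.finite_and_card_cover hι hχN hS hχ (hp (d + i) (by omega))).2]
    exact congrArg _ (trace_pow_eq_card (fun δ : RelPi (S.slitInter (Set.range ι)) →* G =>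
        δ.comp (RelPi.map (A := S.surfaceInter (Set.range ι)) S.incoming fun _ hx => hx))
      (fun δ => δ.comp (RelPi.map S.outgoing fun _ hx => hx))
      ((S.matrix G (Set.range ι)).map (Nat.cast : ℕ → ℤ)) (fun _ _ => rfl) (d + i)).symm
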